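/- **Setting.** For a measurable $E\subset\mathbb R^2$ let $P(E)=\sup\{\int_E\operatorname{div}T: T\in C^1_c(\mathbb R^2;\mathbb R^2),\ |T|\le1\}$. A *double bubble* is a pair $\mathcal E=(\mathcal E(1),\mathcal E(2))$ of sets of finite perimeter in $\mathbb R^2$ with $0<|\mathcal E(h)|<\infty$ and $|\mathcal E(1)\cap\mathcal E(2)|=0$; put $\mathcal E(0)=\mathbb R^2\setminus(\mathcal E(1)\cup\mathcal E(2))$, $\mathrm{vol}(\mathcal E)=(|\mathcal E(1)|,|\mathcal E(2)|)$ and $P(\mathcal E)=\frac12\sum_{h=0}^2P(\mathcal E(h))$. For $\theta\in(0,\pi)$ and $u:[-\theta,\theta]\to\mathbb R$ let $A(\theta,u)=\{(1+u(t))(\cos t,\sin t):|t|<\theta\}$, and for $v:[-\frac{\sqrt3}2,\frac{\sqrt3}2]\to\mathbb R$ let $H(v)=\{(v(t),t):|t|<\frac{\sqrt3}2\}$; write $\overline A(\theta,u)$, $\overline H(v)$ for the same curves with their end points. "$u\in C^1_0$ on $(-a,a)$ with $\|u\|_{C^1}\le\varepsilon$" means: $u$ is continuous on $[-a,a]$,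 vanishes at $\pm a$, is $C^1$ in $(-a,a)$, and $|u|,|u'|\le\varepsilon$ there. *Case $m_2>m_1>0$.* Let $r_0,r_1,r_2>0$ and $\theta_0,\theta_1,\theta_2\in(0,\pi)$ satisfy $r_0\sin\theta_0=r_1\sin\theta_1=r_2\sin\theta_2$, $\theta_1+\theta_0=\theta_2-\theta_0=\frac{2\pi}3$, and let $L_0,L_1,L_2$ be the isometries $L_kx=(x_1-r_k\cos\theta_k,x_2)$ for $k=0,2$ and $L_1x=(r_1\cos\theta_1-x_1,x_2)$. For $\sigma\in\mathbb R$ and functions $u_k$ consider the conditions $$\partial\mathcal E(1)\setminus\partial\mathcal E(2)=(1+\sigma)L_1r_1A(\theta_1,u_1),\quad \partial\mathcal E(2)\setminus\partial\mathcal E(1)=(1+\sigma)L_2r_2A(\theta_2,u_2),\quad \partial\mathcal E(1)\cap\partial\mathcal E(2)=(1+\sigma)L_0r_0\overline A(\theta_0,u_0).\tag{$*$}$$ The reference standard double bubble $\mathcal E_0$ with $\mathrm{vol}(\mathcal E_0)=(m_1,m_2)$ is the double bubble with these volumes satisfying $(*)$ for such $r_k,\theta_k$ with $\sigma=0$, $u_k=0$.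 An *$(\varepsilon,\sigma)$-perturbation* of $\mathcal E_0$, with functions $u_0,u_1,u_2$, is a double bubble $\mathcal E$ with $\mathrm{vol}(\mathcal E)=\mathrm{vol}(\mathcal E_0)$ satisfying $(*)$ with $u_k\in C^1_0$ on $(-\theta_k,\theta_k)$, $\|u_k\|_{C^1}\le\varepsilon$, $k=0,1,2$. *Case $m_2=m_1>0$.* The same definitions with $r_1=r_2=r>0$, $\theta_1=\theta_2=\frac{2\pi}3$ and the last condition in $(*)$ replaced by $\partial\mathcal E(1)\cap\partial\mathcal E(2)=(1+\sigma)\,r\,\overline H(v_0)$, where $v_0\in C^1_0$ on $(-\frac{\sqrt3}2,\frac{\sqrt3}2)$ with $\|v_0\|_{C^1}\le\varepsilon$ (and $v_0=0$ for $\mathcal E_0$). **Theorem 3.3 (Fuglede double-bubble).** For every $\rho\in(0,1]$ there are $\varepsilon_1,\sigma_1,\kappa>0$, depending on $\rho$ only, such that for all $m_2\ge m_1>0$ with $m_1/m_2=\rho$ there is $\kappa_1>0$ with the following property. Let $\mathcal E$ be an $(\varepsilon,\sigma)$-perturbation of $\mathcal E_0$, where $\mathrm{vol}(\mathcal E_0)=(m_1,m_2)$,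 $0<\varepsilon<\varepsilon_1$ and $|\sigma|<\sigma_1$. If $m_2>m_1$, then $$P(\mathcal E)-P(\mathcal E_0)\ge\kappa_1\Big(\sigma^2+\sum_{k=0}^2r_k\int_{-\theta_k}^{\theta_k}u_k^2\Big)\quad\text{and}\quad P(\mathcal E)-P(\mathcal E_0)\ge\kappa\Big(r_2\,\sigma^2+\sum_{k=0}^2r_k\int_{-\theta_k}^{\theta_k}u_k^2\Big).$$ If $m_2=m_1$, then $$P(\mathcal E)-P(\mathcal E_0)\ge\kappa_1\Big(\sigma^2+r\int_{-\sqrt3/2}^{\sqrt3/2}v_0^2+\sum_{k=1}^2r\int_{-2\pi/3}^{2\pi/3}u_k^2\Big)\quad\text{and}\quad P(\mathcal E)-P(\mathcal E_0)\ge\kappa\Big(r\,\sigma^2+r\int_{-\sqrt3/2}^{\sqrt3/2}v_0^2+\sum_{k=1}^2r\int_{-2\pi/3}^{2\pi/3}u_k^2\Big).$$ -/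

import Mathlib

open MeasureTheory Set
open scoped ENNReal

noncomputable section

/-- The Euclidean plane. -/
abbrev Plane : Type := EuclideanSpace ℝ (Fin 2)

/-- Divergence of a planar vector field. -/
def divergence (T : Plane → Plane) (x : Plane) : ℝ :=
  ∑ i : Fin 2, (fderiv ℝ T x (EuclideanSpace.single i 1)) i

/-- Distributional perimeter of a (Lebesgue measurable) set: the supremum of `∫_E div T` over
compactly supported `C¹` fields `T` with `|T| ≤ 1`. -/
def distPerimeter (E : Set Plane) : ℝ≥0∞ :=
  ⨆ (T : Plane → Plane) (_ : ContDiff ℝ 1 T) (_ : HasCompactSupport T) (_ : ∀ x, ‖T x‖ ≤ 1),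
    ENNReal.ofReal (∫ x in E, divergence T x)

/-- A planar double bubble: two essentially disjoint sets of finite perimeter, of positive and
finite area. -/
structure DoubleBubble where
  chamber₁ : Set Plane
  chamber₂ : Set Plane
  measurable₁ : NullMeasurableSet chamber₁ volume
  measurable₂ : NullMeasurableSet chamber₂ volume
  finitePerimeter₁ : distPerimeter chamber₁ < ∞
  finitePerimeter₂ : distPerimeter chamber₂ < ∞
  volume_pos₁ : 0 < volume chamber₁
  volume_pos₂ : 0 < volume chamber₂
  volume_lt_top₁ : volume chamber₁ < ∞
  volume_lt_top₂ : volume chamber₂ < ∞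
  disjoint : volume (chamber₁ ∩ chamber₂) = 0

namespace DoubleBubble

/-- The exterior chamber. -/
def exterior (E : DoubleBubble) : Set Plane := (E.chamber₁ ∪ E.chamber₂)ᶜ

/-- The pair of areas of the two chambers. -/
def vol (E : DoubleBubble) : ℝ × ℝ := (volume.real E.chamber₁, volume.real E.chamber₂)

/-- The perimeter of a double bubble: half the sum of the perimeters of its three chambers
(all three are finite, the exterior one being at most the sum of the other two). -/
def perimeter (E : DoubleBubble) : ℝ :=
  (1 / 2) * ((distPerimeter E.exterior).toReal + (distPerimeter E.chamber₁).toReal +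
    (distPerimeter E.chamber₂).toReal)

/-- The interfaces of `E` are the exterior interface `Γ₁` of the first chamber, the exterior
interface `Γ₂` of the second chamber, and the common interface `Γ₀` of the two chambers. -/
structure HasInterfaces (E : DoubleBubble) (Γ₁ Γ₂ Γ₀ : Set Plane) : Prop where
  left : frontier E.chamber₁ \ frontier E.chamber₂ = Γ₁
  right : frontier E.chamber₂ \ frontier E.chamber₁ = Γ₂
  common : frontier E.chamber₁ ∩ frontier E.chamber₂ = Γ₀

end DoubleBubble

/-- The part of the perturbed unit circular arc with angular parameter in `s`; a function on
the unit circle is written as a function of the angle. For `s = (-θ, θ)` this is the open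
perturbed arc `A(θ, u)`, for `s = [-θ, θ]` it is the closed one. -/
def perturbedArc (s : Set ℝ) (u : ℝ → ℝ) : Set Plane :=
  (fun t : ℝ => (1 + u t) • !₂[Real.cos t, Real.sin t]) '' s

/-- The part of the horizontally perturbed vertical segment with vertical parameter in `s`. -/
def perturbedSegment (s : Set ℝ) (v : ℝ → ℝ) : Set Plane :=
  (fun t : ℝ => !₂[v t, t]) '' s

/-- The translation carrying the arc of radius `r` and half-aperture `θ` that is centred at the
origin and symmetric about the positive horizontal axis to the one whose end points are
`(0, ± r sin θ)`. -/
def rightIsometry (r θ : ℝ) (x : Plane) : Plane := !₂[x 0 - r * Real.cos θ, x 1]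

/-- The map `rightIsometry r θ` followed by the reflection across the vertical axis. -/
def leftIsometry (r θ : ℝ) (x : Plane) : Plane := !₂[r * Real.cos θ - x 0, x 1]

/-- The curve `(1 + σ) L r A(θ, u)`, with `L = rightIsometry r θ`. -/
def rightArc (σ r θ : ℝ) (s : Set ℝ) (u : ℝ → ℝ) : Set Plane :=
  (fun x : Plane => (1 + σ) • rightIsometry r θ (r • x)) '' perturbedArc s u

/-- The curve `(1 + σ) L r A(θ, u)`, with `L = leftIsometry r θ`. -/
def leftArc (σ r θ : ℝ) (s : Set ℝ) (u : ℝ → ℝ) : Set Plane :=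
  (fun x : Plane => (1 + σ) • leftIsometry r θ (r • x)) '' perturbedArc s u

/-- The curve `(1 + σ) r H(v)`. -/
def midSegment (σ r : ℝ) (s : Set ℝ) (v : ℝ → ℝ) : Set Plane :=
  (fun x : Plane => (1 + σ) • (r • x)) '' perturbedSegment s v

/-- `u` is of class `C¹` in `(-a, a)`, is continuous up to the end points and vanishes there,
and `sup |u| ≤ ε`, `sup |u'| ≤ ε`. -/
structure IsC1ZeroLe (a ε : ℝ) (u : ℝ → ℝ) : Prop where
  continuousOn : ContinuousOn u (Icc (-a) a)
  contDiffOn : ContDiffOn ℝ 1 u (Ioo (-a) a)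
  left_zero : u (-a) = 0
  right_zero : u a = 0
  abs_le : ∀ t ∈ Ioo (-a) a, |u t| ≤ ε
  abs_deriv_le : ∀ t ∈ Ioo (-a) a, |deriv u t| ≤ ε

/-- Radii and half-apertures of three circular arcs with common end points that meet there at
120 degrees; the index 0 is the common interface, 1 and 2 are the exterior interfaces of the
two chambers. -/
structure BubbleGeometry where
  r : Fin 3 → ℝ
  θ : Fin 3 → ℝ
  r_pos : ∀ k, 0 < r k
  θ_pos : ∀ k, 0 < θ k
  θ_lt_pi : ∀ k, θ k < Real.pi
  sin_eq₁ : r 0 * Real.sin (θ 0) = r 1 * Real.sin (θ 1)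
  sin_eq₂ : r 0 * Real.sin (θ 0) = r 2 * Real.sin (θ 2)
  angle₁ : θ 1 + θ 0 = 2 * Real.pi / 3
  angle₂ : θ 2 - θ 0 = 2 * Real.pi / 3

/-- The interfaces of `E` are the three arcs of `g`, perturbed by `u₀, u₁, u₂` and then dilated
by `1 + σ`. The two singular points lie on the boundaries of both chambers, so they belong to
the common interface. -/
def HasArcInterfaces (g : BubbleGeometry) (σ : ℝ) (u : Fin 3 → ℝ → ℝ) (E : DoubleBubble) :
    Prop :=
  E.HasInterfaces
    (leftArc σ (g.r 1) (g.θ 1) (Ioo (-g.θ 1) (g.θ 1)) (u 1))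
    (rightArc σ (g.r 2) (g.θ 2) (Ioo (-g.θ 2) (g.θ 2)) (u 2))
    (rightArc σ (g.r 0) (g.θ 0) (Icc (-g.θ 0) (g.θ 0)) (u 0))

/-- Reference standard double bubble with chambers of different area: singular points on the
vertical axis, symmetric about the origin. -/
def IsReferenceBubble (g : BubbleGeometry) (E₀ : DoubleBubble) : Prop :=
  HasArcInterfaces g 0 (fun _ _ => 0) E₀

/-- `E` is an `(ε, σ)`-perturbation of `E₀`, with functions `u 0, u 1, u 2`. -/
structure IsPerturbation (g : BubbleGeometry) (E₀ : DoubleBubble) (ε σ : ℝ)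
    (u : Fin 3 → ℝ → ℝ) (E : DoubleBubble) : Prop where
  vol_eq : E.vol = E₀.vol
  small : ∀ k, IsC1ZeroLe (g.θ k) ε (u k)
  interfaces : HasArcInterfaces g σ u E

/-- Analogue of `HasArcInterfaces` for chambers of equal area: two arcs of radius `r` and
half-aperture `2π/3`, perturbed by `u₁, u₂`, and a segment of length `√3 r`, perturbed
by `v₀`. -/
def HasSymInterfaces (r σ : ℝ) (v₀ u₁ u₂ : ℝ → ℝ) (E : DoubleBubble) : Prop :=
  E.HasInterfaces
    (leftArc σ r (2 * Real.pi / 3) (Ioo (-(2 * Real.pi / 3)) (2 * Real.pi / 3)) u₁)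
    (rightArc σ r (2 * Real.pi / 3) (Ioo (-(2 * Real.pi / 3)) (2 * Real.pi / 3)) u₂)
    (midSegment σ r (Icc (-(√3 / 2)) (√3 / 2)) v₀)

/-- Reference standard double bubble with chambers of equal area. -/
def IsSymReferenceBubble (r : ℝ) (E₀ : DoubleBubble) : Prop :=
  0 < r ∧ HasSymInterfaces r 0 (fun _ => 0) (fun _ => 0) (fun _ => 0) E₀

/-- `E` is an `(ε, σ)`-perturbation of the symmetric bubble `E₀`, with functions
`v₀, u₁, u₂`. -/
structure IsSymPerturbation (r : ℝ) (E₀ : DoubleBubble) (ε σ : ℝ) (v₀ u₁ u₂ : ℝ → ℝ)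
    (E : DoubleBubble) : Prop where
  vol_eq : E.vol = E₀.vol
  small₀ : IsC1ZeroLe (√3 / 2) ε v₀
  small₁ : IsC1ZeroLe (2 * Real.pi / 3) ε u₁
  small₂ : IsC1ZeroLe (2 * Real.pi / 3) ε u₂
  interfaces : HasSymInterfaces r σ v₀ u₁ u₂ E

end

noncomputable section

/-! ### One-dimensional inequalities -/

/-! The argument has an analytic half, which bounds explicit integrals from below, and a geometric
half, which identifies perimeter and areas with these integrals.

Analytic half. Rescale so that the singular points of the reference bubble are at distance 2. The
interface of half-aperture θ then has curvature `sin θ`. Subtracting from each length change the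
curvature times the enclosed area change leaves an excess that is `∫ (u'² - u²) / 2` to second
order. The 120 degree condition and the two area constraints cancel all first order terms
(`standard_perimeter_eq`, `perimeter_balance`): the perimeter gap is exactly a term quadratic in σ
plus `1 + σ` times the sum of the excesses. An excess may be negative when θ exceeds π/2, but only
through the area change A of its arc: `IsC1ZeroLe.poincare_mean` bounds it below, up to small
errors, by `segmentStiffness θ * A² / 2` plus a multiple of `∫ u²`. The stiffness is the derivative
of curvature with respect to area and has the sign of `cos θ`. The constraints leave two free
parameters, the dilation x and the area y exchanged across the common interface, so stability
reduces to positivity of a quadratic form in (x, y). This is `exists_form_ge`, or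
`exists_form_ge_sym` for equal areas: the dilation term and the positive stiffness of the common
interface absorb the negative stiffness of the exterior arcs. Strict positivity leaves room for the
higher order errors (`exists_stability_of_form_ge`).

Geometric half. Only the topological frontiers of the chambers are prescribed, whereas perimeter is
a supremum over test fields. Seen from the centre of its exterior arc, each chamber has a frontier
that meets every ray exactly once: the exterior arc is a polar graph and the common interface fills
the remaining angles. Connectedness and finiteness of the area then force the chamber to be a union
of two cones up to a null set (`mem_of_frontier_star`). Gauss–Green holds on a cone over a C¹ arc
(`integral_cone_divergence`), the side contributions of the two cones cancel, and test fields close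
to the unit normals turn fluxes into lengths (`distPerimeter_eq_of_flux`). The field `x / 2` yields
the areas.

Uniformity. Since `segmentArea` is convex in the aperture, the area ratio determines the shape
(`eq_of_area_ratio_eq`). All remaining dependence on the bubble is a dilation, so the constants
depend on the ratio only. -/

theorem Measurable.intervalIntegrable_of_abs_le {f : ℝ → ℝ} {M : ℝ} (hf : Measurable f)
    (hM : ∀ t, |f t| ≤ M) (a b : ℝ) : IntervalIntegrable f volume a b := by
  refine (intervalIntegrable_const (c := M)).mono_fun hf.aestronglyMeasurable ?_
  refine Filter.Eventually.of_forall fun t => ?_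
  simpa using (hM t).trans (le_abs_self M)

theorem Measurable.intervalIntegrable_sq_of_abs_le {f : ℝ → ℝ} {M : ℝ} (hf : Measurable f)
    (hM : ∀ t, |f t| ≤ M) (a b : ℝ) : IntervalIntegrable (fun t => f t ^ 2) volume a b := by
  refine (hf.pow_const 2).intervalIntegrable_of_abs_le (M := M ^ 2) (fun t => ?_) a b
  rw [abs_pow]
  exact pow_le_pow_left₀ (abs_nonneg _) (hM t) 2

/-- Dirichlet–Poincaré inequality, subcritical length. -/
theorem poincare_of_lt {a b μ M : ℝ} {f f' : ℝ → ℝ} {S : Set ℝ} (hab : a ≤ b) (hμ : 0 < μ)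
    (hL : μ * (b - a) < Real.pi) (hS : S.Countable) (hf : ContinuousOn f (Icc a b))
    (hd : ∀ t ∈ Ioo a b \ S, HasDerivAt f (f' t) t) (hm : Measurable f')
    (hM : ∀ t, |f' t| ≤ M) (ha : f a = 0) (hb : f b = 0) :
    μ ^ 2 * ∫ t in a..b, f t ^ 2 ≤ ∫ t in a..b, f' t ^ 2 := by
  -- Half of the slack in `hL`: shifting the phase by δ keeps the argument strictly inside (0, π) on
  -- the closed interval. The cotangent `C` is therefore regular up to the end points and solves the
  -- Riccati equation `C' = -μ (1 + C²)`.
  set δ := (Real.pi - μ * (b - a)) / 2 with hδ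
  have hδ0 : 0 < δ := by rw [hδ]; linarith
  have hs : ∀ t ∈ Icc a b, 0 < Real.sin (μ * (t - a) + δ) := by
    intro t ht
    apply Real.sin_pos_of_pos_of_lt_pi
    · have := mul_nonneg hμ.le (sub_nonneg.2 ht.1); linarith
    · have : μ * (t - a) ≤ μ * (b - a) := by gcongr; exact ht.2
      rw [hδ]; linarith
  set C : ℝ → ℝ := fun t => Real.cos (μ * (t - a) + δ) / Real.sin (μ * (t - a) + δ) with hC
  have hCc : ContinuousOn C (Icc a b) := by
    apply ContinuousOn.div (by fun_prop) (by fun_prop)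
    intro t ht; exact (hs t ht).ne'
  have hCd : ∀ t ∈ Icc a b, HasDerivAt C (-μ * (1 + C t ^ 2)) t := by
    intro t ht
    have h0 : HasDerivAt (fun t => μ * (t - a) + δ) μ t := by
      simpa using (((hasDerivAt_id t).sub_const a).const_mul μ).add_const δ
    have h := (h0.cos).div (h0.sin) (hs t ht).ne'
    refine h.congr_deriv ?_
    have := (hs t ht).ne'
    rw [show C t = Real.cos (μ * (t - a) + δ) / Real.sin (μ * (t - a) + δ) from rfl]
    field_simp
    ring
  have huI : uIcc a b = Icc a b := uIcc_of_le hab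
  have i1 : IntervalIntegrable (fun t => f' t * (2 * μ * f t * C t)) volume a b := by
    refine (hm.intervalIntegrable_of_abs_le hM a b).mul_continuousOn ?_
    rw [huI]
    exact (continuousOn_const.mul hf).mul hCc
  have i2 : IntervalIntegrable (fun t => μ ^ 2 * f t ^ 2 * (1 + C t ^ 2)) volume a b := by
    apply ContinuousOn.intervalIntegrable
    rw [huI]
    exact (continuousOn_const.mul (hf.pow 2)).mul (continuousOn_const.add (hCc.pow 2))
  -- The square `(f' - μ f C)²` equals `f'² - μ² f²` minus the derivative of `μ f² C`, and that
  -- derivative integrates to zero because f vanishes at both ends.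
  have hFTC := integral_eq_of_hasDerivAt_off_countable_of_le (fun t => f t ^ 2 * (μ * C t))
    (fun t => f' t * (2 * μ * f t * C t) - μ ^ 2 * f t ^ 2 * (1 + C t ^ 2)) hab hS
    ((hf.pow 2).mul (continuousOn_const.mul hCc)) (by
      intro t ht
      have h := ((hd t ht).pow 2).mul ((hCd t (Ioo_subset_Icc_self ht.1)).const_mul μ)
      refine h.congr_deriv ?_
      simp only [Pi.pow_apply]
      ring) (i1.sub i2)
  simp only [ha, hb] at hFTC
  have i3 := hm.intervalIntegrable_sq_of_abs_le hM a b
  have i4 : IntervalIntegrable (fun t => μ ^ 2 * f t ^ 2) volume a b := by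
    apply ContinuousOn.intervalIntegrable
    rw [huI]
    exact continuousOn_const.mul (hf.pow 2)
  have hmono : ∫ t in a..b, (f' t * (2 * μ * f t * C t) - μ ^ 2 * f t ^ 2 * (1 + C t ^ 2)) ≤
      ∫ t in a..b, (f' t ^ 2 - μ ^ 2 * f t ^ 2) := by
    apply intervalIntegral.integral_mono_on hab (i1.sub i2) (i3.sub i4)
    intro t _
    nlinarith [sq_nonneg (f' t - μ * f t * C t)]
  rw [hFTC, intervalIntegral.integral_sub i3 i4, intervalIntegral.integral_const_mul] at hmono
  simp at hmono
  linarith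

/-- Dirichlet–Poincaré inequality. -/
theorem poincare_of_le {a b μ M : ℝ} {f f' : ℝ → ℝ} {S : Set ℝ} (hab : a ≤ b) (hμ : 0 < μ)
    (hL : μ * (b - a) ≤ Real.pi) (hS : S.Countable) (hf : ContinuousOn f (Icc a b))
    (hd : ∀ t ∈ Ioo a b \ S, HasDerivAt f (f' t) t) (hm : Measurable f')
    (hM : ∀ t, |f' t| ≤ M) (ha : f a = 0) (hb : f b = 0) :
    μ ^ 2 * ∫ t in a..b, f t ^ 2 ≤ ∫ t in a..b, f' t ^ 2 := by
  have hlim : Filter.Tendsto (fun ν : ℝ => ν ^ 2 * ∫ t in a..b, f t ^ 2) (nhdsWithin μ (Iio μ))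
      (nhds (μ ^ 2 * ∫ t in a..b, f t ^ 2)) := by
    apply Filter.Tendsto.mono_left _ nhdsWithin_le_nhds
    exact ((continuous_pow 2).mul continuous_const).tendsto μ
  refine le_of_tendsto hlim ?_
  filter_upwards [Ioo_mem_nhdsLT hμ] with ν hν
  refine poincare_of_lt hab hν.1 ?_ hS hf hd hm hM ha hb
  rcases hab.eq_or_lt with h | h
  · simp [h, Real.pi_pos]
  · have : ν * (b - a) < μ * (b - a) := mul_lt_mul_of_pos_right hν.2 (by linarith)
    linarith

/-- Wirtinger inequality for a function of mean zero supported in `[-θ, θ]`, where `θ ≤ Θ`, as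
a `2Θ`-periodic function. -/
theorem wirtinger_of_support {θ Θ M : ℝ} {v v' : ℝ → ℝ} {S : Set ℝ} (hΘ : 0 < Θ) (hθ : θ ≤ Θ)
    (hS : S.Countable) (hv : Continuous v) (hd : ∀ t ∉ S, HasDerivAt v (v' t) t)
    (hm : Measurable v') (hM : ∀ t, |v' t| ≤ M) (h0 : ∀ t, θ ≤ |t| → v t = 0)
    (h0' : ∀ t, θ ≤ |t| → v' t = 0) (hmean : ∫ t in (-Θ)..Θ, v t = 0) :
    (Real.pi / Θ) ^ 2 * ∫ t in (-Θ)..Θ, v t ^ 2 ≤ ∫ t in (-Θ)..Θ, v' t ^ 2 := by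
  have hz : ∀ t, Θ ≤ |t| → v t = 0 := fun t ht => h0 t (hθ.trans ht)
  have hz' : ∀ t, Θ ≤ |t| → v' t = 0 := fun t ht => h0' t (hθ.trans ht)
  have hμ : 0 < Real.pi / Θ := by positivity
  -- Half a period apart, v takes a common value k: the difference is `-v 0` at `-Θ` and `v 0` at 0,
  -- so it has a zero. Then `v - k` satisfies Dirichlet conditions on two complementary half-periods
  -- of length Θ.
  obtain ⟨a, ha, hak⟩ : ∃ a ∈ Icc (-Θ) 0, v a - v (a + Θ) = 0 := by
    have e1 : v (-Θ) = 0 := hz _ (by rw [abs_neg, abs_of_pos hΘ])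
    have e2 : v Θ = 0 := hz _ (by rw [abs_of_pos hΘ])
    have hc : ContinuousOn (fun a => v a - v (a + Θ)) (uIcc (-Θ) 0) := by fun_prop
    have := intermediate_value_uIcc hc
    rw [uIcc_of_le (by linarith : -Θ ≤ 0)] at this
    apply this
    simp only [neg_add_cancel, zero_add, e1, e2, zero_sub, sub_zero]
    rw [mem_uIcc]
    rcases le_total 0 (v 0) with h | h
    · left; constructor <;> linarith
    · right; constructor <;> linarith
  set k := v a with hk
  have hk2 : v (a + Θ) = k := by linarith
  have key1 := poincare_of_le (a := a) (b := a + Θ) (μ := Real.pi / Θ) (f := fun t => v t - k)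
    (f' := v') (S := S) (M := M) (by linarith) hμ
    (by rw [add_sub_cancel_left, div_mul_cancel₀ _ hΘ.ne']) hS (by fun_prop)
    (fun t ht => (hd t ht.2).sub_const k) hm hM (by simp [hk]) (by simp [hk2])
  set S' : Set ℝ := S ∪ (fun t => t - 2 * Θ) ⁻¹' S with hS'
  have hS'c : S'.Countable := by
    refine hS.union (hS.preimage_of_injOn ?_)
    intro x _ y _ h
    simpa using h
  have hsum : ∀ t, v' t * v' (t - 2 * Θ) = 0 := by
    intro t
    rcases le_or_gt Θ |t| with h | h
    · simp [hz' t h]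
    · rw [hz' (t - 2 * Θ), mul_zero]
      rw [abs_lt] at h
      rw [abs_of_neg (by linarith)]
      linarith
  have hsum0 : ∀ t, v t * v (t - 2 * Θ) = 0 := by
    intro t
    rcases le_or_gt Θ |t| with h | h
    · simp [hz t h]
    · rw [hz (t - 2 * Θ), mul_zero]
      rw [abs_lt] at h
      rw [abs_of_neg (by linarith)]
      linarith
  -- On this half-period `v t + v (t - 2 * Θ)` is the periodic extension of v: the support condition
  -- makes at least one of the two terms vanish, so squares split without cross terms.
  have key2 := poincare_of_le (a := a + Θ) (b := a + 2 * Θ) (μ := Real.pi / Θ)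
    (f := fun t => v t + v (t - 2 * Θ) - k)
    (f' := fun t => v' t + v' (t - 2 * Θ)) (S := S') (M := M + M) (by linarith) hμ
    (by rw [show a + 2 * Θ - (a + Θ) = Θ by ring, div_mul_cancel₀ _ hΘ.ne']) hS'c (by fun_prop)
    (by
      intro t ht
      have h1 : t ∉ S := fun h => ht.2 (Or.inl h)
      have h2 : t - 2 * Θ ∉ S := fun h => ht.2 (Or.inr h)
      exact ((hd t h1).add ((hd _ h2).comp_sub_const t (2 * Θ))).sub_const k)
    (hm.add (hm.comp (measurable_id.sub_const _)))
    (fun t => (abs_add_le _ _).trans (add_le_add (hM _) (hM _)))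
    (by
      simp only [hk2]
      rw [hz (a + Θ - 2 * Θ)]
      · ring
      · rw [abs_of_nonpos (by linarith [ha.2])]; linarith [ha.2])
    (by
      simp only [add_sub_cancel_right]
      rw [hz (a + 2 * Θ)]
      · simp [hk]
      · rw [abs_of_nonneg (by linarith [ha.1])]; linarith [ha.1])
  have iv : ∀ x y, IntervalIntegrable (fun t => v t ^ 2) volume x y :=
    fun x y => (hv.pow 2).intervalIntegrable _ _
  have iv1 : ∀ x y, IntervalIntegrable v volume x y := fun x y => hv.intervalIntegrable _ _
  have iv' : ∀ x y, IntervalIntegrable (fun t => v' t ^ 2) volume x y :=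
    fun x y => hm.intervalIntegrable_sq_of_abs_le hM _ _
  have trans' : ∀ g : ℝ → ℝ, (∀ t, Θ ≤ |t| → g t = 0) → (∀ x y, IntervalIntegrable g volume x y) →
      (∫ t in a..(a + Θ), g t) + (∫ t in (a + Θ)..(a + 2 * Θ), (g t + g (t - 2 * Θ)))
        = ∫ t in (-Θ)..Θ, g t := by
    intro g hg ig
    have ishift : IntervalIntegrable (fun t => g (t - 2 * Θ)) volume (a + Θ) (a + 2 * Θ) := by
      have := (ig (a + Θ - 2 * Θ) (a + 2 * Θ - 2 * Θ)).comp_sub_right (2 * Θ)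
      simpa using this
    rw [intervalIntegral.integral_add (ig _ _) ishift,
      intervalIntegral.integral_comp_sub_right (fun t => g t)]
    rw [show a + Θ - 2 * Θ = a - Θ by ring, show a + 2 * Θ - 2 * Θ = a by ring]
    have z1 : ∫ t in (a - Θ)..(-Θ), g t = 0 := by
      apply intervalIntegral.integral_zero_ae
      refine Filter.Eventually.of_forall fun t ht => hg t ?_
      rw [uIoc_of_le (by linarith [ha.2])] at ht
      rw [abs_of_nonpos (by linarith [ht.2])]; linarith [ht.2]
    have z2 : ∫ t in (Θ)..(a + 2 * Θ), g t = 0 := by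
      apply intervalIntegral.integral_zero_ae
      refine Filter.Eventually.of_forall fun t ht => hg t ?_
      rw [uIoc_of_le (by linarith [ha.1])] at ht
      rw [abs_of_nonneg (by linarith [ht.1])]; linarith [ht.1]
    have e1 := intervalIntegral.integral_add_adjacent_intervals (ig (a - Θ) (-Θ)) (ig (-Θ) a)
    have e2 := intervalIntegral.integral_add_adjacent_intervals (ig (a + Θ) (Θ))
      (ig (Θ) (a + 2 * Θ))
    have e3 := intervalIntegral.integral_add_adjacent_intervals (ig (-Θ) a) (ig a (a + Θ))
    have e4 := intervalIntegral.integral_add_adjacent_intervals (ig (-Θ) (a + Θ)) (ig (a + Θ) Θ)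
    linarith
  have t1 := trans' v hz iv1
  have t2 := trans' (fun t => v t ^ 2) (fun t ht => by simp [hz t ht]) iv
  have t3 := trans' (fun t => v' t ^ 2) (fun t ht => by simp [hz' t ht]) iv'
  have c1 : ∫ t in a..(a + Θ), (v t - k) ^ 2 =
      (∫ t in a..(a + Θ), v t ^ 2) - 2 * k * (∫ t in a..(a + Θ), v t) + k ^ 2 * Θ := by
    rw [← intervalIntegral.integral_const_mul, ← intervalIntegral.integral_sub (iv _ _)
      ((iv1 _ _).const_mul _)]
    have : k ^ 2 * Θ = ∫ t in a..(a + Θ), k ^ 2 := by simp; ring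
    rw [this, ← intervalIntegral.integral_add ((iv _ _).sub ((iv1 _ _).const_mul _))
      intervalIntegrable_const]
    congr 1; ext t; ring
  have iw1 : ∀ x y, IntervalIntegrable (fun t => v t + v (t - 2 * Θ)) volume x y := fun x y =>
    Continuous.intervalIntegrable (by fun_prop) _ _
  have iw : ∀ x y, IntervalIntegrable (fun t => v t ^ 2 + v (t - 2 * Θ) ^ 2) volume x y :=
    fun x y => Continuous.intervalIntegrable (by fun_prop) _ _
  have c2 : ∫ t in (a + Θ)..(a + 2 * Θ), (v t + v (t - 2 * Θ) - k) ^ 2 =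
      (∫ t in (a + Θ)..(a + 2 * Θ), (v t ^ 2 + v (t - 2 * Θ) ^ 2))
        - 2 * k * (∫ t in (a + Θ)..(a + 2 * Θ), (v t + v (t - 2 * Θ))) + k ^ 2 * Θ := by
    rw [← intervalIntegral.integral_const_mul, ← intervalIntegral.integral_sub (iw _ _)
      ((iw1 _ _).const_mul _)]
    have : k ^ 2 * Θ = ∫ t in (a + Θ)..(a + 2 * Θ), k ^ 2 := by simp; ring
    rw [this, ← intervalIntegral.integral_add ((iw _ _).sub ((iw1 _ _).const_mul _))
      intervalIntegrable_const]
    congr 1; ext t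
    linear_combination 2 * hsum0 t
  have c3 : ∫ t in (a + Θ)..(a + 2 * Θ), (v' t + v' (t - 2 * Θ)) ^ 2 =
      ∫ t in (a + Θ)..(a + 2 * Θ), (v' t ^ 2 + v' (t - 2 * Θ) ^ 2) := by
    congr 1; ext t
    linear_combination 2 * hsum t
  rw [c1] at key1
  rw [c2, c3] at key2
  -- When the two half-periods are added, the terms linear in k cancel since v has mean zero, and
  -- the `k²` terms have the favourable sign.
  have hk0 : 0 ≤ (Real.pi / Θ) ^ 2 * (k ^ 2 * Θ) := by positivity
  rw [← t2, ← t3]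
  rw [hmean] at t1
  have : (∫ t in (a + Θ)..(a + 2 * Θ), (v t + v (t - 2 * Θ))) = - ∫ t in a..(a + Θ), v t := by
    linarith
  rw [this] at key2
  nlinarith [key1, key2, hk0]

/-- Below π/2 this is `x < tan x`; beyond it the cosine is nonpositive. Up to a positive factor the
quantity is the derivative of `segmentArea`, and it is the denominator of every stiffness below. -/
theorem Real.sin_sub_mul_cos_pos {x : ℝ} (h0 : 0 < x) (hπ : x < Real.pi) :
    0 < Real.sin x - x * Real.cos x := by
  rcases lt_or_ge x (Real.pi / 2) with h | h
  · have h1 := Real.lt_tan h0 h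
    have hc : 0 < Real.cos x := Real.cos_pos_of_mem_Ioo ⟨by linarith, h⟩
    rw [Real.tan_eq_sin_div_cos, lt_div_iff₀ hc] at h1
    linarith
  · have h1 := Real.sin_pos_of_pos_of_lt_pi h0 hπ
    have h2 : Real.cos x ≤ 0 := Real.cos_nonpos_of_pi_div_two_le_of_le h (by linarith)
    nlinarith

namespace IsC1ZeroLe

variable {a ε : ℝ} {u : ℝ → ℝ}

theorem hasDerivAt (hu : IsC1ZeroLe a ε u) {t : ℝ} (ht : t ∈ Ioo (-a) a) :
    HasDerivAt u (deriv u t) t :=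
  ((hu.contDiffOn.differentiableOn (by simp)).differentiableAt (isOpen_Ioo.mem_nhds ht)).hasDerivAt

theorem continuousOn_deriv (hu : IsC1ZeroLe a ε u) : ContinuousOn (deriv u) (Ioo (-a) a) :=
  hu.contDiffOn.continuousOn_deriv_of_isOpen isOpen_Ioo (by simp)

theorem abs_le_Icc (hu : IsC1ZeroLe a ε u) (ha : 0 < a) {t : ℝ} (ht : t ∈ Icc (-a) a) :
    |u t| ≤ ε := by
  have hε : 0 ≤ ε := (abs_nonneg _).trans (hu.abs_le 0 ⟨by linarith, ha⟩)
  rcases eq_or_lt_of_le ht.1 with h | h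
  · rw [← h, hu.left_zero]; simpa
  rcases eq_or_lt_of_le ht.2 with h' | h'
  · rw [h', hu.right_zero]; simpa
  exact hu.abs_le t ⟨h, h'⟩

theorem nonneg (hu : IsC1ZeroLe a ε u) (ha : 0 < a) : 0 ≤ ε :=
  (abs_nonneg _).trans (hu.abs_le 0 ⟨by linarith, ha⟩)

theorem intervalIntegrable (hu : IsC1ZeroLe a ε u) (ha : 0 < a) :
    IntervalIntegrable u volume (-a) a := by
  apply ContinuousOn.intervalIntegrable
  rw [uIcc_of_le (by linarith)]
  exact hu.continuousOn

theorem intervalIntegrable_sq (hu : IsC1ZeroLe a ε u) (ha : 0 < a) :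
    IntervalIntegrable (fun t => u t ^ 2) volume (-a) a := by
  apply ContinuousOn.intervalIntegrable
  rw [uIcc_of_le (by linarith)]
  exact hu.continuousOn.pow 2

end IsC1ZeroLe

theorem intervalIntegral_congr_Ioo {a b : ℝ} (hab : a ≤ b) {f g : ℝ → ℝ}
    (h : ∀ t ∈ Ioo a b, f t = g t) : ∫ t in a..b, f t = ∫ t in a..b, g t := by
  rw [intervalIntegral.integral_of_le hab, intervalIntegral.integral_of_le hab,
    integral_Ioc_eq_integral_Ioo, integral_Ioc_eq_integral_Ioo]
  exact setIntegral_congr_fun measurableSet_Ioo h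

theorem intervalIntegrable_of_continuousOn_Ioo {a b M : ℝ} (hab : a ≤ b) {f : ℝ → ℝ}
    (h : ContinuousOn f (Ioo a b)) (hM : ∀ t ∈ Ioo a b, |f t| ≤ M) :
    IntervalIntegrable f volume a b := by
  rw [intervalIntegrable_iff_integrableOn_Ioo_of_le hab]
  exact IntegrableOn.of_bound (by simp) (h.aestronglyMeasurable measurableSet_Ioo) M
    ((ae_restrict_iff' measurableSet_Ioo).2 (Filter.Eventually.of_forall hM))

theorem intervalIntegral_indicator_Ioo {a b A B : ℝ} (hab : a ≤ b) (hA : A ≤ a) (hB : b ≤ B)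
    (f : ℝ → ℝ) : ∫ t in A..B, (Ioo a b).indicator f t = ∫ t in a..b, f t := by
  rw [intervalIntegral.integral_of_le (hA.trans (hab.trans hB)),
    intervalIntegral.integral_of_le hab, setIntegral_indicator measurableSet_Ioo,
    integral_Ioc_eq_integral_Ioo]
  congr 2
  ext t
  simp only [mem_inter_iff, mem_Ioc, mem_Ioo]
  constructor
  · exact fun h => h.2
  · exact fun h => ⟨⟨by linarith, by linarith⟩, h⟩

namespace IsC1ZeroLe

variable {θ ε μ : ℝ} {u : ℝ → ℝ}

theorem intervalIntegrable_deriv (hu : IsC1ZeroLe θ ε u) (hθ : 0 < θ) :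
    IntervalIntegrable (deriv u) volume (-θ) θ :=
  intervalIntegrable_of_continuousOn_Ioo (by linarith) hu.continuousOn_deriv hu.abs_deriv_le

theorem intervalIntegrable_deriv_sq (hu : IsC1ZeroLe θ ε u) (hθ : 0 < θ) :
    IntervalIntegrable (fun t => deriv u t ^ 2) volume (-θ) θ := by
  refine intervalIntegrable_of_continuousOn_Ioo (M := ε ^ 2) (by linarith)
    (hu.continuousOn_deriv.pow 2) fun t ht => ?_
  rw [abs_pow]
  exact pow_le_pow_left₀ (abs_nonneg _) (hu.abs_deriv_le t ht) 2

theorem poincare (hu : IsC1ZeroLe θ ε u) (hθ : 0 < θ) :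
    (Real.pi / (2 * θ)) ^ 2 * ∫ t in (-θ)..θ, u t ^ 2 ≤ ∫ t in (-θ)..θ, deriv u t ^ 2 := by
  have h := poincare_of_le (a := -θ) (b := θ) (μ := Real.pi / (2 * θ)) (f := u)
    (f' := (Ioo (-θ) θ).indicator (deriv u)) (S := ∅) (M := ε) (by linarith) (by positivity)
    (by field_simp; norm_num) countable_empty hu.continuousOn
    (by
      intro t ht
      rw [indicator_of_mem ht.1]
      exact hu.hasDerivAt ht.1)
    ((measurable_deriv u).indicator measurableSet_Ioo)
    (by
      intro t
      by_cases ht : t ∈ Ioo (-θ) θ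
      · rw [indicator_of_mem ht]; exact hu.abs_deriv_le t ht
      · rw [indicator_of_notMem ht]; simpa using hu.nonneg hθ)
    hu.left_zero hu.right_zero
  refine h.trans (le_of_eq (intervalIntegral_congr_Ioo (by linarith) fun t ht => ?_))
  rw [indicator_of_mem ht]

/-- Sharp lower bound for the second variation of an arc with fixed end points in terms of the
first variation of the enclosed area. -/
theorem poincare_mean (hu : IsC1ZeroLe θ ε u) (hθ : 0 < θ) (hμ : 0 < μ) (hμθ : μ * θ < Real.pi) :
    μ ^ 2 * (∫ t in (-θ)..θ, u t ^ 2) +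
      μ ^ 3 * Real.cos (μ * θ) / (2 * (Real.sin (μ * θ) - μ * θ * Real.cos (μ * θ))) *
        (∫ t in (-θ)..θ, u t) ^ 2 ≤ ∫ t in (-θ)..θ, deriv u t ^ 2 := by
  set C := Real.cos (μ * θ) with hC
  set S := Real.sin (μ * θ) with hS
  have hD : 0 < S - μ * θ * C := Real.sin_sub_mul_cos_pos (by positivity) hμθ
  have hle : -θ ≤ θ := by linarith
  have hI : uIcc (-θ) θ = Icc (-θ) θ := uIcc_of_le hle
  set c := ∫ t in (-θ)..θ, u t with hc
  -- The function `cos (μ t) - cos (μ θ)` vanishes at ±θ and is the extremal for prescribed mean. A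
  -- is the multiple of it carrying the whole mean c, so that `w` has mean zero. Extended by zero,
  -- `w` lives on a circle of length `2π/μ`, whose first nonzero frequency is exactly μ.
  set A := c * μ / (2 * (S - μ * θ * C)) with hA
  set Θ := Real.pi / μ with hΘ
  have hΘ0 : 0 < Θ := by positivity
  have hθΘ : θ ≤ Θ := by rw [hΘ, le_div_iff₀ hμ]; linarith
  set w : ℝ → ℝ := fun t => u t - A * (Real.cos (μ * t) - C) with hw
  set w' : ℝ → ℝ := fun t => deriv u t + A * μ * Real.sin (μ * t) with hw'
  have hwc : ContinuousOn w (Icc (-θ) θ) := hu.continuousOn.sub (by fun_prop)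
  have hwl : w (-θ) = 0 := by simp [hw, hu.left_zero, hC]
  have hwr : w θ = 0 := by simp [hw, hu.right_zero, hC]
  have hwd : ∀ t ∈ Ioo (-θ) θ, HasDerivAt w (w' t) t := by
    intro t ht
    have h1 : HasDerivAt (fun t => Real.cos (μ * t)) (-Real.sin (μ * t) * μ) t := by
      simpa using ((hasDerivAt_id t).const_mul μ).cos
    refine ((hu.hasDerivAt ht).sub ((h1.sub_const C).const_mul A)).congr_deriv ?_
    simp only [hw']; ring
  set v := (Ioo (-θ) θ).indicator w with hv
  set v' := (Ioo (-θ) θ).indicator w' with hv'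
  have hvc : Continuous v := by
    have h1 : Continuous fun t => w (max (-θ) (min θ t)) := by
      refine hwc.comp_continuous (by fun_prop) fun t => ⟨le_max_left _ _, ?_⟩
      exact max_le hle (min_le_left _ _)
    convert h1 using 1
    ext t
    by_cases ht : t ∈ Ioo (-θ) θ
    · rw [hv, indicator_of_mem ht, min_eq_right ht.2.le, max_eq_right ht.1.le]
    · rw [hv, indicator_of_notMem ht]
      rcases le_or_gt t (-θ) with h | h
      · rw [min_eq_right (by linarith), max_eq_left h, hwl]
      · have h2 : θ ≤ t := by
          by_contra hh
          exact ht ⟨h, not_le.1 hh⟩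
        rw [min_eq_left h2, max_eq_right hle, hwr]
  have hnot : ∀ t : ℝ, θ ≤ |t| → t ∉ Ioo (-θ) θ := by
    intro t ht hh
    exact absurd (abs_lt.2 ⟨hh.1, hh.2⟩) (not_lt.2 ht)
  have ii : ∀ f : ℝ → ℝ, ContinuousOn f (Icc (-θ) θ) → IntervalIntegrable f volume (-θ) θ := by
    intro f hf
    apply ContinuousOn.intervalIntegrable
    rwa [hI]
  have iu := hu.intervalIntegrable hθ
  have iu' := hu.intervalIntegrable_deriv hθ
  have hintg : ∫ t in (-θ)..θ, (Real.cos (μ * t) - C) = 2 * (S - μ * θ * C) / μ := by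
    rw [intervalIntegral.integral_eq_sub_of_hasDerivAt
      (f := fun t => Real.sin (μ * t) / μ - C * t)]
    · simp only [mul_neg, Real.sin_neg]
      rw [← hS]; field_simp; ring
    · intro t _
      have h1 : HasDerivAt (fun t => Real.sin (μ * t)) (Real.cos (μ * t) * μ) t := by
        simpa using ((hasDerivAt_id t).const_mul μ).sin
      refine ((h1.div_const μ).sub ((hasDerivAt_id t).const_mul C)).congr_deriv ?_
      field_simp
    · exact ii _ (by fun_prop)
  have hintg2 : ∫ t in (-θ)..θ, ((Real.cos (μ * t) - C) ^ 2 - Real.sin (μ * t) ^ 2) =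
      - C * (2 * (S - μ * θ * C) / μ) := by
    rw [intervalIntegral.integral_eq_sub_of_hasDerivAt
      (f := fun t => Real.sin (μ * t) * Real.cos (μ * t) / μ - 2 * C * (Real.sin (μ * t) / μ) +
        C ^ 2 * t)]
    · simp only [mul_neg, Real.sin_neg, Real.cos_neg]
      rw [← hS, ← hC]; field_simp; ring
    · intro t _
      have h1 : HasDerivAt (fun t => Real.sin (μ * t)) (Real.cos (μ * t) * μ) t := by
        simpa using ((hasDerivAt_id t).const_mul μ).sin
      have h2 : HasDerivAt (fun t => Real.cos (μ * t)) (-Real.sin (μ * t) * μ) t := by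
        simpa using ((hasDerivAt_id t).const_mul μ).cos
      refine ((((h1.mul h2).div_const μ).sub ((h1.div_const μ).const_mul (2 * C))).add
        ((hasDerivAt_id t).const_mul (C ^ 2))).congr_deriv ?_
      field_simp
      ring
    · exact ii _ (by fun_prop)
  have hmean : ∫ t in (-Θ)..Θ, v t = 0 := by
    rw [hv, intervalIntegral_indicator_Ioo hle (by linarith) hθΘ]
    simp only [hw]
    rw [intervalIntegral.integral_sub iu (ii _ (by fun_prop)), intervalIntegral.integral_const_mul,
      hintg, ← hc, hA]
    field_simp
    ring
  have hW := wirtinger_of_support (θ := θ) (Θ := Θ) (M := ε + |A * μ|) (v := v) (v' := v')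
    (S := {-θ, θ}) hΘ0 hθΘ (Set.toFinite _).countable hvc
    (by
      intro t ht
      simp only [mem_insert_iff, mem_singleton_iff, not_or] at ht
      by_cases h : t ∈ Ioo (-θ) θ
      · rw [hv', indicator_of_mem h]
        refine (hwd t h).congr_of_eventuallyEq ?_
        filter_upwards [isOpen_Ioo.mem_nhds h] with s hs
        rw [hv, indicator_of_mem hs]
      · rw [hv', indicator_of_notMem h]
        have hout : t ∈ (Icc (-θ) θ)ᶜ := by
          intro hh
          exact h ⟨lt_of_le_of_ne hh.1 (Ne.symm ht.1), lt_of_le_of_ne hh.2 ht.2⟩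
        refine (hasDerivAt_const t (0 : ℝ)).congr_of_eventuallyEq ?_
        filter_upwards [isClosed_Icc.isOpen_compl.mem_nhds hout] with s hs
        rw [hv, indicator_of_notMem (fun hh => hs (Ioo_subset_Icc_self hh))])
    (Measurable.indicator (by
      apply (measurable_deriv u).add
      fun_prop) measurableSet_Ioo)
    (by
      intro t
      by_cases h : t ∈ Ioo (-θ) θ
      · rw [hv', indicator_of_mem h]
        refine (abs_add_le _ _).trans (add_le_add (hu.abs_deriv_le t h) ?_)
        rw [abs_mul]
        exact mul_le_of_le_one_right (abs_nonneg _) (Real.abs_sin_le_one _)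
      · rw [hv', indicator_of_notMem h]
        have := hu.nonneg hθ
        simp only [abs_zero]; positivity)
    (fun t ht => by rw [hv, indicator_of_notMem (hnot t ht)])
    (fun t ht => by rw [hv', indicator_of_notMem (hnot t ht)])
    hmean
  have sq_ind : ∀ f : ℝ → ℝ, (fun t => (Ioo (-θ) θ).indicator f t ^ 2) =
      (Ioo (-θ) θ).indicator (fun t => f t ^ 2) := by
    intro f; ext t
    by_cases h : t ∈ Ioo (-θ) θ
    · simp only [indicator_of_mem h]
    · simp only [indicator_of_notMem h]; norm_num
  rw [hv, hv', sq_ind w, sq_ind w', intervalIntegral_indicator_Ioo hle (by linarith) hθΘ,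
    intervalIntegral_indicator_Ioo hle (by linarith) hθΘ,
    show Real.pi / Θ = μ by rw [hΘ]; field_simp] at hW
  -- integration by parts
  have hIBP : ∫ t in (-θ)..θ, (deriv u t * Real.sin (μ * t) + u t * (μ * Real.cos (μ * t))) = 0 := by
    have iB : IntervalIntegrable
        (fun t => deriv u t * Real.sin (μ * t) + u t * (μ * Real.cos (μ * t))) volume (-θ) θ :=
      (iu'.mul_continuousOn (by fun_prop)).add (iu.mul_continuousOn (by fun_prop))
    rw [intervalIntegral.integral_eq_sub_of_hasDerivAt_of_le hle
      (f := fun t => u t * Real.sin (μ * t)) (hu.continuousOn.mul (by fun_prop)) _ iB]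
    · simp [hu.left_zero, hu.right_zero]
    · intro t ht
      have h1 : HasDerivAt (fun t => Real.sin (μ * t)) (Real.cos (μ * t) * μ) t := by
        simpa using ((hasDerivAt_id t).const_mul μ).sin
      refine ((hu.hasDerivAt ht).mul h1).congr_deriv (by ring)
  have iB1 : IntervalIntegrable (fun t => deriv u t * Real.sin (μ * t)) volume (-θ) θ :=
    iu'.mul_continuousOn (by fun_prop)
  have iB2 : IntervalIntegrable (fun t => u t * Real.cos (μ * t)) volume (-θ) θ :=
    iu.mul_continuousOn (by fun_prop)
  have iB3 : IntervalIntegrable (fun t => u t * (μ * Real.cos (μ * t))) volume (-θ) θ :=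
    iu.mul_continuousOn (by fun_prop)
  set K := ∫ t in (-θ)..θ, u t * Real.cos (μ * t) with hK
  have hIBP' : ∫ t in (-θ)..θ, deriv u t * Real.sin (μ * t) = - (μ * K) := by
    rw [intervalIntegral.integral_add iB1 iB3] at hIBP
    have : ∫ t in (-θ)..θ, u t * (μ * Real.cos (μ * t)) = μ * K := by
      rw [hK, ← intervalIntegral.integral_const_mul]; congr 1; ext t; ring
    linarith
  have iu2 := hu.intervalIntegrable_sq hθ
  have iu2' := hu.intervalIntegrable_deriv_sq hθ
  have ig2 : IntervalIntegrable (fun t => (Real.cos (μ * t) - C) ^ 2) volume (-θ) θ :=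
    ii _ (by fun_prop)
  have is2 : IntervalIntegrable (fun t => Real.sin (μ * t) ^ 2) volume (-θ) θ :=
    ii _ (by fun_prop)
  have ew : ∫ t in (-θ)..θ, w t ^ 2 = (∫ t in (-θ)..θ, u t ^ 2) - 2 * A * K + 2 * A * C * c +
      A ^ 2 * ∫ t in (-θ)..θ, (Real.cos (μ * t) - C) ^ 2 := by
    rw [hK, hc, ← intervalIntegral.integral_const_mul, ← intervalIntegral.integral_const_mul,
      ← intervalIntegral.integral_const_mul,
      ← intervalIntegral.integral_sub iu2 (iB2.const_mul _),
      ← intervalIntegral.integral_add (iu2.sub (iB2.const_mul _)) (iu.const_mul _),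
      ← intervalIntegral.integral_add ((iu2.sub (iB2.const_mul _)).add (iu.const_mul _))
        (ig2.const_mul _)]
    congr 1; ext t; simp only [hw]; ring
  have ew' : ∫ t in (-θ)..θ, w' t ^ 2 = (∫ t in (-θ)..θ, deriv u t ^ 2) - 2 * A * μ ^ 2 * K +
      A ^ 2 * μ ^ 2 * ∫ t in (-θ)..θ, Real.sin (μ * t) ^ 2 := by
    have : - (2 * A * μ ^ 2 * K) = 2 * A * μ * ∫ t in (-θ)..θ, deriv u t * Real.sin (μ * t) := by
      rw [hIBP']; ring
    rw [sub_eq_add_neg, this, ← intervalIntegral.integral_const_mul,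
      ← intervalIntegral.integral_const_mul,
      ← intervalIntegral.integral_add iu2' (iB1.const_mul _),
      ← intervalIntegral.integral_add (iu2'.add (iB1.const_mul _)) (is2.const_mul _)]
    congr 1; ext t; simp only [hw']; ring
  rw [intervalIntegral.integral_sub ig2 is2] at hintg2
  -- The integral `K` enters both sides with the same coefficient `-2 A μ²` and drops out; only c,
  -- the integral of u, survives.
  rw [ew, ew'] at hW
  have hfin : μ ^ 3 * C / (2 * (S - μ * θ * C)) * c ^ 2 =
      μ ^ 2 * (2 * A * C * c) + A ^ 2 * μ ^ 2 * (-C * (2 * (S - μ * θ * C) / μ)) := by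
    rw [hA]; field_simp; ring
  rw [hfin, ← hintg2]
  linarith

end IsC1ZeroLe

/-! ### Second order lower bounds for lengths -/

/-- The Taylor bound `√(A² + B²) ≈ A + B² / (2A)` near (1, 0). Lowering the coefficient of `B² / 2`
to `1 - 2ε` pays both for A differing from 1 and for the quartic remainder. -/
theorem Real.le_sqrt_sq_add_sq {A B ε : ℝ} (hε : ε ≤ 1 / 4) (hA0 : 1 - ε ≤ A)
    (hA1 : A ≤ 1 + ε) (hB : |B| ≤ ε) : A + (1 - 2 * ε) * (B ^ 2 / 2) ≤ √(A ^ 2 + B ^ 2) := by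
  have hε0 : 0 ≤ ε := (abs_nonneg _).trans hB
  have hB2 : B ^ 2 ≤ ε ^ 2 := sq_le_sq' (abs_le.1 hB).1 (abs_le.1 hB).2
  have h0 : 0 ≤ B ^ 2 := sq_nonneg B
  apply Real.le_sqrt_of_sq_le
  have h1 : A * (1 - 2 * ε) ≤ 1 - ε := by nlinarith
  have h2 : (1 - 2 * ε) ^ 2 ≤ 1 := by nlinarith
  have h3 : (1 - 2 * ε) ^ 2 * (B ^ 2 / 4) ≤ ε := by nlinarith
  nlinarith [mul_le_mul_of_nonneg_right h1 h0, mul_le_mul_of_nonneg_right h3 h0]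

theorem sq_intervalIntegral_le {a : ℝ} (ha : 0 < a) {u : ℝ → ℝ}
    (h1 : IntervalIntegrable u volume (-a) a)
    (h2 : IntervalIntegrable (fun t => u t ^ 2) volume (-a) a) :
    (∫ t in (-a)..a, u t) ^ 2 ≤ 2 * a * ∫ t in (-a)..a, u t ^ 2 := by
  set c := ∫ t in (-a)..a, u t with hc
  set m := c / (2 * a) with hm
  have h : 0 ≤ ∫ t in (-a)..a, (u t - m) ^ 2 :=
    intervalIntegral.integral_nonneg (by linarith) fun t _ => sq_nonneg _
  have e : ∫ t in (-a)..a, (u t - m) ^ 2 =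
      (∫ t in (-a)..a, u t ^ 2) - 2 * m * c + m ^ 2 * (2 * a) := by
    have : m ^ 2 * (2 * a) = ∫ t in (-a)..a, m ^ 2 := by simp; ring
    rw [hc, this, ← intervalIntegral.integral_const_mul, ← intervalIntegral.integral_sub h2
      (h1.const_mul _), ← intervalIntegral.integral_add (h2.sub (h1.const_mul _))
      intervalIntegrable_const]
    congr 1; ext t; ring
  rw [e] at h
  have : 2 * m * c - m ^ 2 * (2 * a) = c ^ 2 / (2 * a) := by rw [hm]; field_simp; ring
  have h3 : c ^ 2 / (2 * a) ≤ ∫ t in (-a)..a, u t ^ 2 := by linarith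
  rw [div_le_iff₀ (by positivity)] at h3
  linarith

namespace IsC1ZeroLe

variable {θ ε : ℝ} {u : ℝ → ℝ}

theorem intervalIntegrable_length (hu : IsC1ZeroLe θ ε u) (hθ : 0 < θ) :
    IntervalIntegrable (fun t => √((1 + u t) ^ 2 + deriv u t ^ 2)) volume (-θ) θ := by
  refine intervalIntegrable_of_continuousOn_Ioo (M := √((1 + ε) ^ 2 + ε ^ 2)) (by linarith) ?_ ?_
  · apply ContinuousOn.sqrt
    exact ((continuousOn_const.add (hu.continuousOn.mono Ioo_subset_Icc_self)).pow 2).add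
      (hu.continuousOn_deriv.pow 2)
  · intro t ht
    have h1 := _root_.abs_le.1 (hu.abs_le t ht)
    have h2 := _root_.abs_le.1 (hu.abs_deriv_le t ht)
    rw [abs_of_nonneg (Real.sqrt_nonneg _)]
    apply Real.sqrt_le_sqrt
    have hε := hu.nonneg hθ
    nlinarith

theorem intervalIntegrable_area (hu : IsC1ZeroLe θ ε u) (hθ : 0 < θ) :
    IntervalIntegrable (fun t => u t + u t ^ 2 / 2) volume (-θ) θ :=
  (hu.intervalIntegrable hθ).add ((hu.intervalIntegrable_sq hθ).div_const 2)

theorem integral_area (hu : IsC1ZeroLe θ ε u) (hθ : 0 < θ) :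
    ∫ t in (-θ)..θ, (u t + u t ^ 2 / 2) =
      (∫ t in (-θ)..θ, u t) + (∫ t in (-θ)..θ, u t ^ 2) / 2 := by
  rw [intervalIntegral.integral_add (hu.intervalIntegrable hθ)
    ((hu.intervalIntegrable_sq hθ).div_const 2), intervalIntegral.integral_div]

theorem integral_sq_nonneg (hθ : 0 < θ) (u : ℝ → ℝ) : 0 ≤ ∫ t in (-θ)..θ, u t ^ 2 :=
  intervalIntegral.integral_nonneg (by linarith) fun t _ => sq_nonneg _

/-- Lower bound for the length of a perturbed arc, corrected by the enclosed area. -/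
theorem excess_ge (hu : IsC1ZeroLe θ ε u) (hθ : 0 < θ) (hε : ε ≤ 1 / 4) :
    (1 - 2 * ε) * ((∫ t in (-θ)..θ, deriv u t ^ 2) / 2) - (∫ t in (-θ)..θ, u t ^ 2) / 2 ≤
      (∫ t in (-θ)..θ, √((1 + u t) ^ 2 + deriv u t ^ 2)) - 2 * θ
        - ∫ t in (-θ)..θ, (u t + u t ^ 2 / 2) := by
  have iu := hu.intervalIntegrable hθ
  have iu' := hu.intervalIntegrable_deriv_sq hθ
  have h : ∫ t in (-θ)..θ, (1 + u t + (1 - 2 * ε) * (deriv u t ^ 2 / 2)) ≤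
      ∫ t in (-θ)..θ, √((1 + u t) ^ 2 + deriv u t ^ 2) := by
    refine intervalIntegral.integral_mono_on_of_le_Ioo (by linarith)
      ((intervalIntegrable_const.add iu).add ((iu'.div_const 2).const_mul _))
      (hu.intervalIntegrable_length hθ) fun t ht => ?_
    have h1 := _root_.abs_le.1 (hu.abs_le t ht)
    exact Real.le_sqrt_sq_add_sq hε (by linarith) (by linarith) (hu.abs_deriv_le t ht)
  rw [intervalIntegral.integral_add (intervalIntegrable_const.add iu)
    ((iu'.div_const 2).const_mul _), intervalIntegral.integral_add intervalIntegrable_const iu,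
    intervalIntegral.integral_const_mul, intervalIntegral.integral_div,
    intervalIntegral.integral_const] at h
  rw [hu.integral_area hθ]
  simp only [smul_eq_mul, mul_one] at h
  linarith

end IsC1ZeroLe

/-- Quantitative second order lower bound for the length of a perturbed arc, corrected by the
enclosed area. -/
theorem exists_arc_excess_ge {θ η : ℝ} (hθ : 0 < θ) (hπ : θ < Real.pi) (hη : 0 < η) :
    ∃ ε₁ > (0 : ℝ), ∃ c > (0 : ℝ), ∀ (ε : ℝ) (u : ℝ → ℝ), IsC1ZeroLe θ ε u → ε ≤ ε₁ →
      (Real.cos θ / (2 * (Real.sin θ - θ * Real.cos θ)) - η) / 2 *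
          (∫ t in (-θ)..θ, (u t + u t ^ 2 / 2)) ^ 2 + c * ∫ t in (-θ)..θ, u t ^ 2 ≤
        (∫ t in (-θ)..θ, √((1 + u t) ^ 2 + deriv u t ^ 2)) - 2 * θ
          - ∫ t in (-θ)..θ, (u t + u t ^ 2 / 2) := by
  have hD := Real.sin_sub_mul_cos_pos hθ hπ
  -- `Q μ` is the coefficient of the squared mean in `poincare_mean`. A μ slightly above 1 costs
  -- less than η in this coefficient and produces a surplus `(μ² - 1) ∫ u²`. Half of that surplus
  -- covers the errors of order ε, and the other half gives the constant c.
  set Q : ℝ → ℝ := fun μ => μ ^ 3 * Real.cos (μ * θ) /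
    (2 * (Real.sin (μ * θ) - μ * θ * Real.cos (μ * θ))) with hQ
  have hQc : ContinuousAt Q 1 := by
    apply ContinuousAt.div (by fun_prop) (by fun_prop)
    simp only [one_mul]; linarith
  have hQ1 : Q 1 = Real.cos θ / (2 * (Real.sin θ - θ * Real.cos θ)) := by simp [hQ]
  obtain ⟨μ, ⟨hμQ, hμθ⟩, hμ1⟩ : ∃ μ, (Q 1 - η < Q μ ∧ μ * θ < Real.pi) ∧ 1 < μ := by
    have e1 : ∀ᶠ μ in nhds (1 : ℝ), Q 1 - η < Q μ :=
      hQc.eventually_const_lt (by linarith)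
    have e2 : ∀ᶠ μ in nhds (1 : ℝ), μ * θ < Real.pi := by
      have : ContinuousAt (fun μ : ℝ => μ * θ) 1 := by fun_prop
      exact this.eventually_lt continuousAt_const (by simpa using hπ)
    have e3 : ∀ᶠ μ in nhdsWithin (1 : ℝ) (Ioi 1), 1 < μ := eventually_mem_nhdsWithin
    exact (((e1.and e2).filter_mono nhdsWithin_le_nhds).and e3).exists
  rw [hQ1] at hμQ
  have hden : 0 < 2 * (2 * μ ^ 2 + 7 * |Q μ| * θ) := by positivity
  have hμ2 : 0 < μ ^ 2 - 1 := by nlinarith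
  refine ⟨min (1 / 4) ((μ ^ 2 - 1) / (2 * (2 * μ ^ 2 + 7 * |Q μ| * θ))),
    lt_min (by norm_num) (by positivity), (μ ^ 2 - 1) / 4, by positivity, ?_⟩
  intro ε u hu hε
  have hε4 : ε ≤ 1 / 4 := hε.trans (min_le_left _ _)
  have hε' := hε.trans (min_le_right _ _)
  rw [le_div_iff₀ hden] at hε'
  have hε0 := hu.nonneg hθ
  have hex := hu.excess_ge hθ hε4
  have hpm := hu.poincare_mean hθ (by linarith : 0 < μ) hμθ
  have hCS := sq_intervalIntegral_le hθ (hu.intervalIntegrable hθ) (hu.intervalIntegrable_sq hθ)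
  have hI := IsC1ZeroLe.integral_sq_nonneg hθ u
  have hb := hu.integral_area hθ
  have hcabs : |∫ t in (-θ)..θ, u t| ≤ 2 * θ * ε := by
    have := intervalIntegral.norm_integral_le_of_norm_le_const (a := -θ) (b := θ) (f := u) (C := ε)
      (fun t ht => by
        rw [uIoc_of_le (by linarith)] at ht
        exact hu.abs_le_Icc hθ (Ioc_subset_Icc_self ht))
    rw [Real.norm_eq_abs, show θ - -θ = 2 * θ by ring, abs_of_pos (by linarith : 0 < 2 * θ)] at this
    linarith
  have hIε : (∫ t in (-θ)..θ, u t ^ 2) ≤ 2 * θ * ε := by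
    have := intervalIntegral.norm_integral_le_of_norm_le_const (a := -θ) (b := θ)
      (f := fun t => u t ^ 2) (C := ε)
      (fun t ht => by
        rw [uIoc_of_le (by linarith)] at ht
        have h := hu.abs_le_Icc hθ (Ioc_subset_Icc_self ht)
        rw [Real.norm_eq_abs, abs_pow]
        nlinarith [abs_nonneg (u t)])
    rw [Real.norm_eq_abs, show θ - -θ = 2 * θ by ring, abs_of_pos (by linarith : 0 < 2 * θ),
      abs_of_nonneg hI] at this
    linarith
  set q := Real.cos θ / (2 * (Real.sin θ - θ * Real.cos θ))
  set c := ∫ t in (-θ)..θ, u t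
  set I := ∫ t in (-θ)..θ, u t ^ 2
  set b := ∫ t in (-θ)..θ, (u t + u t ^ 2 / 2)
  set J := ∫ t in (-θ)..θ, deriv u t ^ 2
  set X := (∫ t in (-θ)..θ, √((1 + u t) ^ 2 + deriv u t ^ 2)) - 2 * θ - b
  change μ ^ 2 * I + Q μ * c ^ 2 ≤ J at hpm
  -- Here `b = c + I / 2`. Replacing `c²` by `b²` costs at most `5/2 θ ε I`, and the factor `1 - 2ε`
  -- costs at most `4 θ ε I`; together less than `7 θ ε I`.
  have hdiff : |(1 - 2 * ε) * c ^ 2 - b ^ 2| ≤ 7 * θ * ε * I := by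
    have h1 : (1 - 2 * ε) * c ^ 2 - b ^ 2 = -(I / 2 * (2 * c + I / 2)) - 2 * ε * c ^ 2 := by
      rw [hb]; ring
    have h2 : |I / 2 * (2 * c + I / 2)| ≤ I / 2 * (5 * θ * ε) := by
      rw [abs_mul, abs_of_nonneg (by linarith : 0 ≤ I / 2)]
      apply mul_le_mul_of_nonneg_left _ (by linarith)
      rw [abs_le] at hcabs ⊢
      constructor <;> linarith
    have h3 : 2 * ε * c ^ 2 ≤ 4 * θ * ε * I := by nlinarith
    have h4 : 0 ≤ 2 * ε * c ^ 2 := by positivity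
    have h5 : 0 ≤ θ * ε * I := by positivity
    rw [h1]
    rw [abs_le] at h2 ⊢
    constructor <;> linarith
  have hQdiff : Q μ * b ^ 2 - |Q μ| * (7 * θ * ε * I) ≤ (1 - 2 * ε) * (Q μ * c ^ 2) := by
    have h1 : |Q μ * ((1 - 2 * ε) * c ^ 2 - b ^ 2)| ≤ |Q μ| * (7 * θ * ε * I) := by
      rw [abs_mul]; exact mul_le_mul_of_nonneg_left hdiff (abs_nonneg _)
    have := (abs_le.1 h1).1
    linarith
  have h1 : (1 - 2 * ε) * (μ ^ 2 * I + Q μ * c ^ 2) ≤ (1 - 2 * ε) * J :=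
    mul_le_mul_of_nonneg_left hpm (by linarith)
  have h2 : (q - η) * b ^ 2 ≤ Q μ * b ^ 2 := mul_le_mul_of_nonneg_right hμQ.le (sq_nonneg b)
  have h3 := mul_le_mul_of_nonneg_right hε' hI
  nlinarith

/-- Second order lower bound for the length of a perturbed segment. -/
theorem exists_segment_excess_ge {a : ℝ} (ha : 0 < a) :
    ∃ ε₁ > (0 : ℝ), ∃ c > (0 : ℝ), ∀ (ε : ℝ) (v : ℝ → ℝ), IsC1ZeroLe a ε v → ε ≤ ε₁ →
      1 / a ^ 3 / 2 * (∫ t in (-a)..a, v t) ^ 2 + c * ∫ t in (-a)..a, v t ^ 2 ≤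
        (∫ t in (-a)..a, √(1 + deriv v t ^ 2)) - 2 * a := by
  -- In units of `I / a²`: Poincaré with `π² / 4 > 2.4` bounds half of the energy below by about
  -- 1.2, while Cauchy–Schwarz bounds the required area term above by 1. The remainder exceeds 0.1
  -- even after the loss `2ε`.
  refine ⟨1 / 100, by norm_num, 1 / (10 * a ^ 2), by positivity, ?_⟩
  intro ε v hv hε
  have iu' := hv.intervalIntegrable_deriv_sq ha
  have hε0 := hv.nonneg ha
  have h : ∫ t in (-a)..a, (1 + (1 - 2 * ε) * (deriv v t ^ 2 / 2)) ≤
      ∫ t in (-a)..a, √(1 + deriv v t ^ 2) := by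
    refine intervalIntegral.integral_mono_on_of_le_Ioo (by linarith)
      (intervalIntegrable_const.add ((iu'.div_const 2).const_mul _))
      ?_ fun t ht => ?_
    · refine intervalIntegrable_of_continuousOn_Ioo (M := √(1 + ε ^ 2)) (by linarith) ?_ ?_
      · exact (continuousOn_const.add (hv.continuousOn_deriv.pow 2)).sqrt
      · intro t ht
        rw [abs_of_nonneg (Real.sqrt_nonneg _)]
        apply Real.sqrt_le_sqrt
        have := sq_le_sq' (abs_le.1 (hv.abs_deriv_le t ht)).1 (abs_le.1 (hv.abs_deriv_le t ht)).2
        linarith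
    · have := Real.le_sqrt_sq_add_sq (A := 1) (B := deriv v t) (ε := ε) (by linarith) (by linarith)
        (by linarith) (hv.abs_deriv_le t ht)
      simpa using this
  rw [intervalIntegral.integral_add intervalIntegrable_const
    ((iu'.div_const 2).const_mul _), intervalIntegral.integral_const_mul,
    intervalIntegral.integral_div, intervalIntegral.integral_const] at h
  simp only [smul_eq_mul, mul_one] at h
  have hP := hv.poincare ha
  have hCS := sq_intervalIntegral_le ha (hv.intervalIntegrable ha) (hv.intervalIntegrable_sq ha)
  have hI := IsC1ZeroLe.integral_sq_nonneg ha v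
  set I := ∫ t in (-a)..a, v t ^ 2
  set c := ∫ t in (-a)..a, v t
  set J := ∫ t in (-a)..a, deriv v t ^ 2
  have hπ : 3.14 < Real.pi := Real.pi_gt_d2
  have hJ : 2.4 / a ^ 2 * I ≤ J := by
    refine le_trans (mul_le_mul_of_nonneg_right ?_ hI) hP
    rw [div_pow, mul_pow, div_le_div_iff₀ (by positivity) (by positivity)]
    have : 9.6 ≤ Real.pi ^ 2 := by nlinarith
    nlinarith [sq_nonneg a]
  have h1 : 1 / a ^ 3 / 2 * c ^ 2 ≤ 1 / a ^ 2 * I := by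
    have : 1 / a ^ 3 / 2 * c ^ 2 ≤ 1 / a ^ 3 / 2 * (2 * a * I) := by gcongr
    refine this.trans (le_of_eq ?_)
    field_simp
  have hK : 0 ≤ I / a ^ 2 := by positivity
  have e1 : 2.4 / a ^ 2 * I = 2.4 * (I / a ^ 2) := by ring
  have e2 : 1 / a ^ 2 * I = I / a ^ 2 := by ring
  have e3 : 1 / (10 * a ^ 2) * I = 0.1 * (I / a ^ 2) := by field_simp; ring
  rw [e1] at hJ
  rw [e2] at h1
  rw [e3]
  have h2 : (1 - 2 * ε) * (2.4 * (I / a ^ 2)) ≤ (1 - 2 * ε) * J :=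
    mul_le_mul_of_nonneg_left hJ (by linarith)
  nlinarith

/-! ### The finite-dimensional second variation -/

/-- Area of the circular segment of half-aperture `θ` whose chord has half-length one. -/
def segmentArea (θ : ℝ) : ℝ := (θ - Real.sin θ * Real.cos θ) / Real.sin θ ^ 2

/-- Derivative of the curvature with respect to the area, for the circular segment of
half-aperture `θ` whose chord has half-length one. -/
def segmentStiffness (θ : ℝ) : ℝ :=
  Real.sin θ ^ 3 * (Real.cos θ / (2 * (Real.sin θ - θ * Real.cos θ)))

theorem hasDerivAt_segmentArea {θ : ℝ} (h0 : 0 < θ) (hπ : θ < Real.pi) :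
    HasDerivAt segmentArea (2 * (Real.sin θ - θ * Real.cos θ) / Real.sin θ ^ 3) θ := by
  have hs := Real.sin_pos_of_pos_of_lt_pi h0 hπ
  have h := ((hasDerivAt_id θ).sub ((Real.hasDerivAt_sin θ).mul (Real.hasDerivAt_cos θ))).div
    ((Real.hasDerivAt_sin θ).pow 2) (pow_pos hs 2).ne'
  refine h.congr_deriv ?_
  simp only [id, Pi.sub_apply, Pi.mul_apply, Pi.pow_apply]
  have hc : Real.cos θ ^ 2 = 1 - Real.sin θ ^ 2 := by
    have := Real.sin_sq_add_cos_sq θ; linarith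
  field_simp
  push_cast
  ring_nf
  rw [hc]
  ring

theorem segmentArea_strictMonoOn : StrictMonoOn segmentArea (Ioo 0 Real.pi) := by
  apply strictMonoOn_of_deriv_pos (convex_Ioo _ _)
  · intro θ hθ
    exact (hasDerivAt_segmentArea hθ.1 hθ.2).continuousAt.continuousWithinAt
  · intro θ hθ
    rw [interior_Ioo] at hθ
    rw [(hasDerivAt_segmentArea hθ.1 hθ.2).deriv]
    have := Real.sin_sub_mul_cos_pos hθ.1 hθ.2
    have := Real.sin_pos_of_pos_of_lt_pi hθ.1 hθ.2
    positivity

/-- A form of the Cusa–Huygens inequality. -/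
theorem Real.three_mul_sin_mul_cos_lt {θ : ℝ} (h0 : 0 < θ) (hπ : θ < Real.pi) :
    3 * (Real.sin θ * Real.cos θ) < θ * (1 + 2 * Real.cos θ ^ 2) := by
  have hm : StrictMonoOn (fun θ : ℝ => θ * (1 + 2 * Real.cos θ ^ 2) - 3 * (Real.sin θ * Real.cos θ))
      (Ico 0 Real.pi) := by
    apply strictMonoOn_of_deriv_pos (convex_Ico _ _) (by fun_prop)
    intro θ hθ
    rw [interior_Ico] at hθ
    have h1 := Real.sin_sub_mul_cos_pos hθ.1 hθ.2
    have h2 := Real.sin_pos_of_pos_of_lt_pi hθ.1 hθ.2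
    have hd : HasDerivAt
        (fun θ : ℝ => θ * (1 + 2 * Real.cos θ ^ 2) - 3 * (Real.sin θ * Real.cos θ))
        (4 * Real.sin θ * (Real.sin θ - θ * Real.cos θ)) θ := by
      refine (((hasDerivAt_id θ).mul ((((Real.hasDerivAt_cos θ).pow 2).const_mul 2).const_add
        1)).sub (((Real.hasDerivAt_sin θ).mul (Real.hasDerivAt_cos θ)).const_mul 3)).congr_deriv ?_
      simp only [id, Pi.pow_apply]
      have hc : Real.cos θ ^ 2 = 1 - Real.sin θ ^ 2 := by
        have := Real.sin_sq_add_cos_sq θ; linarith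
      push_cast
      ring_nf
      rw [hc]
      ring
    rw [hd.deriv]
    positivity
  have := hm (left_mem_Ico.2 Real.pi_pos) ⟨h0.le, hπ⟩ h0
  simp at this
  linarith

/-- Strict convexity of `segmentArea`: its second derivative is a positive multiple of the gap in
the Cusa–Huygens inequality. This drives the monotonicity of both chamber areas in φ. -/
theorem deriv_segmentArea_strictMonoOn :
    StrictMonoOn (fun θ => 2 * (Real.sin θ - θ * Real.cos θ) / Real.sin θ ^ 3) (Ioo 0 Real.pi) := by
  have hd : ∀ θ ∈ Ioo (0 : ℝ) Real.pi,
      HasDerivAt (fun θ => 2 * (Real.sin θ - θ * Real.cos θ) / Real.sin θ ^ 3)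
        (2 * (θ * (1 + 2 * Real.cos θ ^ 2) - 3 * (Real.sin θ * Real.cos θ)) / Real.sin θ ^ 4)
        θ := by
    intro θ hθ
    have hs := Real.sin_pos_of_pos_of_lt_pi hθ.1 hθ.2
    refine ((((Real.hasDerivAt_sin θ).sub ((hasDerivAt_id θ).mul (Real.hasDerivAt_cos θ))).const_mul
      2).div ((Real.hasDerivAt_sin θ).pow 3) (pow_pos hs 3).ne').congr_deriv ?_
    simp only [id, Pi.sub_apply, Pi.mul_apply, Pi.pow_apply]
    have hc : Real.cos θ ^ 2 = 1 - Real.sin θ ^ 2 := by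
      have := Real.sin_sq_add_cos_sq θ; linarith
    field_simp
    push_cast
    ring_nf
    rw [hc]
    ring
  apply strictMonoOn_of_deriv_pos (convex_Ioo _ _)
  · intro θ hθ
    exact (hd θ hθ).continuousAt.continuousWithinAt
  · intro θ hθ
    rw [interior_Ioo] at hθ
    rw [(hd θ hθ).deriv]
    have := Real.three_mul_sin_mul_cos_lt hθ.1 hθ.2
    have := Real.sin_pos_of_pos_of_lt_pi hθ.1 hθ.2
    have : 0 < θ * (1 + 2 * Real.cos θ ^ 2) - 3 * (Real.sin θ * Real.cos θ) := by linarith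
    positivity

/-- Area of the smaller chamber of the standard double bubble, normalised by the distance of
the singular points, in terms of the half-aperture of the common interface. -/
def smallArea (φ : ℝ) : ℝ := segmentArea (2 * Real.pi / 3 - φ) + segmentArea φ

/-- Area of the larger chamber of the standard double bubble, normalised by the distance of
the singular points, in terms of the half-aperture of the common interface. -/
def largeArea (φ : ℝ) : ℝ := segmentArea (2 * Real.pi / 3 + φ) - segmentArea φ

/-- As φ grows, one segment loses aperture at the rate at which the other gains it. By convexity the
loss dominates, because `φ < 2π/3 - φ` on this interval. -/
theorem smallArea_strictAntiOn : StrictAntiOn smallArea (Ioo 0 (Real.pi / 3)) := by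
  have hd : ∀ φ ∈ Ioo 0 (Real.pi / 3), HasDerivAt smallArea _ φ := fun φ hφ =>
    ((hasDerivAt_segmentArea (θ := 2 * Real.pi / 3 - φ) (by linarith [hφ.2, Real.pi_pos])
      (by linarith [hφ.1, Real.pi_pos])).comp_const_sub (2 * Real.pi / 3) φ).add
      (hasDerivAt_segmentArea hφ.1 (by linarith [hφ.2, Real.pi_pos]))
  apply strictAntiOn_of_deriv_neg (convex_Ioo _ _)
  · intro φ hφ
    exact (hd φ hφ).continuousAt.continuousWithinAt
  · intro φ hφ
    rw [interior_Ioo] at hφ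
    rw [(hd φ hφ).deriv]
    have := deriv_segmentArea_strictMonoOn (a := φ) (b := 2 * Real.pi / 3 - φ)
      ⟨hφ.1, by linarith [hφ.2, Real.pi_pos]⟩ ⟨by linarith [hφ.2, Real.pi_pos], by
        linarith [hφ.1, Real.pi_pos]⟩ (by linarith [hφ.2])
    simp only at this
    linarith

theorem largeArea_strictMonoOn : StrictMonoOn largeArea (Ioo 0 (Real.pi / 3)) := by
  have hd : ∀ φ ∈ Ioo 0 (Real.pi / 3), HasDerivAt largeArea _ φ := fun φ hφ =>
    ((hasDerivAt_segmentArea (θ := 2 * Real.pi / 3 + φ) (by linarith [hφ.1, Real.pi_pos])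
      (by linarith [hφ.2, Real.pi_pos])).comp_const_add (2 * Real.pi / 3) φ).sub
      (hasDerivAt_segmentArea hφ.1 (by linarith [hφ.2, Real.pi_pos]))
  apply strictMonoOn_of_deriv_pos (convex_Ioo _ _)
  · intro φ hφ
    exact (hd φ hφ).continuousAt.continuousWithinAt
  · intro φ hφ
    rw [interior_Ioo] at hφ
    rw [(hd φ hφ).deriv]
    have := deriv_segmentArea_strictMonoOn (a := φ) (b := 2 * Real.pi / 3 + φ)
      ⟨hφ.1, by linarith [hφ.2, Real.pi_pos]⟩ ⟨by linarith [hφ.1, Real.pi_pos], by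
        linarith [hφ.2, Real.pi_pos]⟩ (by linarith [Real.pi_pos])
    simp only at this
    linarith

theorem segmentArea_pos {θ : ℝ} (h0 : 0 < θ) (hπ : θ < Real.pi) : 0 < segmentArea θ := by
  have hs := Real.sin_pos_of_pos_of_lt_pi h0 hπ
  have h1 := Real.sin_lt h0
  have h2 := Real.cos_le_one θ
  have : 0 < θ - Real.sin θ * Real.cos θ := by nlinarith
  unfold segmentArea
  positivity

theorem smallArea_pos {φ : ℝ} (hφ : φ ∈ Ioo 0 (Real.pi / 3)) : 0 < smallArea φ :=
  add_pos (segmentArea_pos (by linarith [hφ.2, Real.pi_pos]) (by linarith [hφ.1, Real.pi_pos]))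
    (segmentArea_pos hφ.1 (by linarith [hφ.2, Real.pi_pos]))

theorem largeArea_pos {φ : ℝ} (hφ : φ ∈ Ioo 0 (Real.pi / 3)) : 0 < largeArea φ :=
  sub_pos.2 (segmentArea_strictMonoOn ⟨hφ.1, by linarith [hφ.2, Real.pi_pos]⟩
    ⟨by linarith [hφ.1, Real.pi_pos], by linarith [hφ.2, Real.pi_pos]⟩ (by linarith [Real.pi_pos]))

/-- The ratio of the areas determines the shape of the standard double bubble. -/
theorem eq_of_area_ratio_eq {φ ψ : ℝ} (hφ : φ ∈ Ioo 0 (Real.pi / 3))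
    (hψ : ψ ∈ Ioo 0 (Real.pi / 3))
    (h : smallArea φ / largeArea φ = smallArea ψ / largeArea ψ) : φ = ψ := by
  have key : ∀ {φ ψ : ℝ}, φ ∈ Ioo 0 (Real.pi / 3) → ψ ∈ Ioo 0 (Real.pi / 3) → φ < ψ →
      smallArea ψ / largeArea ψ < smallArea φ / largeArea φ := by
    intro φ ψ hφ hψ hlt
    exact div_lt_div₀' (smallArea_strictAntiOn hφ hψ hlt).le (largeArea_strictMonoOn hφ hψ hlt)
      (smallArea_pos hφ) (largeArea_pos hφ)
  rcases lt_trichotomy φ ψ with hlt | rfl | hlt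
  · exact absurd h (key hφ hψ hlt).ne'
  · rfl
  · exact absurd h (key hψ hφ hlt).ne

/-- Cauchy–Schwarz in the metric of the first two terms gives `(x m + y)² ≤ (x² p m / 2 + K y²) (2 m
/ p + 1 / K)`. A negative k is thus absorbed exactly under `h`. Each exterior arc is handled this
way with a share K of the stiffness of the common interface. -/
theorem exists_form_ge_of_absorb {p m K k : ℝ} (hp : 0 < p) (hm : 0 < m) (hK : 0 < K)
    (h : -k * (2 * m / p + 1 / K) < 1) :
    ∃ c > (0 : ℝ), ∀ x y : ℝ,
      c * (x ^ 2 + y ^ 2) ≤ x ^ 2 * (p * m) / 2 + K * y ^ 2 + k * (x * m + y) ^ 2 := by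
  have hN : 0 < min (p * m / 2) K := lt_min (by positivity) hK
  have hle : ∀ x y : ℝ, min (p * m / 2) K * (x ^ 2 + y ^ 2) ≤ x ^ 2 * (p * m) / 2 + K * y ^ 2 := by
    intro x y
    nlinarith [mul_le_mul_of_nonneg_right (min_le_left (p * m / 2) K) (sq_nonneg x),
      mul_le_mul_of_nonneg_right (min_le_right (p * m / 2) K) (sq_nonneg y)]
  have hCS : ∀ x y : ℝ, (x * m + y) ^ 2 ≤
      (x ^ 2 * (p * m) / 2 + K * y ^ 2) * (2 * m / p + 1 / K) := by
    intro x y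
    have : (x ^ 2 * (p * m) / 2 + K * y ^ 2) * (2 * m / p + 1 / K) - (x * m + y) ^ 2 =
        m / (2 * (p * K)) * (p * x - 2 * K * y) ^ 2 := by
      field_simp; ring
    have : 0 ≤ m / (2 * (p * K)) * (p * x - 2 * K * y) ^ 2 := by positivity
    linarith
  rcases le_or_gt 0 k with hk | hk
  · refine ⟨_, hN, fun x y => (hle x y).trans ?_⟩
    have : 0 ≤ k * (x * m + y) ^ 2 := by positivity
    linarith
  · set δ := 1 + k * (2 * m / p + 1 / K) with hδ
    have hδ0 : 0 < δ := by rw [hδ]; linarith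
    refine ⟨δ * min (p * m / 2) K, by positivity, fun x y => ?_⟩
    have h1 := mul_le_mul_of_nonneg_left (hle x y) hδ0.le
    have h2 := mul_le_mul_of_nonpos_left (hCS x y) hk.le
    rw [hδ] at h1
    rw [hδ]
    nlinarith

/-- `1 - (−κ)(2 m / p)` for the stiffness `κ` of an arc and an area `m = G ± G₀`. -/
theorem stiffness_absorb_iff {θ g K : ℝ} (h0 : 0 < θ) (hπ : θ < Real.pi) (hK : 0 < K)
    (h : 0 < Real.sin θ * (1 + Real.cos θ / (2 * K)) + Real.cos θ * g) :
    -segmentStiffness θ * (2 * (segmentArea θ + g) / Real.sin θ + 1 / K) < 1 := by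
  have hs := Real.sin_pos_of_pos_of_lt_pi h0 hπ
  have hD := Real.sin_sub_mul_cos_pos h0 hπ
  have hc : Real.cos θ ^ 2 = 1 - Real.sin θ ^ 2 := by
    have := Real.sin_sq_add_cos_sq θ; linarith
  -- The slack in the criterion factors: the free θ in the numerator combines with the denominator
  -- into `sin θ`, leaving a positive factor times the expression of the hypothesis, which is
  -- trigonometric apart from g and K.
  have e : 1 - -segmentStiffness θ * (2 * (segmentArea θ + g) / Real.sin θ + 1 / K) =
      Real.sin θ ^ 2 / (Real.sin θ - θ * Real.cos θ) *
        (Real.sin θ * (1 + Real.cos θ / (2 * K)) + Real.cos θ * g) := by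
    unfold segmentStiffness segmentArea
    set D := Real.sin θ - θ * Real.cos θ with hDdef
    have hD0 := hD.ne'
    have e1 : 1 - -(Real.sin θ ^ 3 * (Real.cos θ / (2 * D))) *
        (2 * ((θ - Real.sin θ * Real.cos θ) / Real.sin θ ^ 2 + g) / Real.sin θ + 1 / K) =
        (D + θ * Real.cos θ - Real.sin θ * Real.cos θ ^ 2 + Real.sin θ ^ 2 * Real.cos θ * g +
          Real.sin θ ^ 3 * Real.cos θ / (2 * K)) / D := by
      field_simp
      ring
    rw [e1, hc, show D + θ * Real.cos θ = Real.sin θ by rw [hDdef]; ring]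
    field_simp
    ring
  have : 0 < Real.sin θ ^ 2 / (Real.sin θ - θ * Real.cos θ) *
        (Real.sin θ * (1 + Real.cos θ / (2 * K)) + Real.cos θ * g) := by positivity
  linarith

/-- From `sin φ < φ` the denominator satisfies `sin φ - φ cos φ ≤ sin φ (1 - cos φ)`, and `sin³ φ =
sin φ (1 - cos φ) (1 + cos φ)`. -/
theorem segmentStiffness_ge {φ : ℝ} (h0 : 0 < φ) (h1 : φ < Real.pi / 2) :
    Real.cos φ * (1 + Real.cos φ) / 2 ≤ segmentStiffness φ := by
  have hs := Real.sin_pos_of_pos_of_lt_pi h0 (by linarith)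
  have hD := Real.sin_sub_mul_cos_pos h0 (by linarith)
  have hc0 : 0 < Real.cos φ := Real.cos_pos_of_mem_Ioo ⟨by linarith, h1⟩
  have hlt := Real.sin_lt h0
  unfold segmentStiffness
  rw [← mul_div_assoc, div_le_div_iff₀ (by norm_num) (by positivity)]
  have h2 : (Real.sin φ - φ * Real.cos φ) * (1 + Real.cos φ) ≤ Real.sin φ ^ 3 := by
    have : Real.sin φ ^ 3 = Real.sin φ * (1 - Real.cos φ) * (1 + Real.cos φ) := by
      have := Real.sin_sq_add_cos_sq φ
      have e : Real.sin φ ^ 2 = 1 - Real.cos φ ^ 2 := by linarith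
      rw [pow_succ, e]; ring
    rw [this]
    apply mul_le_mul_of_nonneg_right _ (by linarith)
    nlinarith
  nlinarith [mul_le_mul_of_nonneg_left h2 hc0.le]

theorem Real.sin_two_pi_div_three : Real.sin (2 * Real.pi / 3) = √3 / 2 := by
  rw [show 2 * Real.pi / 3 = Real.pi - Real.pi / 3 by ring, Real.sin_pi_sub, Real.sin_pi_div_three]

theorem Real.cos_two_pi_div_three : Real.cos (2 * Real.pi / 3) = -(1 / 2) := by
  rw [show 2 * Real.pi / 3 = Real.pi - Real.pi / 3 by ring, Real.cos_pi_sub, Real.cos_pi_div_three]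

/-- The absorption criterion for the exterior arc of the smaller chamber when `φ ≤ π/6`, with `r =
√3`, `s = sin φ`, `c = cos φ`, `g = segmentArea φ`, `k` the stiffness of the common interface and
0.45 the share allotted to this arc. The bounds are numerical and have ample room. -/
theorem sin_add_two_pi_div_three_aux {r s c g k : ℝ} (hr : r ^ 2 = 3) (hrl : 1.732 < r)
    (hs : 0 < s) (hs6 : s ≤ 1 / 2) (hsc : s ^ 2 + c ^ 2 = 1) (hc6 : r / 2 ≤ c) (hc1 : c ≤ 1)
    (hk : 0.8079 < k) (hg : 0 < g) (hgu : g * c ≤ s) :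
    0 < (r / 2 * c + 1 / 2 * s) * (1 + (-(1 / 2) * c + r / 2 * s) / (2 * (0.45 * k))) +
      (-(1 / 2) * c + r / 2 * s) * g := by
  have hru : r < 1.7321 := by nlinarith
  have hC : -(1 / 2) ≤ -(1 / 2) * c + r / 2 * s := by nlinarith
  have hS : 0.866 ≤ r / 2 * c + 1 / 2 * s := by
    have h1 : 1 - c ≤ s ^ 2 := by nlinarith
    nlinarith
  -- The lower bound comes from the parabola `-s/2 + √3 s²/2`, whose minimum is `-1/(8√3) ≈
  -- -0.0722`.
  have hCG : -0.0723 ≤ (-(1 / 2) * c + r / 2 * s) * g := by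
    have h1 : (-(1 / 2) * c + r / 2 * s) * g = -(1 / 2) * (g * c) + r / 2 * s * g := by ring
    have h2 : g * c ≤ g := by nlinarith
    have h4 : r / 2 * s * (g * c) ≤ r / 2 * s * g :=
      mul_le_mul_of_nonneg_left h2 (by positivity)
    have hg0 : 0 < g * c := mul_pos hg (by linarith)
    rcases le_or_gt (r / 2 * s) (1 / 2) with h5 | h5
    · have h6 : (r / 2 * s - 1 / 2) * s ≤ (r / 2 * s - 1 / 2) * (g * c) :=
        mul_le_mul_of_nonpos_left hgu (by linarith)
      nlinarith [sq_nonneg (r * s - 1 / 2)]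
    · nlinarith
  have hq : -0.7 ≤ (-(1 / 2) * c + r / 2 * s) / (2 * (0.45 * k)) := by
    rw [le_div_iff₀ (by positivity)]; linarith
  have h7 : 0.866 * 0.3 ≤
      (r / 2 * c + 1 / 2 * s) * (1 + (-(1 / 2) * c + r / 2 * s) / (2 * (0.45 * k))) :=
    mul_le_mul hS (by linarith) (by norm_num) (by linarith)
  linarith

/-- The absorption criterion for the exterior arc of the larger chamber when `φ > π/6`: `c = cos φ`,
while `S` and `C` are the sine and cosine of `2π/3 + φ`. Here K is twice the lower bound of
`segmentStiffness_ge`. The exchanged area helps, since both C and `-g` are negative, and outweighs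
the deficit `S (K + C)`. -/
theorem cos_mul_one_add_cos_aux {c g K C S : ℝ} (hK : K = c * (1 + c)) (hc : 1 / 2 < c)
    (hc6 : c ≤ 0.86605) (hS0 : 0 < S) (hS : S ≤ 1 / 2)
    (hC1 : -1 ≤ C) (hC0 : C < -0.866) (hg : 1 - c ≤ g) :
    0 < S * (1 + C / K) + C * -g := by
  have hKpos : 3 / 4 < K := by rw [hK]; nlinarith
  have e : S * (1 + C / K) + C * -g = (S * (K + C) + C * -g * K) / K := by
    field_simp
  rw [e]
  apply div_pos _ (by linarith)
  have hGK : (1 - c) * K ≤ g * K := mul_le_mul_of_nonneg_right hg (by linarith)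
  -- `c - c³` is concave for positive c, so its minimum over the range is at an end; it is about
  -- 0.2165 at the right one, where `c ≈ √3/2`.
  have hcs : 0.216 ≤ (1 - c) * K := by
    have : (1 - c) * K = c * (1 - c ^ 2) := by rw [hK]; ring
    rw [this]
    nlinarith [mul_nonneg (sub_nonneg.2 hc.le) (sub_nonneg.2 hc6)]
  have hCG : (-C) * 0.216 ≤ (-C) * (g * K) :=
    mul_le_mul_of_nonneg_left (by linarith) (by linarith)
  have hCG' : C * -g * K = (-C) * (g * K) := by ring
  rw [hCG']
  rcases le_or_gt 0 (K + C) with h5 | h5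
  · have : 0 ≤ S * (K + C) := by positivity
    linarith
  · have : 1 / 2 * (K + C) ≤ S * (K + C) := mul_le_mul_of_nonpos_right hS h5.le
    linarith

/-- Positivity of the finite-dimensional part of the second variation of the standard double
bubble with different areas. -/
theorem exists_form_ge {φ : ℝ} (hφ : φ ∈ Ioo 0 (Real.pi / 3)) :
    ∃ c > (0 : ℝ), ∀ x y : ℝ, c * (x ^ 2 + y ^ 2) ≤
      x ^ 2 * (Real.sin (2 * Real.pi / 3 - φ) * smallArea φ +
          Real.sin (2 * Real.pi / 3 + φ) * largeArea φ) / 2 +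
        segmentStiffness φ * y ^ 2 +
        segmentStiffness (2 * Real.pi / 3 - φ) * (x * smallArea φ + y) ^ 2 +
        segmentStiffness (2 * Real.pi / 3 + φ) * (x * largeArea φ - y) ^ 2 := by
  have hπ := Real.pi_pos
  obtain ⟨h0, h3⟩ := hφ
  have hm1 := smallArea_pos ⟨h0, h3⟩
  have hm2 := largeArea_pos ⟨h0, h3⟩
  have hs1 : 0 < Real.sin (2 * Real.pi / 3 - φ) :=
    Real.sin_pos_of_pos_of_lt_pi (by linarith) (by linarith)
  have hs2 : 0 < Real.sin (2 * Real.pi / 3 + φ) :=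
    Real.sin_pos_of_pos_of_lt_pi (by linarith) (by linarith)
  have hκ := segmentStiffness_ge h0 (by linarith)
  have hs := Real.sin_pos_of_pos_of_lt_pi h0 (by linarith)
  have hc : 1 / 2 < Real.cos φ := by
    rw [← Real.cos_pi_div_three]
    exact Real.cos_lt_cos_of_nonneg_of_le_pi h0.le (by linarith) h3
  have hc1 := Real.cos_le_one φ
  have hsc := Real.sin_sq_add_cos_sq φ
  have hG0 := segmentArea_pos h0 (by linarith)
  have h3s : (√3) ^ 2 = 3 := Real.sq_sqrt (by norm_num)
  have h3l : 1.732 < √3 := by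
    apply Real.lt_sqrt_of_sq_lt; norm_num
  have h3u : √3 < 1.7321 := by
    rw [Real.sqrt_lt' (by norm_num)]; norm_num
  have e1s : Real.sin (2 * Real.pi / 3 - φ) = √3 / 2 * Real.cos φ + 1 / 2 * Real.sin φ := by
    rw [Real.sin_sub, Real.sin_two_pi_div_three, Real.cos_two_pi_div_three]; ring
  have e1c : Real.cos (2 * Real.pi / 3 - φ) = -(1 / 2) * Real.cos φ + √3 / 2 * Real.sin φ := by
    rw [Real.cos_sub, Real.sin_two_pi_div_three, Real.cos_two_pi_div_three]
  have e2s : Real.sin (2 * Real.pi / 3 + φ) = √3 / 2 * Real.cos φ - 1 / 2 * Real.sin φ := by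
    rw [Real.sin_add, Real.sin_two_pi_div_three, Real.cos_two_pi_div_three]; ring
  have e2c : Real.cos (2 * Real.pi / 3 + φ) = -(1 / 2) * Real.cos φ - √3 / 2 * Real.sin φ := by
    rw [Real.cos_add, Real.sin_two_pi_div_three, Real.cos_two_pi_div_three]
  have hK0 : 0 < segmentStiffness φ := lt_of_lt_of_le (by positivity) hκ
  -- At `φ = π/6` the exterior arc of the smaller chamber is a half circle. Up to there both
  -- exterior arcs have nonpositive stiffness and share the common interface; beyond, only that of
  -- the larger chamber does.
  rcases le_or_gt φ (Real.pi / 6) with h6 | h6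
  · have hc6 : √3 / 2 ≤ Real.cos φ := by
      rw [← Real.cos_pi_div_six]
      exact Real.cos_le_cos_of_nonneg_of_le_pi h0.le (by linarith) h6
    have hs6 : Real.sin φ ≤ 1 / 2 := by
      rw [← Real.sin_pi_div_six]
      exact Real.sin_le_sin_of_le_of_le_pi_div_two (by linarith) (by linarith) h6
    -- The bound of `segmentStiffness_ge` at `cos φ = √3/2` is about 0.8080.
    have hκ8 : 0.8079 < segmentStiffness φ := by
      refine lt_of_lt_of_le ?_ hκ
      nlinarith
    have hG0u : segmentArea φ * Real.cos φ ≤ Real.sin φ := by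
      have ht := Real.lt_tan h0 (by linarith)
      have hcp : 0 < Real.cos φ := by linarith
      rw [Real.tan_eq_sin_div_cos, lt_div_iff₀ hcp] at ht
      unfold segmentArea
      rw [div_mul_eq_mul_div, div_le_iff₀ (by positivity)]
      have e : Real.sin φ * Real.sin φ ^ 2 = Real.sin φ - Real.sin φ * Real.cos φ ^ 2 := by
        have : Real.sin φ ^ 2 = 1 - Real.cos φ ^ 2 := by linarith
        rw [this]; ring
      rw [e]
      linarith
    -- The stiffness of the common interface is split as 0.45 + 0.55. The arc of the larger chamber
    -- gets more because its cosine can be as low as `-√3/2`, against `-1/2` for the other arc.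
    have a1 : -segmentStiffness (2 * Real.pi / 3 - φ) *
        (2 * (segmentArea (2 * Real.pi / 3 - φ) + segmentArea φ) / Real.sin (2 * Real.pi / 3 - φ) +
          1 / (0.45 * segmentStiffness φ)) < 1 := by
      apply stiffness_absorb_iff (by linarith) (by linarith) (by positivity)
      rw [e1s, e1c]
      exact sin_add_two_pi_div_three_aux h3s h3l hs hs6 hsc hc6 hc1 hκ8 hG0 hG0u
    have a2 : -segmentStiffness (2 * Real.pi / 3 + φ) *
        (2 * (segmentArea (2 * Real.pi / 3 + φ) + -segmentArea φ) /
          Real.sin (2 * Real.pi / 3 + φ) + 1 / (0.55 * segmentStiffness φ)) < 1 := by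
      apply stiffness_absorb_iff (by linarith) (by linarith) (by positivity)
      have hC : -0.86606 ≤ Real.cos (2 * Real.pi / 3 + φ) := by
        rw [← neg_le_neg_iff, ← Real.cos_pi_sub, neg_neg]
        refine le_trans ?_ (by linarith : √3 / 2 ≤ 0.86606)
        rw [← Real.cos_pi_div_six]
        exact Real.cos_le_cos_of_nonneg_of_le_pi (by linarith) (by linarith) (by linarith)
      have hC0 : Real.cos (2 * Real.pi / 3 + φ) ≤ 0 := by
        rw [e2c]
        have : 0 < √3 / 2 * Real.sin φ := by positivity
        linarith
      have hq : -0.98 ≤ Real.cos (2 * Real.pi / 3 + φ) / (2 * (0.55 * segmentStiffness φ)) := by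
        rw [le_div_iff₀ (by positivity)]; linarith
      have h2 : 0 ≤ Real.cos (2 * Real.pi / 3 + φ) * -segmentArea φ :=
        mul_nonneg_of_nonpos_of_nonpos hC0 (by linarith)
      exact add_pos_of_pos_of_nonneg (mul_pos hs2 (by linarith)) h2
    obtain ⟨c1, hc1, H1⟩ := exists_form_ge_of_absorb hs1 hm1
      (by positivity : 0 < 0.45 * segmentStiffness φ) a1
    obtain ⟨c2, hc2, H2⟩ := exists_form_ge_of_absorb hs2 hm2
      (by positivity : 0 < 0.55 * segmentStiffness φ)
      (by simpa [largeArea, sub_eq_add_neg] using a2)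
    refine ⟨c1 + c2, by positivity, fun x y => ?_⟩
    have h1 := H1 x y
    -- Area leaving one chamber enters the other, hence the opposite sign of y.
    have h2 := H2 x (-y)
    rw [← sub_eq_add_neg] at h2
    linarith
  · have hc6 : Real.cos φ ≤ √3 / 2 := by
      rw [← Real.cos_pi_div_six]
      exact Real.cos_le_cos_of_nonneg_of_le_pi (by linarith) (by linarith) h6.le
    -- The smaller chamber's arc is now at most a half circle, so its term is nonnegative and the
    -- whole stiffness of the common interface is available to the other arc.
    have hk1 : 0 ≤ segmentStiffness (2 * Real.pi / 3 - φ) := by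
      have hD := Real.sin_sub_mul_cos_pos (x := 2 * Real.pi / 3 - φ) (by linarith) (by linarith)
      have hC : 0 ≤ Real.cos (2 * Real.pi / 3 - φ) :=
        Real.cos_nonneg_of_mem_Icc ⟨by linarith, by linarith⟩
      unfold segmentStiffness
      positivity
    have a2 : -segmentStiffness (2 * Real.pi / 3 + φ) *
        (2 * (segmentArea (2 * Real.pi / 3 + φ) + -segmentArea φ) /
          Real.sin (2 * Real.pi / 3 + φ) + 1 / segmentStiffness φ) < 1 := by
      apply stiffness_absorb_iff (by linarith) (by linarith) (by positivity)
      have hS2 : Real.sin (2 * Real.pi / 3 + φ) ≤ 1 / 2 := by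
        rw [← Real.sin_pi_sub, ← Real.sin_pi_div_six]
        exact Real.sin_le_sin_of_le_of_le_pi_div_two (by linarith) (by linarith) (by linarith)
      have hC1 := Real.neg_one_le_cos (2 * Real.pi / 3 + φ)
      have hC0 : Real.cos (2 * Real.pi / 3 + φ) < -0.866 := by
        rw [← neg_lt_neg_iff, ← Real.cos_pi_sub, neg_neg]
        refine lt_of_lt_of_le (by linarith : 0.866 < √3 / 2) ?_
        rw [← Real.cos_pi_div_six]
        exact Real.cos_le_cos_of_nonneg_of_le_pi (by linarith) (by linarith) (by linarith)
      have hG0l : 1 - Real.cos φ ≤ segmentArea φ := by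
        unfold segmentArea
        rw [le_div_iff₀ (by positivity)]
        have := Real.sin_lt h0
        have h4 := Real.sin_le_one φ
        have : 0 ≤ Real.sin φ * (1 - Real.cos φ) * (1 - Real.sin φ) :=
          mul_nonneg (mul_nonneg hs.le (by linarith)) (by linarith)
        linarith
      have hq : Real.cos (2 * Real.pi / 3 + φ) / (Real.cos φ * (1 + Real.cos φ)) ≤
          Real.cos (2 * Real.pi / 3 + φ) / (2 * segmentStiffness φ) := by
        rw [div_le_div_iff₀ (by positivity) (by positivity)]
        exact mul_le_mul_of_nonpos_left (by linarith) (by linarith)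
      have hstep := cos_mul_one_add_cos_aux rfl hc (by linarith) hs2 hS2 hC1 hC0 hG0l
      have := mul_le_mul_of_nonneg_left (add_le_add_right hq 1) hs2.le
      linarith
    obtain ⟨c2, hc2, H2⟩ := exists_form_ge_of_absorb hs2 hm2 hK0
      (by simpa [largeArea, sub_eq_add_neg] using a2)
    refine ⟨c2, hc2, fun x y => ?_⟩
    have h2 := H2 x (-y)
    rw [← sub_eq_add_neg] at h2
    have h4 : 0 ≤ segmentStiffness (2 * Real.pi / 3 - φ) * (x * smallArea φ + y) ^ 2 := by
      positivity
    have h5 : 0 ≤ x ^ 2 * (Real.sin (2 * Real.pi / 3 - φ) * smallArea φ) := by positivity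
    linarith

/-- Positivity of the finite-dimensional part of the second variation of the standard double
bubble with equal areas. -/
theorem exists_form_ge_sym :
    ∃ c > (0 : ℝ), ∀ x y : ℝ, c * (x ^ 2 + y ^ 2) ≤
      x ^ 2 * (√3 / 2 * segmentArea (2 * Real.pi / 3) +
          √3 / 2 * segmentArea (2 * Real.pi / 3)) / 2 +
        1 * y ^ 2 +
        segmentStiffness (2 * Real.pi / 3) * (x * segmentArea (2 * Real.pi / 3) + y) ^ 2 +
        segmentStiffness (2 * Real.pi / 3) * (x * segmentArea (2 * Real.pi / 3) - y) ^ 2 := by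
  have hπ := Real.pi_pos
  have hm := segmentArea_pos (θ := 2 * Real.pi / 3) (by linarith) (by linarith)
  have hs3 : (0 : ℝ) < √3 := by positivity
  -- By symmetry each arc takes half of the coefficient 1 of the common segment. No area is added to
  -- the circular segment, so `g = 0`.
  have a := stiffness_absorb_iff (θ := 2 * Real.pi / 3) (g := 0) (K := 1 / 2) (by linarith)
    (by linarith) (by norm_num) (by
      rw [Real.sin_two_pi_div_three, Real.cos_two_pi_div_three]
      norm_num)
  rw [Real.sin_two_pi_div_three, add_zero] at a
  obtain ⟨c, hc, H⟩ := exists_form_ge_of_absorb (p := √3 / 2) (by positivity) hm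
    (by norm_num : (0 : ℝ) < 1 / 2) a
  refine ⟨c + c, by positivity, fun x y => ?_⟩
  have h1 := H x y
  have h2 := H x (-y)
  nlinarith

/-! ### From positivity of the form to a stability estimate -/

theorem sq_sum_le (x y m₁ m₂ : ℝ) : y ^ 2 + (-(x * m₁ + y)) ^ 2 + (-(x * m₂ - y)) ^ 2 ≤
    (5 + 2 * m₁ ^ 2 + 2 * m₂ ^ 2) * (x ^ 2 + y ^ 2) := by
  have h : (5 + 2 * m₁ ^ 2 + 2 * m₂ ^ 2) * (x ^ 2 + y ^ 2) -
      (y ^ 2 + (-(x * m₁ + y)) ^ 2 + (-(x * m₂ - y)) ^ 2) =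
      5 * x ^ 2 + (x * m₁ - y) ^ 2 + (x * m₂ + y) ^ 2 + 2 * (m₁ * y) ^ 2 + 2 * (m₂ * y) ^ 2 := by
    ring
  have : 0 ≤ 5 * x ^ 2 + (x * m₁ - y) ^ 2 + (x * m₂ + y) ^ 2 + 2 * (m₁ * y) ^ 2 +
      2 * (m₂ * y) ^ 2 := by positivity
  linarith

/-- The right side is the factor relating the exact dilation term to the one in the quadratic form,
once σ is replaced by the parameter x that solves the area constraints; it tends to 1 with σ. -/
theorem one_sub_two_mul_abs_le {σ : ℝ} (h : -(1 / 2) < σ) :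
    1 - 2 * |σ| ≤ 4 * (1 + σ) ^ 2 / (2 + σ) ^ 2 := by
  have h2 : 0 < 2 + σ := by linarith
  rw [le_div_iff₀ (by positivity)]
  rcases abs_cases σ with ⟨h1, h'⟩ | ⟨h1, h'⟩
  · rw [h1]
    have : 0 ≤ σ ^ 3 := by positivity
    nlinarith
  · rw [h1]
    have : 0 ≤ -σ * (4 + 5 * σ + 2 * σ ^ 2) := mul_nonneg (by linarith) (by nlinarith)
    nlinarith

/-- From positivity of the second variation to stability. The `A k` are the area variations and
the `Y k` the corrected length variations of the interfaces. -/
theorem exists_stability_of_form_ge {P m₁ m₂ c₀ : ℝ} {κ : Fin 3 → ℝ} (hP : 0 < P) (hc₀ : 0 < c₀)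
    (hform : ∀ x y : ℝ, c₀ * (x ^ 2 + y ^ 2) ≤ x ^ 2 * P / 4 + κ 0 * y ^ 2 +
      κ 1 * (x * m₁ + y) ^ 2 + κ 2 * (x * m₂ - y) ^ 2) :
    ∃ η > (0 : ℝ), ∃ σ₁ > (0 : ℝ), σ₁ ≤ 1 / 2 ∧ ∃ c > (0 : ℝ), ∀ (σ : ℝ) (A Y N : Fin 3 → ℝ),
      |σ| < σ₁ → (1 + σ) ^ 2 * (m₁ + A 1 + A 0) = m₁ → (1 + σ) ^ 2 * (m₂ + A 2 - A 0) = m₂ →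
      (∀ k, 0 ≤ N k) → (∀ k, (κ k - η) / 2 * A k ^ 2 + N k ≤ Y k) →
      c * σ ^ 2 + (∑ k, N k) / 2 ≤ σ ^ 2 * P / (2 * (1 + σ)) + (1 + σ) * ∑ k, Y k := by
  set C := 5 + 2 * m₁ ^ 2 + 2 * m₂ ^ 2 with hC
  have hC0 : 0 < C := by positivity
  -- Half of the form is worth `c₀ / 2`. The error η costs `c₀ / 8` through `sq_sum_le`, the
  -- dilation factor costs another `c₀ / 8`, and `c₀ / 4` is left for `x²`. The factor `1 + σ ≥ 1/2`
  -- turns it into `c₀ / 8`.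
  refine ⟨c₀ / (4 * C), by positivity, min (1 / 2) (c₀ / (2 * P)),
    lt_min (by norm_num) (by positivity), min_le_left _ _, c₀ / 8, by positivity, ?_⟩
  intro σ A Y N hσ h1 h2 hN hY
  have hσ2 : |σ| < 1 / 2 := hσ.trans_le (min_le_left _ _)
  have hσP : |σ| < c₀ / (2 * P) := hσ.trans_le (min_le_right _ _)
  rw [lt_div_iff₀ (by positivity)] at hσP
  obtain ⟨hl, hr⟩ := abs_lt.1 hσ2
  have hp : 0 < 1 + σ := by linarith
  -- `x = 1 - 1 / (1 + σ)²` is the relative area that the perturbations must remove to compensate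
  -- the dilation. With it the constraints become linear and express `A 1`, `A 2` through x and `A
  -- 0`.
  set x := σ * (2 + σ) / (1 + σ) ^ 2 with hx
  have hxe : (1 + σ) ^ 2 * x = σ * (2 + σ) := by rw [hx]; field_simp
  have hA1 : A 1 = -(x * m₁ + A 0) := by
    have : (1 + σ) ^ 2 * (A 1 + (x * m₁ + A 0)) = 0 := by
      linear_combination h1 + m₁ * hxe
    rcases mul_eq_zero.1 this with h | h
    · exact absurd h (by positivity)
    · linarith
  have hA2 : A 2 = -(x * m₂ - A 0) := by
    have : (1 + σ) ^ 2 * (A 2 + (x * m₂ - A 0)) = 0 := by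
      linear_combination h2 + m₂ * hxe
    rcases mul_eq_zero.1 this with h | h
    · exact absurd h (by positivity)
    · linarith
  have hf := hform x (A 0)
  have hY' : ∑ k, ((κ k - c₀ / (4 * C)) / 2 * A k ^ 2 + N k) ≤ ∑ k, Y k :=
    Finset.sum_le_sum fun k _ => hY k
  have hNs : 0 ≤ ∑ k, N k := Finset.sum_nonneg fun k _ => hN k
  rw [Finset.sum_add_distrib] at hY'
  have hsum : ∑ k, (κ k - c₀ / (4 * C)) / 2 * A k ^ 2 =
      (κ 0 * A 0 ^ 2 + κ 1 * (x * m₁ + A 0) ^ 2 + κ 2 * (x * m₂ - A 0) ^ 2) / 2 -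
        c₀ / (8 * C) * (A 0 ^ 2 + A 1 ^ 2 + A 2 ^ 2) := by
    rw [Fin.sum_univ_three, hA1, hA2]; field_simp; ring
  have hA : A 0 ^ 2 + A 1 ^ 2 + A 2 ^ 2 ≤ C * (x ^ 2 + A 0 ^ 2) := by
    rw [hA1, hA2, hC]
    exact sq_sum_le x (A 0) m₁ m₂
  have hA' : c₀ / (8 * C) * (A 0 ^ 2 + A 1 ^ 2 + A 2 ^ 2) ≤ c₀ / 8 * (x ^ 2 + A 0 ^ 2) := by
    refine (mul_le_mul_of_nonneg_left hA (by positivity)).trans (le_of_eq ?_)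
    field_simp
  have hσx : σ ^ 2 * P / (2 * (1 + σ)) =
      (1 + σ) * (x ^ 2 * P / 8 * (4 * (1 + σ) ^ 2 / (2 + σ) ^ 2)) := by
    have : (2 + σ) ≠ 0 := by linarith
    rw [hx]; field_simp; ring
  have hβ : 1 - 2 * |σ| ≤ 4 * (1 + σ) ^ 2 / (2 + σ) ^ 2 :=
    one_sub_two_mul_abs_le hl
  have hxP : x ^ 2 * P / 8 - c₀ / 8 * x ^ 2 ≤ x ^ 2 * P / 8 * (4 * (1 + σ) ^ 2 / (2 + σ) ^ 2) := by
    have h3 : x ^ 2 * P / 8 * (1 - 2 * |σ|) ≤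
        x ^ 2 * P / 8 * (4 * (1 + σ) ^ 2 / (2 + σ) ^ 2) :=
      mul_le_mul_of_nonneg_left hβ (by positivity)
    have h4 : x ^ 2 * (|σ| * (2 * P)) ≤ x ^ 2 * c₀ :=
      mul_le_mul_of_nonneg_left hσP.le (sq_nonneg x)
    linarith
  -- To first order `x = 2σ`; on `|σ| ≤ 1/2` the needed inequality is `(1 + σ)² ≤ 2 + σ`.
  have hxσ : σ ^ 2 ≤ x ^ 2 := by
    rw [hx, div_pow, le_div_iff₀ (by positivity), mul_pow]
    apply mul_le_mul_of_nonneg_left _ (sq_nonneg σ)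
    refine pow_le_pow_left₀ (by positivity) ?_ 2
    have : σ ^ 2 ≤ 1 / 4 := by
      have := sq_le_sq' hl.le hr.le
      linarith
    linarith
  have hin : c₀ / 4 * x ^ 2 + ∑ k, N k ≤
      x ^ 2 * P / 8 * (4 * (1 + σ) ^ 2 / (2 + σ) ^ 2) + ∑ k, Y k := by
    have : 0 ≤ c₀ * A 0 ^ 2 := by positivity
    linarith
  rw [hσx, ← mul_add]
  have hlow : (1 / 2) * (c₀ / 4 * x ^ 2 + ∑ k, N k) ≤ (1 + σ) * (c₀ / 4 * x ^ 2 + ∑ k, N k) :=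
    mul_le_mul_of_nonneg_right (by linarith) (by positivity)
  have := mul_le_mul_of_nonneg_left hin hp.le
  have : c₀ / 8 * σ ^ 2 ≤ c₀ / 8 * x ^ 2 := mul_le_mul_of_nonneg_left hxσ (by positivity)
  linarith

/-! ### Flux identity for cones over arcs -/

/-- `f` is continuous on `[-a, a]`, with continuous bounded derivative `f'` on `(-a, a)`. -/
structure HasBoundedDerivOn (a : ℝ) (f f' : ℝ → ℝ) : Prop where
  continuousOn : ContinuousOn f (Icc (-a) a)
  hasDerivAt : ∀ t ∈ Ioo (-a) a, HasDerivAt f (f' t) t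
  continuousOn_deriv : ContinuousOn f' (Ioo (-a) a)
  bounded_deriv : ∃ M, ∀ t ∈ Ioo (-a) a, |f' t| ≤ M

theorem plane_eq (a b : ℝ) :
    (!₂[a, b] : Plane) = a • EuclideanSpace.single 0 1 + b • EuclideanSpace.single 1 1 := by
  ext i; fin_cases i <;> simp

theorem ContinuousOn.plane {X : Type*} [TopologicalSpace X] {f g : X → ℝ} {s : Set X}
    (hf : ContinuousOn f s) (hg : ContinuousOn g s) :
    ContinuousOn (fun t => (!₂[f t, g t] : Plane)) s := by
  simp only [plane_eq]
  exact (hf.smul continuousOn_const).add (hg.smul continuousOn_const)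

theorem Continuous.plane {X : Type*} [TopologicalSpace X] {f g : X → ℝ}
    (hf : Continuous f) (hg : Continuous g) : Continuous (fun t => (!₂[f t, g t] : Plane)) := by
  simp only [plane_eq]
  exact (hf.smul continuous_const).add (hg.smul continuous_const)

theorem HasDerivAt.plane {x y : ℝ → ℝ} {x' y' t : ℝ} (hx : HasDerivAt x x' t)
    (hy : HasDerivAt y y' t) : HasDerivAt (fun t => (!₂[x t, y t] : Plane)) !₂[x', y'] t := by
  simp only [plane_eq]
  exact (hx.smul_const _).add (hy.smul_const _)

/-- The identification of `ℝ × ℝ` with the plane. -/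
def prodToPlane (z : ℝ × ℝ) : Plane := !₂[z.1, z.2]

theorem measurePreserving_prodToPlane : MeasurePreserving prodToPlane :=
  (PiLp.volume_preserving_toLp (Fin 2)).comp
    (MeasurePreserving.symm _ (volume_preserving_finTwoArrow ℝ))

theorem measurableEmbedding_prodToPlane : MeasurableEmbedding prodToPlane :=
  ((MeasurableEquiv.finTwoArrow (α := ℝ)).symm.trans
    (MeasurableEquiv.toLp 2 (Fin 2 → ℝ))).measurableEmbedding

/-- The partial derivative `∂ⱼ Tᵢ`. -/
def partialDeriv (T : Plane → Plane) (i j : Fin 2) (x : Plane) : ℝ :=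
  (fderiv ℝ T x (EuclideanSpace.single j 1)) i

theorem divergence_eq (T : Plane → Plane) (x : Plane) :
    divergence T x = partialDeriv T 0 0 x + partialDeriv T 1 1 x := by
  simp [divergence, partialDeriv, Fin.sum_univ_two]

theorem continuous_partialDeriv {T : Plane → Plane} (hT : ContDiff ℝ 1 T) (i j : Fin 2) :
    Continuous (partialDeriv T i j) := by
  have h1 : Continuous (fun x => fderiv ℝ T x (EuclideanSpace.single j 1)) :=
    (hT.continuous_fderiv (by simp)).clm_apply continuous_const
  exact (EuclideanSpace.proj (𝕜 := ℝ) i).continuous.comp h1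

theorem continuous_divergence {T : Plane → Plane} (hT : ContDiff ℝ 1 T) :
    Continuous (divergence T) := by
  rw [funext (divergence_eq T)]
  exact (continuous_partialDeriv hT 0 0).add (continuous_partialDeriv hT 1 1)

theorem hasDerivAt_comp_plane {T : Plane → Plane} (hT : ContDiff ℝ 1 T) {x y : ℝ → ℝ}
    {x' y' t : ℝ} (hx : HasDerivAt x x' t) (hy : HasDerivAt y y' t) (i : Fin 2) :
    HasDerivAt (fun t => T !₂[x t, y t] i)
      (x' * partialDeriv T i 0 !₂[x t, y t] + y' * partialDeriv T i 1 !₂[x t, y t]) t := by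
  have h1 := ((hT.differentiable (by simp)) !₂[x t, y t]).hasFDerivAt.comp_hasDerivAt t
    (hx.plane hy)
  have h2 := (EuclideanSpace.proj (𝕜 := ℝ) i).hasFDerivAt.comp_hasDerivAt t h1
  refine h2.congr_deriv ?_
  rw [plane_eq x' y', map_add, map_smul, map_smul]
  simp [partialDeriv]

/-- A function which is continuous and bounded on a set. -/
def ContBddOn (S : Set (ℝ × ℝ)) (f : ℝ × ℝ → ℝ) : Prop :=
  ContinuousOn f S ∧ ∃ M, ∀ z ∈ S, |f z| ≤ M

namespace ContBddOn

variable {S : Set (ℝ × ℝ)} {f g : ℝ × ℝ → ℝ}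

theorem add (hf : ContBddOn S f) (hg : ContBddOn S g) : ContBddOn S (fun z => f z + g z) := by
  obtain ⟨hf, M, hM⟩ := hf
  obtain ⟨hg, N, hN⟩ := hg
  exact ⟨hf.add hg, M + N, fun z hz => (abs_add_le _ _).trans (add_le_add (hM z hz) (hN z hz))⟩

theorem sub (hf : ContBddOn S f) (hg : ContBddOn S g) : ContBddOn S (fun z => f z - g z) := by
  obtain ⟨hf, M, hM⟩ := hf
  obtain ⟨hg, N, hN⟩ := hg
  exact ⟨hf.sub hg, M + N, fun z hz => (abs_sub _ _).trans (add_le_add (hM z hz) (hN z hz))⟩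

theorem mul (hf : ContBddOn S f) (hg : ContBddOn S g) : ContBddOn S (fun z => f z * g z) := by
  obtain ⟨hf, M, hM⟩ := hf
  obtain ⟨hg, N, hN⟩ := hg
  refine ⟨hf.mul hg, M * N, fun z hz => ?_⟩
  rw [abs_mul]
  exact mul_le_mul (hM z hz) (hN z hz) (abs_nonneg _) ((abs_nonneg _).trans (hM z hz))

theorem of_isCompact {K : Set (ℝ × ℝ)} (hK : IsCompact K) (hSK : S ⊆ K) (hf : ContinuousOn f K) :
    ContBddOn S f := by
  obtain ⟨M, hM⟩ := hK.exists_bound_of_continuousOn hf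
  exact ⟨hf.mono hSK, M, fun z hz => hM z (hSK hz)⟩

theorem integrableOn (hf : ContBddOn S f) (hS : MeasurableSet S) (hv : volume S ≠ ∞) :
    IntegrableOn f S := by
  obtain ⟨hf, M, hM⟩ := hf
  exact IntegrableOn.of_bound (lt_top_iff_ne_top.2 hv) (hf.aestronglyMeasurable hS) M
    ((ae_restrict_iff' hS).2 (Filter.Eventually.of_forall hM))

end ContBddOn

/-- The parameter domain of a cone. -/
def coneDomain (a : ℝ) : Set (ℝ × ℝ) := Ioo 0 1 ×ˢ Ioo (-a) a

/-- The parametrisation of the cone with vertex `(p, q)` over the arc `(x, y)`. -/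
def coneMap (p q : ℝ) (x y : ℝ → ℝ) (z : ℝ × ℝ) : Plane :=
  !₂[p + z.1 * (x z.2 - p), q + z.1 * (y z.2 - q)]

theorem measurableSet_coneDomain (a : ℝ) : MeasurableSet (coneDomain a) :=
  measurableSet_Ioo.prod measurableSet_Ioo

theorem volume_coneDomain_ne_top (a : ℝ) : volume (coneDomain a) ≠ ∞ := by
  have hb : Bornology.IsBounded (coneDomain a) :=
    (Metric.isBounded_Ioo _ _).prod (Metric.isBounded_Ioo _ _)
  exact hb.measure_lt_top.ne

theorem coneDomain_subset (a : ℝ) : coneDomain a ⊆ Icc 0 1 ×ˢ Icc (-a) a :=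
  prod_mono Ioo_subset_Icc_self Ioo_subset_Icc_self

/-- The flux of `T` through the arc `(x, y)` with parameter in `(-a, a)`. -/
def flux (T : Plane → Plane) (a : ℝ) (x x' y y' : ℝ → ℝ) : ℝ :=
  ∫ t in (-a)..a, (T !₂[x t, y t] 0 * y' t - T !₂[x t, y t] 1 * x' t)

/-- The flux of `T` through the segment from `(p, q)` to `(x, y)`. -/
def segmentFlux (T : Plane → Plane) (p q x y : ℝ) : ℝ :=
  ∫ s in (0 : ℝ)..1, (T !₂[p + s * (x - p), q + s * (y - q)] 0 * (y - q) -
    T !₂[p + s * (x - p), q + s * (y - q)] 1 * (x - p))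

section Cone

variable {a p q : ℝ} {x x' y y' : ℝ → ℝ}

theorem hasFDerivAt_conePair {z : ℝ × ℝ} (hx : HasDerivAt x (x' z.2) z.2)
    (hy : HasDerivAt y (y' z.2) z.2) :
    HasFDerivAt (fun z : ℝ × ℝ => (p + z.1 * (x z.2 - p), q + z.1 * (y z.2 - q)))
      (Matrix.toLin (.finTwoProd ℝ) (.finTwoProd ℝ)
        !![x z.2 - p, z.1 * x' z.2; y z.2 - q, z.1 * y' z.2]).toContinuousLinearMap z := by
  rw [Matrix.toLin_finTwoProd_toContinuousLinearMap]
  have h1 : HasFDerivAt (fun z : ℝ × ℝ => x z.2 - p) _ z :=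
    (hx.comp_hasFDerivAt z (hasFDerivAt_snd (𝕜 := ℝ) (E := ℝ) (F := ℝ))).sub_const p
  have h2 : HasFDerivAt (fun z : ℝ × ℝ => y z.2 - q) _ z :=
    (hy.comp_hasFDerivAt z (hasFDerivAt_snd (𝕜 := ℝ) (E := ℝ) (F := ℝ))).sub_const q
  refine HasFDerivAt.congr_fderiv (((hasFDerivAt_fst.mul h1).const_add p).prodMk
    ((hasFDerivAt_fst.mul h2).const_add q)) ?_
  ext <;> simp

/-- Change of variables. The Jacobian of the cone map is `z.1` times the cross product of position
and velocity, and τ records its constant sign, that is, the orientation of the arc as seen from the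
vertex. -/
theorem setIntegral_cone (hx : HasBoundedDerivOn a x x') (hy : HasBoundedDerivOn a y y')
    (hinj : InjOn (coneMap p q x y) (coneDomain a)) {τ : ℝ} (hτ : |τ| = 1)
    (hpos : ∀ t ∈ Ioo (-a) a, 0 < τ * ((x t - p) * y' t - (y t - q) * x' t)) (g : Plane → ℝ) :
    ∫ w in coneMap p q x y '' coneDomain a, g w =
      τ * ∫ z in coneDomain a, z.1 * ((x z.2 - p) * y' z.2 - (y z.2 - q) * x' z.2) *
        g (coneMap p q x y z) := by
  set Ψ : ℝ × ℝ → ℝ × ℝ := fun z => (p + z.1 * (x z.2 - p), q + z.1 * (y z.2 - q)) with hΨ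
  have hcomp : coneMap p q x y = prodToPlane ∘ Ψ := rfl
  have hinj' : InjOn Ψ (coneDomain a) := by
    rw [hcomp] at hinj; exact hinj.of_comp
  rw [hcomp, image_comp, measurePreserving_prodToPlane.setIntegral_image_emb
    measurableEmbedding_prodToPlane,
    integral_image_eq_integral_abs_det_fderiv_smul volume (measurableSet_coneDomain a)
      (fun z hz => (hasFDerivAt_conePair (hx.hasDerivAt _ hz.2)
        (hy.hasDerivAt _ hz.2)).hasFDerivWithinAt) hinj', ← integral_const_mul]
  refine setIntegral_congr_fun (measurableSet_coneDomain a) fun z hz => ?_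
  have hdet : ((Matrix.toLin (.finTwoProd ℝ) (.finTwoProd ℝ)
        !![x z.2 - p, z.1 * x' z.2; y z.2 - q, z.1 * y' z.2]).toContinuousLinearMap).det =
      z.1 * ((x z.2 - p) * y' z.2 - (y z.2 - q) * x' z.2) := by
    simp only [LinearMap.det_toContinuousLinearMap, LinearMap.det_toLin, Matrix.det_fin_two_of]
    ring
  have h1 := hpos z.2 hz.2
  have h2 : |z.1 * ((x z.2 - p) * y' z.2 - (y z.2 - q) * x' z.2)| =
      τ * (z.1 * ((x z.2 - p) * y' z.2 - (y z.2 - q) * x' z.2)) := by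
    rw [← one_mul |_|, ← hτ, ← abs_mul, abs_of_pos]
    have := mul_pos hz.1.1 h1
    linarith
  simp only [hdet, h2, smul_eq_mul, Function.comp]
  ring

-- The Piola identity: Jacobian times divergence equals `∂ₛ [s (T₀ y' - T₁ x')] - ∂ₜ [T₀ (y - q) -
-- T₁ (x - p)]`. Expanded, it involves no second derivative of the arc, so C¹ suffices. Integrating
-- the first term in s gives the flux through the arc, and integrating the second in t gives the
-- fluxes through the two sides.
set_option maxHeartbeats 1000000 in
theorem integral_cone_divergence (ha : 0 < a) (hx : HasBoundedDerivOn a x x')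
    (hy : HasBoundedDerivOn a y y') {T : Plane → Plane} (hT : ContDiff ℝ 1 T) :
    ∫ z in coneDomain a, z.1 * ((x z.2 - p) * y' z.2 - (y z.2 - q) * x' z.2) *
        divergence T (coneMap p q x y z) =
      flux T a x x' y y' - (segmentFlux T p q (x a) (y a) - segmentFlux T p q (x (-a)) (y (-a))) := by
  have hle : -a ≤ a := by linarith
  set Φ := coneMap p q x y with hΦ
  have hK : IsCompact (Icc (0 : ℝ) 1 ×ˢ Icc (-a) a) := isCompact_Icc.prod isCompact_Icc
  have cx : ContinuousOn (fun z : ℝ × ℝ => x z.2) (Icc (0 : ℝ) 1 ×ˢ Icc (-a) a) :=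
    hx.continuousOn.comp continuousOn_snd fun z hz => hz.2
  have cy : ContinuousOn (fun z : ℝ × ℝ => y z.2) (Icc (0 : ℝ) 1 ×ˢ Icc (-a) a) :=
    hy.continuousOn.comp continuousOn_snd fun z hz => hz.2
  have cΦ : ContinuousOn Φ (Icc (0 : ℝ) 1 ×ˢ Icc (-a) a) := by
    exact (continuousOn_const.add (continuousOn_fst.mul (cx.sub continuousOn_const))).plane
      (continuousOn_const.add (continuousOn_fst.mul (cy.sub continuousOn_const)))
  have bc : ∀ f : ℝ × ℝ → ℝ, ContinuousOn f (Icc (0 : ℝ) 1 ×ˢ Icc (-a) a) →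
      ContBddOn (coneDomain a) f := fun f hf => .of_isCompact hK (coneDomain_subset a) hf
  have bX : ContBddOn (coneDomain a) (fun z => x z.2 - p) := bc _ (cx.sub continuousOn_const)
  have bY : ContBddOn (coneDomain a) (fun z => y z.2 - q) := bc _ (cy.sub continuousOn_const)
  have b1 : ContBddOn (coneDomain a) (fun z => z.1) := bc _ continuousOn_fst
  have bx' : ContBddOn (coneDomain a) (fun z => x' z.2) := by
    obtain ⟨M, hM⟩ := hx.bounded_deriv
    exact ⟨hx.continuousOn_deriv.comp continuousOn_snd fun z hz => hz.2, M, fun z hz => hM _ hz.2⟩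
  have by' : ContBddOn (coneDomain a) (fun z => y' z.2) := by
    obtain ⟨M, hM⟩ := hy.bounded_deriv
    exact ⟨hy.continuousOn_deriv.comp continuousOn_snd fun z hz => hz.2, M, fun z hz => hM _ hz.2⟩
  have bT : ∀ i, ContBddOn (coneDomain a) (fun z => T (Φ z) i) := fun i =>
    bc _ (((EuclideanSpace.proj (𝕜 := ℝ) i).continuous.comp hT.continuous).comp_continuousOn cΦ)
  have bP : ∀ i j, ContBddOn (coneDomain a) (fun z => partialDeriv T i j (Φ z)) := fun i j =>
    bc _ ((continuous_partialDeriv hT i j).comp_continuousOn cΦ)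
  -- the two total derivatives
  set Ds : ℝ × ℝ → ℝ := fun z => (T (Φ z) 0 * y' z.2 - T (Φ z) 1 * x' z.2) +
    z.1 * (((x z.2 - p) * partialDeriv T 0 0 (Φ z) + (y z.2 - q) * partialDeriv T 0 1 (Φ z)) * y' z.2
      - ((x z.2 - p) * partialDeriv T 1 0 (Φ z) + (y z.2 - q) * partialDeriv T 1 1 (Φ z)) * x' z.2)
    with hDs
  set Dt : ℝ × ℝ → ℝ := fun z => (T (Φ z) 0 * y' z.2 - T (Φ z) 1 * x' z.2) +
    z.1 * ((x' z.2 * partialDeriv T 0 0 (Φ z) + y' z.2 * partialDeriv T 0 1 (Φ z)) * (y z.2 - q)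
      - (x' z.2 * partialDeriv T 1 0 (Φ z) + y' z.2 * partialDeriv T 1 1 (Φ z)) * (x z.2 - p))
    with hDt
  have bDs : ContBddOn (coneDomain a) Ds :=
    (((bT 0).mul by').sub ((bT 1).mul bx')).add (b1.mul (((((bX.mul (bP 0 0)).add
      (bY.mul (bP 0 1))).mul by')).sub (((bX.mul (bP 1 0)).add (bY.mul (bP 1 1))).mul bx')))
  have bDt : ContBddOn (coneDomain a) Dt :=
    (((bT 0).mul by').sub ((bT 1).mul bx')).add (b1.mul (((((bx'.mul (bP 0 0)).add
      (by'.mul (bP 0 1))).mul bY)).sub (((bx'.mul (bP 1 0)).add (by'.mul (bP 1 1))).mul bX)))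
  have iDs := bDs.integrableOn (measurableSet_coneDomain a) (volume_coneDomain_ne_top a)
  have iDt := bDt.integrableOn (measurableSet_coneDomain a) (volume_coneDomain_ne_top a)
  have hH : ∀ z, z.1 * ((x z.2 - p) * y' z.2 - (y z.2 - q) * x' z.2) * divergence T (Φ z) =
      Ds z - Dt z := by
    intro z
    rw [divergence_eq]
    simp only [hDs, hDt]
    ring
  simp only [hH]
  rw [integral_sub iDs iDt]
  -- Fubini with s innermost: the primitive vanishes at `s = 0`, the vertex, and at `s = 1` it is
  -- the flux density of the arc.
  have eDs : ∫ z in coneDomain a, Ds z = flux T a x x' y y' := by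
    rw [coneDomain, Measure.volume_eq_prod, ← setIntegral_prod_swap, setIntegral_prod]
    · rw [flux, intervalIntegral.integral_of_le hle, integral_Ioc_eq_integral_Ioo]
      refine setIntegral_congr_fun measurableSet_Ioo fun t ht => ?_
      simp only [Prod.swap_prod_mk]
      rw [← integral_Ioc_eq_integral_Ioo, ← intervalIntegral.integral_of_le zero_le_one]
      have hpx : ∀ s, HasDerivAt (fun s => p + s * (x t - p)) (x t - p) s := fun s => by
        simpa using ((hasDerivAt_id s).mul_const (x t - p)).const_add p
      have hpy : ∀ s, HasDerivAt (fun s => q + s * (y t - q)) (y t - q) s := fun s => by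
        simpa using ((hasDerivAt_id s).mul_const (y t - q)).const_add q
      rw [intervalIntegral.integral_eq_sub_of_hasDerivAt
        (f := fun s => s * (T (Φ (s, t)) 0 * y' t - T (Φ (s, t)) 1 * x' t))]
      · simp only [hΦ, coneMap, one_mul, zero_mul, sub_zero, add_sub_cancel]
      · intro s _
        refine ((hasDerivAt_id s).mul (((hasDerivAt_comp_plane hT (hpx s) (hpy s) 0).mul_const
          (y' t)).sub ((hasDerivAt_comp_plane hT (hpx s) (hpy s) 1).mul_const (x' t)))).congr_deriv
          ?_
        simp only [hDs, hΦ, coneMap, id, one_mul]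
        rfl
      · obtain ⟨hc, M, hM⟩ := bDs
        exact intervalIntegrable_of_continuousOn_Ioo (M := M) zero_le_one
          (hc.comp (by fun_prop) fun s hs => ⟨hs, ht⟩) fun s hs => hM (s, t) ⟨hs, ht⟩
    · exact iDs.swap
  -- Fubini with t innermost; the primitive is continuous up to `t = ±a`, where it gives the flux
  -- densities of the sides.
  have eDt : ∫ z in coneDomain a, Dt z =
      segmentFlux T p q (x a) (y a) - segmentFlux T p q (x (-a)) (y (-a)) := by
    have cseg : ∀ X Y : ℝ, IntervalIntegrable (fun s =>
        T !₂[p + s * (X - p), q + s * (Y - q)] 0 * (Y - q) -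
        T !₂[p + s * (X - p), q + s * (Y - q)] 1 * (X - p)) volume 0 1 := by
      intro X Y
      apply Continuous.intervalIntegrable
      have cT : ∀ i, Continuous fun s : ℝ => T !₂[p + s * (X - p), q + s * (Y - q)] i := fun i =>
        ((EuclideanSpace.proj (𝕜 := ℝ) i).continuous.comp hT.continuous).comp
          (Continuous.plane (by fun_prop) (by fun_prop))
      have := cT 0
      have := cT 1
      fun_prop
    rw [coneDomain, Measure.volume_eq_prod, setIntegral_prod _ iDt, segmentFlux, segmentFlux,
      ← intervalIntegral.integral_sub (cseg _ _) (cseg _ _),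
      intervalIntegral.integral_of_le zero_le_one, integral_Ioc_eq_integral_Ioo]
    refine setIntegral_congr_fun measurableSet_Ioo fun s hs => ?_
    simp only
    rw [← integral_Ioc_eq_integral_Ioo, ← intervalIntegral.integral_of_le hle]
    have hs' : s ∈ Icc (0 : ℝ) 1 := Ioo_subset_Icc_self hs
    have hin : MapsTo (fun t => (s, t)) (Icc (-a) a) (Icc (0 : ℝ) 1 ×ˢ Icc (-a) a) :=
      fun t ht => ⟨hs', ht⟩
    have cΦ' : ContinuousOn (fun t => Φ (s, t)) (Icc (-a) a) :=
      cΦ.comp (by fun_prop) hin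
    have cT : ∀ i, ContinuousOn (fun t => T (Φ (s, t)) i) (Icc (-a) a) := fun i =>
      ((EuclideanSpace.proj (𝕜 := ℝ) i).continuous.comp hT.continuous).comp_continuousOn cΦ'
    rw [intervalIntegral.integral_eq_sub_of_hasDerivAt_of_le hle
      (f := fun t => T (Φ (s, t)) 0 * (y t - q) - T (Φ (s, t)) 1 * (x t - p))]
    · simp only [hΦ, coneMap]
    · exact ((cT 0).mul (hy.continuousOn.sub continuousOn_const)).sub
        ((cT 1).mul (hx.continuousOn.sub continuousOn_const))
    · intro t ht
      have hdx := hx.hasDerivAt t ht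
      have hdy := hy.hasDerivAt t ht
      have hpx : HasDerivAt (fun t => p + s * (x t - p)) (s * x' t) t :=
        ((hdx.sub_const p).const_mul s).const_add p
      have hpy : HasDerivAt (fun t => q + s * (y t - q)) (s * y' t) t :=
        ((hdy.sub_const q).const_mul s).const_add q
      refine (((hasDerivAt_comp_plane hT hpx hpy 0).mul (hdy.sub_const q)).sub
        ((hasDerivAt_comp_plane hT hpx hpy 1).mul (hdx.sub_const p))).congr_deriv ?_
      simp only [hDt, hΦ, coneMap]
      ring
    · obtain ⟨hc, M, hM⟩ := bDt
      exact intervalIntegrable_of_continuousOn_Ioo (M := M) hle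
        (hc.comp (by fun_prop) fun t ht => ⟨hs, ht⟩) fun t ht => hM (s, t) ⟨hs, ht⟩
  rw [eDs, eDt]

end Cone

/-! ### Chambers that are star-shaped with respect to a point -/

/-- If the frontier of a set `E` of positive and finite area meets every ray from `c` exactly once,
then `E` contains the inner part of each ray and does not meet the outer part. -/
theorem mem_of_frontier_star {E : Set Plane} {c : Plane} {M : ℝ}
    (hM : frontier E ⊆ Metric.closedBall c M) (hc : c ∉ frontier E)
    (hex : ∀ x, x ≠ c → ∃ s > (0 : ℝ), c + s • (x - c) ∈ frontier E)
    (huniq : ∀ p ∈ frontier E, ∀ s > (0 : ℝ), c + s • (p - c) ∈ frontier E → s = 1)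
    (hnull : volume (frontier E) = 0) (hpos : 0 < volume E) (hfin : volume E < ∞) :
    (∀ p ∈ frontier E, ∀ s ∈ Ioo (0 : ℝ) 1, c + s • (p - c) ∈ E) ∧
      ∀ p ∈ frontier E, ∀ s > (1 : ℝ), c + s • (p - c) ∉ E := by
  -- A connected set missing the frontier lies in the interior of E or in its exterior. It is
  -- applied to radial segments, to outer rays and to a large circle.
  have hconn : ∀ S : Set Plane, IsPreconnected S → S ∩ frontier E = ∅ →
      ∀ x ∈ S, ∀ y ∈ S, x ∈ E → y ∈ E := by
    intro S hS hd x hx y hy hxE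
    by_contra hyE
    have hnot : ∀ z ∈ S, z ∉ frontier E := fun z hz hz' => by
      have : z ∈ S ∩ frontier E := ⟨hz, hz'⟩
      rw [hd] at this
      exact this
    have hint : ∀ z ∈ S, z ∈ closure E → z ∈ interior E := fun z hz hz' => by
      by_contra h
      exact hnot z hz ⟨hz', h⟩
    obtain ⟨z, -, hz1, hz2⟩ := hS (interior E) (closure E)ᶜ isOpen_interior
      isClosed_closure.isOpen_compl (fun z hz => by
        by_cases h : z ∈ closure E
        · exact Or.inl (hint z hz h)
        · exact Or.inr h) ⟨x, hx, hint x hx (subset_closure hxE)⟩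
      ⟨y, hy, fun h => hyE (interior_subset (hint y hy h))⟩
    exact hz2 (interior_subset_closure hz1)
  have hline : ∀ v : Plane, ∀ I : Set ℝ, IsPreconnected I →
      IsPreconnected ((fun s : ℝ => c + s • v) '' I) := fun v I hI =>
    hI.image _ (by fun_prop)
  -- the inner part
  have hin : ∀ p ∈ frontier E, ∀ s ∈ Ioo (0 : ℝ) 1,
      (c + s • (p - c) ∈ E → c ∈ E) ∧ (c ∈ E → c + s • (p - c) ∈ E) := by
    intro p hp s hs
    have hS := hline (p - c) (Icc 0 s) isPreconnected_Icc
    have hd : (fun s : ℝ => c + s • (p - c)) '' Icc 0 s ∩ frontier E = ∅ := by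
      rw [eq_empty_iff_forall_notMem]
      rintro _ ⟨⟨s', hs', rfl⟩, hmem⟩
      rcases hs'.1.eq_or_lt with h | h
      · rw [← h] at hmem
        simp only [zero_smul, add_zero] at hmem
        exact hc hmem
      · have := huniq p hp s' h hmem
        linarith [hs'.2, hs.2]
    have h0 : c ∈ (fun s : ℝ => c + s • (p - c)) '' Icc 0 s :=
      ⟨0, ⟨le_rfl, hs.1.le⟩, by simp⟩
    have h1 : c + s • (p - c) ∈ (fun s : ℝ => c + s • (p - c)) '' Icc 0 s :=
      ⟨s, ⟨hs.1.le, le_rfl⟩, rfl⟩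
    exact ⟨hconn _ hS hd _ h1 _ h0, hconn _ hS hd _ h0 _ h1⟩
  -- the outer part
  have hpc : ∀ p ∈ frontier E, 0 < ‖p - c‖ := by
    intro p hp
    rw [norm_pos_iff, sub_ne_zero]
    rintro rfl
    exact hc hp
  have hray : ∀ p ∈ frontier E, ∀ s > (1 : ℝ), ∀ s' > (1 : ℝ),
      c + s • (p - c) ∈ E → c + s' • (p - c) ∈ E := by
    intro p hp s hs s' hs' hE
    have hS := hline (p - c) (Ioi 1) isPreconnected_Ioi
    refine hconn _ hS ?_ _ ⟨s, hs, rfl⟩ _ ⟨s', hs', rfl⟩ hE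
    rw [eq_empty_iff_forall_notMem]
    rintro _ ⟨⟨s'', hs'', rfl⟩, hmem⟩
    have := huniq p hp s'' (by linarith [mem_Ioi.1 hs'']) hmem
    linarith [mem_Ioi.1 hs'']
  have hout : ∀ p ∈ frontier E, ∀ s > (1 : ℝ), c + s • (p - c) ∉ E := by
    intro p hp s hs hE
    have hM' : ∀ x ∈ frontier E, ‖x - c‖ ≤ M := fun x hx => by
      simpa [dist_eq_norm] using hM hx
    -- If one outer point were in E, so would be its whole outer ray, then a circle beyond the
    -- frontier, then every other outer ray. E would contain the complement of a ball, against its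
    -- finite area.
    have hsub : (Metric.closedBall c M)ᶜ ⊆ E := by
      intro x hx
      have hxM : M < ‖x - c‖ := by simpa [dist_eq_norm] using hx
      have hxc : x ≠ c := by
        rintro rfl
        have := (hpc p hp).le.trans (hM' p hp)
        simp at hxM
        linarith
      obtain ⟨s₁, hs₁, hmem⟩ := hex x hxc
      set p' := c + s₁ • (x - c) with hp'
      have hp's : p' - c = s₁ • (x - c) := by rw [hp']; simp
      have hxp' : x = c + s₁⁻¹ • (p' - c) := by
        rw [hp's, smul_smul, inv_mul_cancel₀ hs₁.ne', one_smul]; simp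
      have hnx : 0 < ‖x - c‖ := by rw [norm_pos_iff, sub_ne_zero]; exact hxc
      have hs₁1 : 1 < s₁⁻¹ := by
        rw [one_lt_inv₀ hs₁]
        have := hM' p' hmem
        rw [hp's, norm_smul, Real.norm_of_nonneg hs₁.le] at this
        by_contra hcon
        nlinarith
      -- move to a large sphere
      set ρ := ‖x - c‖ + ‖p - c‖ + |M| + 1 with hρ
      have hρM : M < ρ := by
        have := le_abs_self M; have := hpc p hp; linarith
      have hsph : ∀ y ∈ Metric.sphere c ρ, y ∉ frontier E := by
        intro y hy hyE
        have := hM' y hyE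
        rw [mem_sphere_iff_norm] at hy
        linarith
      have hrank : 1 < Module.rank ℝ Plane := by
        rw [← Module.finrank_eq_rank]
        simp
      have hSc := isPreconnected_sphere hrank c ρ
      have key : ∀ r ∈ frontier E, ‖r - c‖ < ρ → 1 < ρ / ‖r - c‖ ∧
          c + (ρ / ‖r - c‖) • (r - c) ∈ Metric.sphere c ρ := by
        intro r hr hlt
        have h0 := hpc r hr
        refine ⟨(one_lt_div h0).2 hlt, ?_⟩
        rw [mem_sphere_iff_norm, add_sub_cancel_left, norm_smul, norm_div, norm_norm,
          div_mul_cancel₀ _ h0.ne', Real.norm_of_nonneg]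
        linarith
      have hlt1 : ‖p - c‖ < ρ := by linarith [abs_nonneg M]
      have hlt2 : ‖p' - c‖ < ρ := (hM' p' hmem).trans_lt hρM
      obtain ⟨k1, k2⟩ := key p hp hlt1
      obtain ⟨k3, k4⟩ := key p' hmem hlt2
      have hE1 := hray p hp s hs _ k1 hE
      have hE2 := hconn _ hSc (by
        rw [eq_empty_iff_forall_notMem]
        rintro y ⟨hy, hy'⟩
        exact hsph y hy hy') _ k2 _ k4 hE1
      rw [hxp']
      exact hray p' hmem _ k3 _ hs₁1 hE2
    have h1 : volume (univ : Set Plane) ≤ volume (Metric.closedBall c M) + volume E := by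
      rw [← union_compl_self (Metric.closedBall c M)]
      exact (measure_union_le _ _).trans (by gcongr)
    have h2 : volume (Metric.closedBall c M) < ∞ := measure_closedBall_lt_top
    have h3 : volume (univ : Set Plane) = ∞ := measure_univ_of_isAddLeftInvariant _
    rw [h3] at h1
    exact absurd (ENNReal.add_lt_top.2 ⟨h2, hfin⟩) (not_lt.2 h1)
  refine ⟨fun p hp s hs => (hin p hp s hs).2 ?_, hout⟩
  -- Were c outside E, all inner segments would be outside too, and E would lie in its negligible
  -- frontier.
  by_contra hcE
  have hsub : E ⊆ frontier E := by
    intro x hx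
    have hxc : x ≠ c := by rintro rfl; exact hcE hx
    obtain ⟨s, hs, hmem⟩ := hex x hxc
    have hxp : x = c + s⁻¹ • ((c + s • (x - c)) - c) := by
      rw [add_sub_cancel_left, smul_smul, inv_mul_cancel₀ hs.ne', one_smul]; simp
    rcases lt_trichotomy s⁻¹ 1 with h | h | h
    · rw [hxp] at hx
      exact absurd ((hin _ hmem _ ⟨inv_pos.2 hs, h⟩).1 hx) hcE
    · have : s = 1 := by rw [← inv_inv s, h, inv_one]
      rw [this] at hmem
      simpa using hmem
    · rw [hxp] at hx
      exact absurd hx (hout _ hmem _ h)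
  exact absurd (measure_mono_null hsub hnull) hpos.ne'

/-- The curve is the image of a null segment of the plane under a differentiable map of the plane to
itself, and such maps preserve null sets. -/
theorem volume_curve_eq_zero {x y x' y' : ℝ → ℝ} {a b : ℝ}
    (hx : ∀ t ∈ Ioo a b, HasDerivAt x (x' t) t) (hy : ∀ t ∈ Ioo a b, HasDerivAt y (y' t) t) :
    volume ((fun t => (!₂[x t, y t] : Plane)) '' Ioo a b) = 0 := by
  set F : ℝ × ℝ → ℝ × ℝ := fun z => (x z.2, y z.2) with hF
  have himg : (fun t => (!₂[x t, y t] : Plane)) '' Ioo a b =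
      prodToPlane '' (F '' ({0} ×ˢ Ioo a b)) := by
    ext w
    simp only [mem_image, mem_prod, mem_singleton_iff, prodToPlane, hF]
    constructor
    · rintro ⟨t, ht, rfl⟩
      exact ⟨_, ⟨(0, t), ⟨rfl, ht⟩, rfl⟩, rfl⟩
    · rintro ⟨_, ⟨z, hz, rfl⟩, rfl⟩
      exact ⟨z.2, hz.2, rfl⟩
  have h0 : volume (({0} : Set ℝ) ×ˢ Ioo a b) = 0 := by
    rw [Measure.volume_eq_prod, Measure.prod_prod]; simp
  have hd : DifferentiableOn ℝ F ({0} ×ˢ Ioo a b) := by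
    intro z hz
    have h1 : DifferentiableAt ℝ (fun z : ℝ × ℝ => x z.2) z :=
      (hx _ hz.2).differentiableAt.comp z differentiableAt_snd
    have h2 : DifferentiableAt ℝ (fun z : ℝ × ℝ => y z.2) z :=
      (hy _ hz.2).differentiableAt.comp z differentiableAt_snd
    exact (h1.prodMk h2).differentiableWithinAt
  have h1 := addHaar_image_eq_zero_of_differentiableOn_of_addHaar_eq_zero volume hd h0
  rw [himg, ← measurePreserving_prodToPlane.map_eq, measurableEmbedding_prodToPlane.map_apply,
    preimage_image_eq _ measurableEmbedding_prodToPlane.injective]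
  exact h1

section Cone

variable {a p q : ℝ} {x x' y y' : ℝ → ℝ}

theorem measurableSet_cone (hx : HasBoundedDerivOn a x x') (hy : HasBoundedDerivOn a y y')
    (hinj : InjOn (coneMap p q x y) (coneDomain a)) :
    MeasurableSet (coneMap p q x y '' coneDomain a) := by
  set Ψ : ℝ × ℝ → ℝ × ℝ := fun z => (p + z.1 * (x z.2 - p), q + z.1 * (y z.2 - q)) with hΨ
  have hcomp : coneMap p q x y = prodToPlane ∘ Ψ := rfl
  have hinj' : InjOn Ψ (coneDomain a) := by
    rw [hcomp] at hinj; exact hinj.of_comp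
  rw [hcomp, image_comp]
  apply measurableEmbedding_prodToPlane.measurableSet_image.2
  exact measurable_image_of_fderivWithin (measurableSet_coneDomain a)
    (fun z hz => (hasFDerivAt_conePair (hx.hasDerivAt _ hz.2)
        (hy.hasDerivAt _ hz.2)).hasFDerivWithinAt) hinj'

theorem continuousOn_coneMap (hx : ContinuousOn x (Icc (-a) a)) (hy : ContinuousOn y (Icc (-a) a)) :
    ContinuousOn (coneMap p q x y) (Icc (0 : ℝ) 1 ×ˢ Icc (-a) a) := by
  have cx : ContinuousOn (fun z : ℝ × ℝ => x z.2) (Icc (0 : ℝ) 1 ×ˢ Icc (-a) a) :=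
    hx.comp continuousOn_snd fun z hz => hz.2
  have cy : ContinuousOn (fun z : ℝ × ℝ => y z.2) (Icc (0 : ℝ) 1 ×ˢ Icc (-a) a) :=
    hy.comp continuousOn_snd fun z hz => hz.2
  exact (continuousOn_const.add (continuousOn_fst.mul (cx.sub continuousOn_const))).plane
      (continuousOn_const.add (continuousOn_fst.mul (cy.sub continuousOn_const)))

theorem integrableOn_cone (hx : ContinuousOn x (Icc (-a) a)) (hy : ContinuousOn y (Icc (-a) a))
    {g : Plane → ℝ} (hg : Continuous g) : IntegrableOn g (coneMap p q x y '' coneDomain a) := by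
  have hK : IsCompact (coneMap p q x y '' (Icc (0 : ℝ) 1 ×ˢ Icc (-a) a)) :=
    (isCompact_Icc.prod isCompact_Icc).image_of_continuousOn (continuousOn_coneMap hx hy)
  exact (hg.continuousOn.integrableOn_compact hK).mono_set (image_mono (coneDomain_subset a))

end Cone

/-! ### Polar coordinates and Gauss–Green in a single chamber -/

theorem polar_unique {r₁ r₂ t₁ t₂ : ℝ} (h₁ : 0 < r₁) (h₂ : 0 < r₂)
    (ht₁ : t₁ ∈ Ioc (-Real.pi) Real.pi) (ht₂ : t₂ ∈ Ioc (-Real.pi) Real.pi)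
    (hc : r₁ * Real.cos t₁ = r₂ * Real.cos t₂) (hs : r₁ * Real.sin t₁ = r₂ * Real.sin t₂) :
    t₁ = t₂ ∧ r₁ = r₂ := by
  have e1 := Complex.arg_mul_cos_add_sin_mul_I h₁ ht₁
  have e2 := Complex.arg_mul_cos_add_sin_mul_I h₂ ht₂
  have e : (r₁ : ℂ) * (Complex.cos t₁ + Complex.sin t₁ * Complex.I) =
      r₂ * (Complex.cos t₂ + Complex.sin t₂ * Complex.I) := by
    have hc' : (r₁ : ℂ) * Complex.cos t₁ = r₂ * Complex.cos t₂ := by exact_mod_cast hc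
    have hs' : (r₁ : ℂ) * Complex.sin t₁ = r₂ * Complex.sin t₂ := by exact_mod_cast hs
    linear_combination hc' + Complex.I * hs'
  rw [e, e2] at e1
  refine ⟨e1.symm, ?_⟩
  have h3 : r₁ ^ 2 = r₂ ^ 2 := by
    have a1 := Real.sin_sq_add_cos_sq t₁
    have a2 := Real.sin_sq_add_cos_sq t₂
    calc r₁ ^ 2 = (r₁ * Real.sin t₁) ^ 2 + (r₁ * Real.cos t₁) ^ 2 := by
          linear_combination -r₁ ^ 2 * a1
      _ = (r₂ * Real.sin t₂) ^ 2 + (r₂ * Real.cos t₂) ^ 2 := by rw [hc, hs]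
      _ = r₂ ^ 2 := by linear_combination r₂ ^ 2 * a2
  exact (pow_left_inj₀ h₁.le h₂.le (by norm_num)).1 h3

theorem exists_polar {x y : ℝ} (h : x ≠ 0 ∨ y ≠ 0) :
    ∃ r > 0, ∃ t ∈ Ioc (-Real.pi) Real.pi, x = r * Real.cos t ∧ y = r * Real.sin t := by
  have hz : (x + y * Complex.I : ℂ) ≠ 0 := by
    intro h0
    have h1 := congrArg Complex.re h0
    have h2 := congrArg Complex.im h0
    simp at h1 h2
    rcases h with h | h
    · exact h h1
    · exact h h2
  refine ⟨‖(x + y * Complex.I : ℂ)‖, norm_pos_iff.2 hz, Complex.arg (x + y * Complex.I),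
    Complex.arg_mem_Ioc _, ?_, ?_⟩
  · rw [Complex.norm_mul_cos_arg]; simp
  · rw [Complex.norm_mul_sin_arg]; simp

/-- A continuous strictly monotone determination of the angle along an arc that avoids the
negative half-axis and turns counterclockwise. -/
theorem exists_angle {b ψ : ℝ} {X X' Y Y' : ℝ → ℝ} (hb : 0 < b) (hψ : ψ ∈ Ioo 0 Real.pi)
    (hX : HasBoundedDerivOn b X X') (hY : HasBoundedDerivOn b Y Y')
    (hslit : ∀ t ∈ Icc (-b) b, Y t = 0 → 0 < X t)
    (hrot : ∀ t ∈ Ioo (-b) b, 0 < X t * Y' t - Y t * X' t) {r₁ r₂ : ℝ} (h₁ : 0 < r₁) (h₂ : 0 < r₂)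
    (hXl : X (-b) = r₁ * Real.cos ψ) (hYl : Y (-b) = -(r₁ * Real.sin ψ))
    (hXr : X b = r₂ * Real.cos ψ) (hYr : Y b = r₂ * Real.sin ψ) :
    ∃ α : ℝ → ℝ, StrictMonoOn α (Icc (-b) b) ∧ α '' Icc (-b) b = Icc (-ψ) ψ ∧
      ∀ t ∈ Icc (-b) b, ∃ r > 0, X t = r * Real.cos (α t) ∧ Y t = r * Real.sin (α t) := by
  have hle : -b ≤ b := by linarith
  set ζ : ℝ → ℂ := fun t => X t + Y t * Complex.I with hζ
  have hre : ∀ t, (ζ t).re = X t := fun t => by simp [hζ]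
  have him : ∀ t, (ζ t).im = Y t := fun t => by simp [hζ]
  have hsl : ∀ t ∈ Icc (-b) b, ζ t ∈ Complex.slitPlane := by
    intro t ht
    rw [Complex.mem_slitPlane_iff, hre, him]
    by_cases h : Y t = 0
    · exact Or.inl (hslit t ht h)
    · exact Or.inr h
  have hζc : ContinuousOn ζ (Icc (-b) b) := by
    have c1 : ContinuousOn (fun t => (X t : ℂ)) (Icc (-b) b) :=
      Complex.continuous_ofReal.comp_continuousOn hX.continuousOn
    have c2 : ContinuousOn (fun t => (Y t : ℂ)) (Icc (-b) b) :=
      Complex.continuous_ofReal.comp_continuousOn hY.continuousOn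
    exact c1.add (c2.mul continuousOn_const)
  set α : ℝ → ℝ := fun t => Complex.arg (ζ t) with hα
  have hαc : ContinuousOn α (Icc (-b) b) := fun t ht =>
    (Complex.continuousAt_arg (hsl t ht)).comp_continuousWithinAt (hζc t ht)
  have hmono : StrictMonoOn α (Icc (-b) b) := by
    apply strictMonoOn_of_deriv_pos (convex_Icc _ _) hαc
    intro t ht
    rw [interior_Icc] at ht
    have hζd : HasDerivAt ζ (X' t + Y' t * Complex.I) t :=
      ((hX.hasDerivAt t ht).ofReal_comp).add ((hY.hasDerivAt t ht).ofReal_comp.mul_const _)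
    have hs := hsl t (Ioo_subset_Icc_self ht)
    -- The angle is the imaginary part of the logarithm, so its derivative is `(X Y' - Y X') /
    -- |ζ|²`, positive by `hrot`.
    have hl := hζd.clog_real hs
    have hi := Complex.imCLM.hasFDerivAt.comp_hasDerivAt t hl
    have hd : HasDerivAt α (Complex.imCLM ((X' t + Y' t * Complex.I) / ζ t)) t := by
      refine hi.congr_of_eventuallyEq (Filter.Eventually.of_forall fun s => ?_)
      simp [hα, Complex.log_im]
    rw [hd.deriv]
    have hn : 0 < Complex.normSq (ζ t) := Complex.normSq_pos.2 (Complex.slitPlane_ne_zero hs)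
    rw [Complex.imCLM_apply, Complex.div_im, hre, him]
    simp only [Complex.add_im, Complex.ofReal_im, Complex.mul_im, Complex.ofReal_re, Complex.I_im,
      Complex.I_re, Complex.add_re, Complex.mul_re, mul_one, mul_zero, zero_add, add_zero, sub_zero]
    rw [← sub_div]
    apply div_pos _ hn
    have := hrot t ht
    linarith
  have hend : α b = ψ := by
    simp only [hα, hζ, hXr, hYr]
    refine Eq.trans ?_ (Complex.arg_mul_cos_add_sin_mul_I h₂ (θ := ψ)
      ⟨by linarith [hψ.1, Real.pi_pos], hψ.2.le⟩)
    congr 1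
    push_cast
    ring
  have hstart : α (-b) = -ψ := by
    simp only [hα, hζ, hXl, hYl]
    refine Eq.trans ?_ (Complex.arg_mul_cos_add_sin_mul_I h₁ (θ := -ψ)
      ⟨by linarith [hψ.2], by linarith [hψ.1, Real.pi_pos]⟩)
    congr 1
    push_cast
    rw [Complex.cos_neg, Complex.sin_neg]
    ring
  refine ⟨α, hmono, ?_, ?_⟩
  · rw [← hstart, ← hend]
    apply Subset.antisymm
    · rintro _ ⟨t, ht, rfl⟩
      exact ⟨hmono.monotoneOn (left_mem_Icc.2 hle) ht ht.1,
        hmono.monotoneOn ht (right_mem_Icc.2 hle) ht.2⟩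
    · exact intermediate_value_Icc hle hαc
  · intro t ht
    refine ⟨‖ζ t‖, norm_pos_iff.2 (Complex.slitPlane_ne_zero (hsl t ht)), ?_, ?_⟩
    · rw [hα, Complex.norm_mul_cos_arg, hre]
    · rw [hα, Complex.norm_mul_sin_arg, him]

theorem HasBoundedDerivOn.const_add {a : ℝ} {f f' : ℝ → ℝ} (hf : HasBoundedDerivOn a f f')
    (c : ℝ) : HasBoundedDerivOn a (fun t => c + f t) f' :=
  ⟨continuousOn_const.add hf.continuousOn, fun t ht => (hf.hasDerivAt t ht).const_add c,
    hf.continuousOn_deriv, hf.bounded_deriv⟩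

theorem HasBoundedDerivOn.const_mul {a : ℝ} {f f' : ℝ → ℝ} (hf : HasBoundedDerivOn a f f')
    (c : ℝ) : HasBoundedDerivOn a (fun t => c * f t) (fun t => c * f' t) := by
  refine ⟨continuousOn_const.mul hf.continuousOn, fun t ht => (hf.hasDerivAt t ht).const_mul c,
    continuousOn_const.mul hf.continuousOn_deriv, ?_⟩
  obtain ⟨M, hM⟩ := hf.bounded_deriv
  refine ⟨|c| * M, fun t ht => ?_⟩
  rw [abs_mul]
  exact mul_le_mul_of_nonneg_left (hM t ht) (abs_nonneg _)

theorem HasBoundedDerivOn.mul {a : ℝ} {f f' g g' : ℝ → ℝ} (hf : HasBoundedDerivOn a f f')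
    (hg : HasBoundedDerivOn a g g') :
    HasBoundedDerivOn a (fun t => f t * g t) (fun t => f' t * g t + f t * g' t) := by
  have hsub : Ioo (-a) a ⊆ Icc (-a) a := Ioo_subset_Icc_self
  refine ⟨hf.continuousOn.mul hg.continuousOn, fun t ht => (hf.hasDerivAt t ht).mul
    (hg.hasDerivAt t ht), (hf.continuousOn_deriv.mul (hg.continuousOn.mono hsub)).add
    ((hf.continuousOn.mono hsub).mul hg.continuousOn_deriv), ?_⟩
  obtain ⟨M, hM⟩ := hf.bounded_deriv
  obtain ⟨N, hN⟩ := hg.bounded_deriv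
  obtain ⟨K, hK⟩ := isCompact_Icc.exists_bound_of_continuousOn hf.continuousOn
  obtain ⟨L, hL⟩ := isCompact_Icc.exists_bound_of_continuousOn hg.continuousOn
  refine ⟨M * L + K * N, fun t ht => (abs_add_le _ _).trans (add_le_add ?_ ?_)⟩
  · rw [abs_mul]
    exact mul_le_mul (hM t ht) (hL t (hsub ht)) (abs_nonneg _) ((abs_nonneg _).trans (hM t ht))
  · rw [abs_mul]
    exact mul_le_mul (hK t (hsub ht)) (hN t ht) (abs_nonneg _)
      ((norm_nonneg _).trans (hK t (hsub ht)))

theorem hasBoundedDerivOn_cos (a : ℝ) :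
    HasBoundedDerivOn a Real.cos (fun t => -Real.sin t) :=
  ⟨Real.continuous_cos.continuousOn, fun t _ => Real.hasDerivAt_cos t, by fun_prop, 1,
    fun t _ => by rw [abs_neg]; exact Real.abs_sin_le_one t⟩

theorem hasBoundedDerivOn_sin (a : ℝ) : HasBoundedDerivOn a Real.sin Real.cos :=
  ⟨Real.continuous_sin.continuousOn, fun t _ => Real.hasDerivAt_sin t, by fun_prop, 1,
    fun t _ => Real.abs_cos_le_one t⟩

theorem hasBoundedDerivOn_id (a : ℝ) : HasBoundedDerivOn a (fun t => t) (fun _ => 1) :=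
  ⟨continuousOn_id, fun t _ => hasDerivAt_id t, continuousOn_const, 1, fun t _ => by simp⟩

/-- **Gauss–Green formula** for a chamber bounded by a polar graph over the angles `(-θ, θ)` and by
an inner arc that joins its end points and is seen from the pole under the remaining angles. The
polar axis points to the right for `η = 1` and to the left for `η = -1`. -/
theorem setIntegral_divergence_of_frontier {E : Set Plane} {η p θ b : ℝ}
    {R R' X X' Y Y' : ℝ → ℝ} (hη : η * η = 1)
    (hθ : θ ∈ Ioo 0 Real.pi) (hb : 0 < b) (hR : HasBoundedDerivOn θ R R')
    (hRpos : ∀ t ∈ Icc (-θ) θ, 0 < R t) (hX : HasBoundedDerivOn b X X')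
    (hY : HasBoundedDerivOn b Y Y') (hslit : ∀ t ∈ Icc (-b) b, Y t = 0 → 0 < X t)
    (hrot : ∀ t ∈ Ioo (-b) b, 0 < X t * Y' t - Y t * X' t)
    (hXl : X (-b) = -(R (-θ) * Real.cos θ)) (hYl : Y (-b) = -(R (-θ) * Real.sin θ))
    (hXr : X b = -(R θ * Real.cos θ)) (hYr : Y b = R θ * Real.sin θ)
    (hfr : frontier E = (fun t => (!₂[p + η * (R t * Real.cos t), R t * Real.sin t] : Plane)) ''
      Ioo (-θ) θ ∪ (fun t => (!₂[p + -η * X t, Y t] : Plane)) '' Icc (-b) b)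
    (hpos : 0 < volume E) (hfin : volume E < ∞) {T : Plane → Plane} (hT : ContDiff ℝ 1 T) :
    ∫ x in E, divergence T x =
      η * (flux T θ (fun t => p + η * (R t * Real.cos t))
          (fun t => η * (R' t * Real.cos t + R t * -Real.sin t))
          (fun t => R t * Real.sin t) (fun t => R' t * Real.sin t + R t * Real.cos t) -
        flux T b (fun t => p + -η * X t) (fun t => -η * X' t) Y Y') := by
  obtain ⟨hθ0, hθπ⟩ := hθ
  have hη0 : η ≠ 0 := by rintro rfl; simp at hη
  have hηabs : |η| = 1 := by
    have : |η| * |η| = 1 := by rw [← abs_mul, hη, abs_one]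
    nlinarith [abs_nonneg η]
  have hbb : -b ≤ b := by linarith
  -- The common interface is described about the reversed polar axis, where the angles not covered
  -- by the exterior arc become `[-ψ, ψ]` and the branch cut is avoided.
  set ψ := Real.pi - θ with hψ
  have hcψ : Real.cos ψ = -Real.cos θ := Real.cos_pi_sub θ
  have hsψ : Real.sin ψ = Real.sin θ := Real.sin_pi_sub θ
  obtain ⟨α, hαm, hαim, hαp⟩ := exists_angle (ψ := ψ) hb ⟨by linarith, by linarith⟩ hX hY hslit
    hrot (hRpos (-θ) ⟨le_rfl, by linarith⟩) (hRpos θ ⟨by linarith, le_rfl⟩)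
    (by rw [hXl, hcψ]; ring) (by rw [hYl, hsψ]) (by rw [hXr, hcψ]; ring) (by rw [hYr, hsψ])
  have hαmem : ∀ t ∈ Icc (-b) b, α t ∈ Icc (-ψ) ψ := fun t ht => hαim ▸ mem_image_of_mem α ht
  choose! r hr0 hrX hrY using hαp
  -- Coordinates centred at the pole with the first axis along the polar axis, so that both
  -- orientations η are treated at once. `F` below is the frontier in these coordinates.
  set mk : ℝ → ℝ → Plane := fun u v => !₂[p + η * u, v] with hmk
  have mk_inj : ∀ {u v u' v' : ℝ}, mk u v = mk u' v' → u = u' ∧ v = v' := by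
    intro u v u' v' h
    have h0 := congrArg (fun w : Plane => w 0) h
    have h1 := congrArg (fun w : Plane => w 1) h
    simp [hmk, hη0] at h0 h1
    exact ⟨h0, h1⟩
  have mk_surj : ∀ w : Plane, ∃ u v, w = mk u v := by
    intro w
    refine ⟨η * (w 0 - p), w 1, ?_⟩
    ext i; fin_cases i
    · simp only [hmk, ← mul_assoc, hη]; simp
    · simp [hmk]
  set c : Plane := mk 0 0 with hc
  have mk_line : ∀ s u v, c + s • (mk u v - c) = mk (s * u) (s * v) := by
    intro s u v
    ext i; fin_cases i
    · simp [hc, hmk]; ring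
    · simp [hc, hmk]
  set F : ℝ → ℝ → Prop := fun u v => (∃ t ∈ Ioo (-θ) θ, R t * Real.cos t = u ∧
    R t * Real.sin t = v) ∨ ∃ t ∈ Icc (-b) b, -X t = u ∧ Y t = v with hF
  have hfrF : ∀ u v, mk u v ∈ frontier E ↔ F u v := by
    intro u v
    rw [hfr]
    constructor
    · rintro (⟨t, ht, h⟩ | ⟨t, ht, h⟩)
      · exact Or.inl ⟨t, ht, mk_inj h⟩
      · have h' : mk (-X t) (Y t) = mk u v := by
          rw [← h]; simp [hmk]
        exact Or.inr ⟨t, ht, mk_inj h'⟩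
    · rintro (⟨t, ht, rfl, rfl⟩ | ⟨t, ht, rfl, rfl⟩)
      · exact Or.inl ⟨t, ht, rfl⟩
      · exact Or.inr ⟨t, ht, by simp [hmk]⟩
  -- uniqueness along rays
  have uo : ∀ {s₁ s₂ t₁ t₂ : ℝ}, 0 < s₁ → 0 < s₂ → t₁ ∈ Ioo (-θ) θ → t₂ ∈ Ioo (-θ) θ →
      s₁ * (R t₁ * Real.cos t₁) = s₂ * (R t₂ * Real.cos t₂) →
      s₁ * (R t₁ * Real.sin t₁) = s₂ * (R t₂ * Real.sin t₂) → t₁ = t₂ ∧ s₁ = s₂ := by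
    intro s₁ s₂ t₁ t₂ hs₁ hs₂ ht₁ ht₂ h1 h2
    have hr1 := hRpos t₁ (Ioo_subset_Icc_self ht₁)
    have hr2 := hRpos t₂ (Ioo_subset_Icc_self ht₂)
    obtain ⟨e1, e2⟩ := polar_unique (r₁ := s₁ * R t₁) (r₂ := s₂ * R t₂) (t₁ := t₁) (t₂ := t₂)
      (by positivity) (by positivity) ⟨by linarith [ht₁.1], by linarith [ht₁.2]⟩
      ⟨by linarith [ht₂.1], by linarith [ht₂.2]⟩ (by linarith) (by linarith)
    refine ⟨e1, ?_⟩
    rw [e1] at e2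
    exact mul_right_cancel₀ hr2.ne' e2
  have ui : ∀ {s₁ s₂ t₁ t₂ : ℝ}, 0 < s₁ → 0 < s₂ → t₁ ∈ Icc (-b) b → t₂ ∈ Icc (-b) b →
      s₁ * X t₁ = s₂ * X t₂ → s₁ * Y t₁ = s₂ * Y t₂ → t₁ = t₂ ∧ s₁ = s₂ := by
    intro s₁ s₂ t₁ t₂ hs₁ hs₂ ht₁ ht₂ h1 h2
    have hr1 := hr0 t₁ ht₁
    have hr2 := hr0 t₂ ht₂
    have m1 := hαmem t₁ ht₁
    have m2 := hαmem t₂ ht₂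
    obtain ⟨e1, e2⟩ := polar_unique (r₁ := s₁ * r t₁) (r₂ := s₂ * r t₂) (t₁ := α t₁) (t₂ := α t₂)
      (by positivity) (by positivity) ⟨by linarith [m1.1], by linarith [m1.2]⟩
      ⟨by linarith [m2.1], by linarith [m2.2]⟩
      (by rw [mul_assoc, mul_assoc, ← hrX t₁ ht₁, ← hrX t₂ ht₂, h1])
      (by rw [mul_assoc, mul_assoc, ← hrY t₁ ht₁, ← hrY t₂ ht₂, h2])
    have e3 := hαm.injOn ht₁ ht₂ e1
    refine ⟨e3, ?_⟩
    rw [e3] at e2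
    exact mul_right_cancel₀ hr2.ne' e2
  -- An exterior ray has angle strictly inside (-θ, θ), whereas an inner one, turned back to the
  -- original axis, has angle of modulus at least θ. The end points belong to the inner arc only,
  -- hence the open and closed intervals.
  have uoi : ∀ {s₁ s₂ t₁ t₂ : ℝ}, 0 < s₁ → 0 < s₂ → t₁ ∈ Ioo (-θ) θ → t₂ ∈ Icc (-b) b →
      s₁ * (R t₁ * Real.cos t₁) = s₂ * -X t₂ →
      s₁ * (R t₁ * Real.sin t₁) = s₂ * Y t₂ → False := by
    intro s₁ s₂ t₁ t₂ hs₁ hs₂ ht₁ ht₂ h1 h2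
    have hr1 := hRpos t₁ (Ioo_subset_Icc_self ht₁)
    have hr2 := hr0 t₂ ht₂
    have m2 := hαmem t₂ ht₂
    rcases le_or_gt 0 (α t₂) with h | h
    · have := (polar_unique (r₁ := s₁ * R t₁) (r₂ := s₂ * r t₂) (t₁ := t₁) (t₂ := Real.pi - α t₂)
        (by positivity) (by positivity) ⟨by linarith [ht₁.1], by linarith [ht₁.2]⟩
        ⟨by linarith [m2.2], by linarith⟩
        (by rw [Real.cos_pi_sub]; linear_combination h1 + (-s₂) * hrX t₂ ht₂)
        (by rw [Real.sin_pi_sub]; linear_combination h2 + s₂ * hrY t₂ ht₂)).1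
      linarith [ht₁.2, m2.2]
    · have := (polar_unique (r₁ := s₁ * R t₁) (r₂ := s₂ * r t₂) (t₁ := t₁)
        (t₂ := -(Real.pi + α t₂))
        (by positivity) (by positivity) ⟨by linarith [ht₁.1], by linarith [ht₁.2]⟩
        ⟨by linarith, by linarith [m2.1]⟩
        (by rw [Real.cos_neg, add_comm, Real.cos_add_pi]
            linear_combination h1 + (-s₂) * hrX t₂ ht₂)
        (by rw [Real.sin_neg, add_comm, Real.sin_add_pi]
            linear_combination h2 + s₂ * hrY t₂ ht₂)).1
      linarith [ht₁.1, m2.1]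
  -- existence along rays
  have hex : ∀ u v, (u ≠ 0 ∨ v ≠ 0) → ∃ s > (0 : ℝ), F (s * u) (s * v) := by
    intro u v huv
    obtain ⟨ρ, hρ, φ, hφ, rfl, rfl⟩ := exists_polar huv
    by_cases hlt : φ ∈ Ioo (-θ) θ
    · have hRφ := hRpos φ (Ioo_subset_Icc_self hlt)
      refine ⟨R φ / ρ, by positivity, Or.inl ⟨φ, hlt, ?_, ?_⟩⟩ <;> field_simp
    · have hcase : ∃ β ∈ Icc (-ψ) ψ, Real.cos β = -Real.cos φ ∧ Real.sin β = Real.sin φ := by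
        rcases le_or_gt θ φ with h | h
        · exact ⟨Real.pi - φ, ⟨by linarith [hφ.2], by linarith⟩, Real.cos_pi_sub φ,
            Real.sin_pi_sub φ⟩
        · have h' : φ ≤ -θ := by
            by_contra hcon
            exact hlt ⟨not_le.1 hcon, h⟩
          refine ⟨-(φ + Real.pi), ⟨by linarith, by linarith [hφ.1]⟩, ?_, ?_⟩
          · rw [Real.cos_neg, Real.cos_add_pi]
          · rw [Real.sin_neg, Real.sin_add_pi, neg_neg]
      obtain ⟨β, hβ, hβc, hβs⟩ := hcase
      rw [← hαim] at hβ
      obtain ⟨t, ht, rfl⟩ := hβ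
      have hrt := hr0 t ht
      refine ⟨r t / ρ, by positivity, Or.inr ⟨t, ht, ?_, ?_⟩⟩
      · rw [hrX t ht, hβc]; field_simp
      · rw [hrY t ht, hβs]; field_simp
  have hF0 : ¬ F 0 0 := by
    rintro (⟨t, ht, h1, h2⟩ | ⟨t, ht, h1, h2⟩)
    · have hRt := hRpos t (Ioo_subset_Icc_self ht)
      have := Real.sin_sq_add_cos_sq t
      rcases mul_eq_zero.1 h1 with h | h
      · exact hRt.ne' h
      · rcases mul_eq_zero.1 h2 with h' | h'
        · exact hRt.ne' h'
        · rw [h, h'] at this; norm_num at this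
    · have := hslit t ht h2
      linarith
  have huniq : ∀ u v s, 0 < s → F u v → F (s * u) (s * v) → s = 1 := by
    rintro u v s hs (⟨t, ht, rfl, rfl⟩ | ⟨t, ht, rfl, rfl⟩) (⟨t', ht', h1, h2⟩ | ⟨t', ht', h1, h2⟩)
    · exact (uo hs one_pos ht ht' (by linarith) (by linarith)).2
    · exact (uoi hs one_pos ht ht' (by linarith) (by linarith)).elim
    · exact (uoi one_pos hs ht' ht (by linarith) (by linarith)).elim
    · exact (ui hs one_pos ht ht' (by linarith) (by linarith)).2
  -- the curves
  set xo : ℝ → ℝ := fun t => p + η * (R t * Real.cos t) with hxo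
  set yo : ℝ → ℝ := fun t => R t * Real.sin t with hyo
  set xi : ℝ → ℝ := fun t => p + -η * X t with hxi
  have dxo : HasBoundedDerivOn θ xo (fun t => η * (R' t * Real.cos t + R t * -Real.sin t)) :=
    ((hR.mul (hasBoundedDerivOn_cos θ)).const_mul η).const_add p
  have dyo : HasBoundedDerivOn θ yo (fun t => R' t * Real.sin t + R t * Real.cos t) :=
    hR.mul (hasBoundedDerivOn_sin θ)
  have dxi : HasBoundedDerivOn b xi (fun t => -η * X' t) := (hX.const_mul (-η)).const_add p
  have hcone_o : ∀ z, coneMap p 0 xo yo z =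
      mk (z.1 * (R z.2 * Real.cos z.2)) (z.1 * (R z.2 * Real.sin z.2)) := by
    intro z
    ext i; fin_cases i
    · simp [coneMap, hmk, hxo]; ring
    · simp [coneMap, hmk, hyo]
  have hcone_i : ∀ z, coneMap p 0 xi Y z = mk (z.1 * -X z.2) (z.1 * Y z.2) := by
    intro z
    ext i; fin_cases i
    · simp [coneMap, hmk, hxi]; ring
    · simp [coneMap, hmk]
  have inj_o : InjOn (coneMap p 0 xo yo) (coneDomain θ) := by
    rintro ⟨s₁, t₁⟩ ⟨hs₁, ht₁⟩ ⟨s₂, t₂⟩ ⟨hs₂, ht₂⟩ h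
    rw [hcone_o, hcone_o] at h
    obtain ⟨h1, h2⟩ := mk_inj h
    obtain ⟨e1, e2⟩ := uo hs₁.1 hs₂.1 ht₁ ht₂ h1 h2
    exact Prod.ext e2 e1
  have inj_i : InjOn (coneMap p 0 xi Y) (coneDomain b) := by
    rintro ⟨s₁, t₁⟩ ⟨hs₁, ht₁⟩ ⟨s₂, t₂⟩ ⟨hs₂, ht₂⟩ h
    rw [hcone_i, hcone_i] at h
    obtain ⟨h1, h2⟩ := mk_inj h
    simp only at h1 h2
    obtain ⟨e1, e2⟩ := ui hs₁.1 hs₂.1 (Ioo_subset_Icc_self ht₁) (Ioo_subset_Icc_self ht₂)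
      (by linarith) h2
    exact Prod.ext e2 e1
  set Co := coneMap p 0 xo yo '' coneDomain θ with hCo
  set Ci := coneMap p 0 xi Y '' coneDomain b with hCi
  have hdisj : Disjoint Co Ci := by
    rw [disjoint_left]
    rintro _ ⟨⟨s₁, t₁⟩, ⟨hs₁, ht₁⟩, rfl⟩ ⟨⟨s₂, t₂⟩, ⟨hs₂, ht₂⟩, h⟩
    rw [hcone_o, hcone_i] at h
    obtain ⟨h1, h2⟩ := mk_inj h
    exact uoi hs₁.1 hs₂.1 ht₁ (Ioo_subset_Icc_self ht₂) h1.symm h2.symm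
  -- the frontier is bounded and negligible
  have hnull : volume (frontier E) = 0 := by
    rw [hfr]
    refine measure_union_null (volume_curve_eq_zero dxo.hasDerivAt dyo.hasDerivAt) ?_
    have hsub : Icc (-b) b ⊆ Ioo (-b) b ∪ {-b, b} := by
      intro t ht
      rcases eq_or_lt_of_le ht.1 with h | h
      · right; left; exact h.symm
      rcases eq_or_lt_of_le ht.2 with h' | h'
      · right; right; exact h'
      · left; exact ⟨h, h'⟩
    refine measure_mono_null (image_mono hsub) ?_
    rw [image_union]
    exact measure_union_null (volume_curve_eq_zero dxi.hasDerivAt hY.hasDerivAt)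
      ((Set.toFinite _).image _ |>.measure_zero _)
  have hbdd : ∃ M, frontier E ⊆ Metric.closedBall c M := by
    have h1 : IsCompact ((fun t => (!₂[xo t, yo t] : Plane)) '' Icc (-θ) θ) :=
      isCompact_Icc.image_of_continuousOn (dxo.continuousOn.plane dyo.continuousOn)
    have h2 : IsCompact ((fun t => (!₂[xi t, Y t] : Plane)) '' Icc (-b) b) :=
      isCompact_Icc.image_of_continuousOn (dxi.continuousOn.plane hY.continuousOn)
    obtain ⟨M, hM⟩ := (h1.union h2).isBounded.subset_closedBall c
    refine ⟨M, Subset.trans ?_ hM⟩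
    rw [hfr]
    exact union_subset_union (image_mono Ioo_subset_Icc_self) Subset.rfl
  obtain ⟨M, hM⟩ := hbdd
  have hex' : ∀ x, x ≠ c → ∃ s > (0 : ℝ), c + s • (x - c) ∈ frontier E := by
    intro x hx
    obtain ⟨u, v, rfl⟩ := mk_surj x
    obtain ⟨s, hs, h⟩ := hex u v (by
      by_contra! hcon
      exact hx (by rw [hcon.1, hcon.2]))
    exact ⟨s, hs, by rwa [mk_line, hfrF]⟩
  obtain ⟨hin, hout⟩ := mem_of_frontier_star hM (by rwa [hc, hfrF]) hex'
    (by
      intro x hx s hs h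
      obtain ⟨u, v, rfl⟩ := mk_surj x
      rw [mk_line, hfrF] at h
      exact huniq u v s hs ((hfrF u v).1 hx) h) hnull hpos hfin
  have hsub1 : Co ∪ Ci ⊆ E := by
    rintro _ (⟨⟨s, t⟩, ⟨hs, ht⟩, rfl⟩ | ⟨⟨s, t⟩, ⟨hs, ht⟩, rfl⟩)
    · rw [hcone_o, ← mk_line]
      exact hin _ ((hfrF _ _).2 (Or.inl ⟨t, ht, rfl, rfl⟩)) s hs
    · rw [hcone_i, ← mk_line]
      exact hin _ ((hfrF _ _).2 (Or.inr ⟨t, Ioo_subset_Icc_self ht, rfl, rfl⟩)) s hs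
  have hraynull : ∀ u v, volume ((fun s => mk (s * u) (s * v)) '' Ioo 0 1) = 0 := by
    intro u v
    refine volume_curve_eq_zero (x' := fun _ => η * (1 * u)) (y' := fun _ => 1 * v)
      (fun t _ => ?_) (fun t _ => ?_)
    · exact (((hasDerivAt_id t).mul_const u).const_mul η).const_add p
    · exact (hasDerivAt_id t).mul_const v
  -- What the two open cones miss: the frontier, the pole, and the two segments from the pole to the
  -- corners, which correspond to the parameters ±b.
  set N : Set Plane := frontier E ∪ {c} ∪
    ((fun s => mk (s * -X (-b)) (s * Y (-b))) '' Ioo 0 1 ∪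
      (fun s => mk (s * -X b) (s * Y b)) '' Ioo 0 1) with hN
  have hN0 : volume N = 0 :=
    measure_union_null (measure_union_null hnull (by simp))
      (measure_union_null (hraynull _ _) (hraynull _ _))
  have hsub2 : E ⊆ (Co ∪ Ci) ∪ N := by
    intro w hw
    by_cases hwc : w = c
    · exact Or.inr (Or.inl (Or.inr hwc))
    obtain ⟨s, hs, hmem⟩ := hex' w hwc
    have hwq : w = c + s⁻¹ • ((c + s • (w - c)) - c) := by
      rw [add_sub_cancel_left, smul_smul, inv_mul_cancel₀ hs.ne', one_smul]; simp
    generalize hq : c + s • (w - c) = q at hmem hwq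
    have hs' : 0 < s⁻¹ := inv_pos.2 hs
    rcases lt_trichotomy s⁻¹ 1 with h | h | h
    · obtain ⟨u, v, rfl⟩ := mk_surj q
      rw [mk_line] at hwq
      rcases (hfrF u v).1 hmem with ⟨t, ht, rfl, rfl⟩ | ⟨t, ht, rfl, rfl⟩
      · refine Or.inl (Or.inl ⟨(s⁻¹, t), ⟨⟨hs', h⟩, ht⟩, ?_⟩)
        rw [hcone_o, hwq]
      · rcases eq_or_lt_of_le ht.1 with h1 | h1
        · refine Or.inr (Or.inr (Or.inl ⟨s⁻¹, ⟨hs', h⟩, ?_⟩))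
          rw [hwq, h1]
        rcases eq_or_lt_of_le ht.2 with h2 | h2
        · refine Or.inr (Or.inr (Or.inr ⟨s⁻¹, ⟨hs', h⟩, ?_⟩))
          rw [hwq, h2]
        · refine Or.inl (Or.inr ⟨(s⁻¹, t), ⟨⟨hs', h⟩, h1, h2⟩, ?_⟩)
          rw [hcone_i, hwq]
    · rw [h, one_smul, add_sub_cancel] at hwq
      exact Or.inr (Or.inl (Or.inl (hwq ▸ hmem)))
    · exact absurd (hwq ▸ hw) (hout q hmem _ h)
  have hae : E =ᵐ[volume] (Co ∪ Ci : Set Plane) := by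
    refine Filter.EventuallyLE.antisymm ?_ hsub1.eventuallyLE
    rw [ae_le_set]
    exact measure_mono_null (fun w hw => (hsub2 hw.1).resolve_left hw.2) hN0
  have hdiv := continuous_divergence hT
  have tau_o : ∀ t ∈ Ioo (-θ) θ, 0 < η * ((xo t - p) * (R' t * Real.sin t + R t * Real.cos t) -
      (yo t - 0) * (η * (R' t * Real.cos t + R t * -Real.sin t))) := by
    intro t ht
    have h1 := hRpos t (Ioo_subset_Icc_self ht)
    have e : η * ((xo t - p) * (R' t * Real.sin t + R t * Real.cos t) -
      (yo t - 0) * (η * (R' t * Real.cos t + R t * -Real.sin t))) = R t ^ 2 := by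
      simp only [hxo, hyo]
      linear_combination (R t ^ 2 * (Real.sin t ^ 2 + Real.cos t ^ 2)) * hη +
        R t ^ 2 * Real.sin_sq_add_cos_sq t
    rw [e]; positivity
  have tau_i : ∀ t ∈ Ioo (-b) b, 0 < -η * ((xi t - p) * Y' t - (Y t - 0) * (-η * X' t)) := by
    intro t ht
    have e : -η * ((xi t - p) * Y' t - (Y t - 0) * (-η * X' t)) = X t * Y' t - Y t * X' t := by
      simp only [hxi]
      linear_combination (X t * Y' t - Y t * X' t) * hη
    rw [e]; exact hrot t ht
  rw [setIntegral_congr_set hae, setIntegral_union hdisj (measurableSet_cone dxi hY inj_i)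
    (integrableOn_cone dxo.continuousOn dyo.continuousOn hdiv)
    (integrableOn_cone dxi.continuousOn hY.continuousOn hdiv),
    setIntegral_cone dxo dyo inj_o hηabs tau_o,
    setIntegral_cone dxi hY inj_i (by rw [abs_neg, hηabs]) tau_i,
    integral_cone_divergence hθ0 dxo dyo hT, integral_cone_divergence hb dxi hY hT]
  -- Both arcs have the same end points, so the fluxes through the sides of the two cones coincide
  -- and cancel, the cones having opposite orientations.
  have ex1 : xi b = xo θ := by simp only [hxi, hxo, hXr]; ring
  have ex2 : xi (-b) = xo (-θ) := by simp only [hxi, hxo, hXl, Real.cos_neg]; ring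
  have ey1 : Y b = yo θ := by simp only [hyo, hYr]
  have ey2 : Y (-b) = yo (-θ) := by simp only [hyo, hYl, Real.sin_neg]; ring
  rw [ex1, ex2, ey1, ey2]
  ring

/-! ### The perimeter of a set with piecewise `C¹` boundary -/

theorem integral_divergence_eq_zero {T : Plane → Plane} (hT : ContDiff ℝ 1 T)
    (hc : HasCompactSupport T) : ∫ x, divergence T x = 0 := by
  have hcd : ∀ i j, HasCompactSupport (partialDeriv T i j) := by
    intro i j
    refine (hc.fderiv ℝ).mono fun x hx => ?_
    rw [Function.mem_support] at hx ⊢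
    intro h
    apply hx
    simp [partialDeriv, h]
  have hint : ∀ i j, Integrable (partialDeriv T i j) := fun i j =>
    (continuous_partialDeriv hT i j).integrable_of_hasCompactSupport (hcd i j)
  have hzero : ∀ i j, ∫ x, partialDeriv T i j x = 0 := by
    intro i j
    have hd : ∀ x, HasFDerivAt (fun x => T x i)
        ((EuclideanSpace.proj (𝕜 := ℝ) i : Plane →L[ℝ] ℝ).comp (fderiv ℝ T x)) x := fun x =>
      (EuclideanSpace.proj (𝕜 := ℝ) i).hasFDerivAt.comp x
        ((hT.differentiable (by simp)) x).hasFDerivAt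
    have hTi : HasCompactSupport (fun x => T x i) := by
      refine hc.mono fun x hx => ?_
      rw [Function.mem_support] at hx ⊢
      intro h
      apply hx
      simp [h]
    have hTc : Continuous (fun x => T x i) :=
      (EuclideanSpace.proj (𝕜 := ℝ) i).continuous.comp hT.continuous
    have key := integral_mul_fderiv_eq_neg_fderiv_mul_of_integrable (𝕜 := ℝ) (μ := (volume : Measure Plane))
      (f := fun _ : Plane => (1 : ℝ)) (g := fun x => T x i) (v := EuclideanSpace.single j 1)
      (by simp) ?_ ?_ (fun x _ => differentiableAt_const _) (fun x _ => (hd x).differentiableAt)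
    · simp only [one_mul, fderiv_fun_const, Pi.zero_apply, zero_apply,
        zero_mul, integral_zero, neg_zero] at key
      rw [← key]
      refine integral_congr_ae (Filter.Eventually.of_forall fun x => ?_)
      simp only [(hd x).fderiv]
      rfl
    · simp only [one_mul]
      refine (hint i j).congr (Filter.Eventually.of_forall fun x => ?_)
      simp only [(hd x).fderiv]
      rfl
    · simpa using hTc.integrable_of_hasCompactSupport hTi
  rw [funext (divergence_eq T), integral_add (hint 0 0) (hint 1 1), hzero, hzero, add_zero]

theorem integrable_divergence {T : Plane → Plane} (hT : ContDiff ℝ 1 T)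
    (hc : HasCompactSupport T) : Integrable (divergence T) := by
  refine (continuous_divergence hT).integrable_of_hasCompactSupport ?_
  refine (hc.fderiv ℝ).mono fun x hx => ?_
  rw [Function.mem_support] at hx ⊢
  intro h
  apply hx
  simp [divergence, h]

theorem plane_cross_le (v : Plane) (p q : ℝ) : v 0 * q - v 1 * p ≤ ‖v‖ * √(p ^ 2 + q ^ 2) := by
  rw [EuclideanSpace.norm_eq, Fin.sum_univ_two, ← Real.sqrt_mul (by positivity)]
  apply Real.le_sqrt_of_sq_le
  simp only [Real.norm_eq_abs, sq_abs]
  nlinarith [sq_nonneg (v 0 * p + v 1 * q)]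

/-- The length of an arc with velocity `(x', y')` and parameter in `(-a, a)`. -/
def arcLength (a : ℝ) (x' y' : ℝ → ℝ) : ℝ := ∫ t in (-a)..a, √(x' t ^ 2 + y' t ^ 2)

/-- There is a compactly supported `C¹` field of norm at most one close to prescribed values of
norm at most one along two disjoint compact simple arcs. -/
theorem exists_contDiff_field_near {K₁ K₂ : Set ℝ} (hK₁ : IsCompact K₁) (hK₂ : IsCompact K₂)
    {γ₁ γ₂ N₁ N₂ : ℝ → Plane} (hγ₁ : ContinuousOn γ₁ K₁) (hγ₂ : ContinuousOn γ₂ K₂)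
    (hN₁ : ContinuousOn N₁ K₁) (hN₂ : ContinuousOn N₂ K₂) (hi₁ : InjOn γ₁ K₁) (hi₂ : InjOn γ₂ K₂)
    (hdisj : ∀ s ∈ K₁, ∀ t ∈ K₂, γ₁ s ≠ γ₂ t) (hb₁ : ∀ t ∈ K₁, ‖N₁ t‖ ≤ 1)
    (hb₂ : ∀ t ∈ K₂, ‖N₂ t‖ ≤ 1) {δ : ℝ} (hδ : 0 < δ) :
    ∃ T : Plane → Plane, ContDiff ℝ 1 T ∧ HasCompactSupport T ∧ (∀ x, ‖T x‖ ≤ 1) ∧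
      (∀ t ∈ K₁, ‖T (γ₁ t) - N₁ t‖ ≤ 2 * δ) ∧ ∀ t ∈ K₂, ‖T (γ₂ t) - N₂ t‖ ≤ 2 * δ := by
  have := isCompact_iff_compactSpace.1 hK₁
  have := isCompact_iff_compactSpace.1 hK₂
  let Γ : K₁ ⊕ K₂ → Plane := Sum.elim (fun t => γ₁ t) (fun t => γ₂ t)
  have hΓc : Continuous Γ := hγ₁.domRestrict.sumElim hγ₂.domRestrict
  have hΓi : Function.Injective Γ := by
    rintro (⟨s, hs⟩ | ⟨s, hs⟩) (⟨t, ht⟩ | ⟨t, ht⟩) h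
    · exact congrArg _ (Subtype.ext (hi₁ hs ht h))
    · exact absurd h (hdisj s hs t ht)
    · exact absurd h.symm (hdisj t ht s hs)
    · exact congrArg _ (Subtype.ext (hi₂ hs ht h))
  have hΓ := hΓc.isClosedEmbedding hΓi
  let n₀ : K₁ ⊕ K₂ → Plane := Sum.elim (fun t : K₁ => N₁ t) (fun t : K₂ => N₂ t)
  have hn₀c : Continuous n₀ := hN₁.domRestrict.sumElim hN₂.domRestrict
  have hn₀b : ∀ z, n₀ z ∈ Metric.closedBall (0 : Plane) 1 := by
    rintro (⟨t, ht⟩ | ⟨t, ht⟩)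
    · exact mem_closedBall_zero_iff.2 (hb₁ t ht)
    · exact mem_closedBall_zero_iff.2 (hb₂ t ht)
  let n : C(K₁ ⊕ K₂, Metric.closedBall (0 : Plane) 1) :=
    ⟨fun z => ⟨n₀ z, hn₀b z⟩, hn₀c.subtype_mk hn₀b⟩
  -- Tietze extension with values in the closed unit ball: the union of the arcs is a closed
  -- embedding because the parameter sets are compact and the arcs simple and disjoint.
  obtain ⟨f, hf⟩ := n.exists_extension hΓ
  obtain ⟨R, hR⟩ := (isCompact_range hΓc).isBounded.exists_norm_le
  let χ : Plane → ℝ := fun x => max 0 (min 1 (R + 1 - ‖x‖))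
  have hχc : Continuous χ := by fun_prop
  have hχ0 : ∀ x, 0 ≤ χ x := fun x => le_max_left _ _
  have hχ1 : ∀ x, χ x ≤ 1 := fun x => max_le zero_le_one (min_le_left _ _)
  have hχK : ∀ x, ‖x‖ ≤ R → χ x = 1 := fun x hx => by
    simp only [χ]
    rw [min_eq_left (by linarith), max_eq_right zero_le_one]
  let F : Plane → Plane := fun x => χ x • (f x : Plane)
  have hFc : Continuous F := hχc.smul (continuous_subtype_val.comp f.continuous)
  have hfn : ∀ x, ‖(f x : Plane)‖ ≤ 1 := fun x => mem_closedBall_zero_iff.1 (f x).2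
  have hFn : ∀ x, ‖F x‖ ≤ 1 := fun x => by
    simp only [F, norm_smul, Real.norm_eq_abs, abs_of_nonneg (hχ0 x)]
    exact mul_le_one₀ (hχ1 x) (norm_nonneg _) (hfn x)
  have hFs : HasCompactSupport F := by
    refine HasCompactSupport.of_support_subset_isCompact (isCompact_closedBall 0 (R + 1)) ?_
    intro x hx
    rw [Metric.mem_closedBall, dist_zero_right]
    by_contra h
    apply hx
    have : χ x = 0 := by
      simp only [χ]
      rw [max_eq_left]
      exact (min_le_right _ _).trans (by linarith)
    simp [F, this]
  -- Smoothing to within δ may raise the norm to `1 + δ`. Dividing by `1 + δ` restores the bound 1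
  -- and brings the total error to at most `2δ`.
  obtain ⟨g, hg, hgF, hgs⟩ := hFc.exists_contDiff_approx 1
    (continuous_const (y := δ)) (fun _ => hδ)
  have hδ1 : 0 < 1 + δ := by linarith
  have hinv : (1 + δ)⁻¹ ≤ 1 := inv_le_one_of_one_le₀ (by linarith)
  have hinv0 : 0 < (1 + δ)⁻¹ := inv_pos.2 hδ1
  have near : ∀ (x N : Plane), F x = N → ‖(1 + δ)⁻¹ • g x - N‖ ≤ 2 * δ := by
    intro x N hN
    have e : (1 + δ)⁻¹ • g x - N = (1 + δ)⁻¹ • ((g x - F x) - δ • F x) := by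
      rw [← hN]
      generalize F x = v
      match_scalars <;> field_simp
      ring
    have h1 : ‖g x - F x‖ ≤ δ := by rw [← dist_eq_norm]; exact (hgF x).le
    have h2 : ‖δ • F x‖ ≤ δ := by
      rw [norm_smul, Real.norm_eq_abs, abs_of_pos hδ]
      exact mul_le_of_le_one_right hδ.le (hFn x)
    rw [e, norm_smul, Real.norm_eq_abs, abs_of_pos hinv0]
    calc (1 + δ)⁻¹ * ‖(g x - F x) - δ • F x‖ ≤ 1 * ‖(g x - F x) - δ • F x‖ :=
          mul_le_mul_of_nonneg_right hinv (norm_nonneg _)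
      _ ≤ 2 * δ := by
          have := norm_sub_le (g x - F x) (δ • F x)
          linarith
  refine ⟨fun x => (1 + δ)⁻¹ • g x, hg.const_smul _, ?_, ?_, ?_, ?_⟩
  · have : HasCompactSupport g := hFs.mono hgs
    exact this.smul_left (f := fun _ => (1 + δ)⁻¹)
  · intro x
    rw [norm_smul, Real.norm_eq_abs, abs_of_pos hinv0, inv_mul_le_iff₀ hδ1, mul_one]
    have h1 : ‖g x - F x‖ ≤ δ := by rw [← dist_eq_norm]; exact (hgF x).le
    have h2 := norm_add_le (g x - F x) (F x)
    rw [sub_add_cancel] at h2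
    linarith [hFn x]
  · intro t ht
    refine near _ _ ?_
    have h1 := DFunLike.congr_fun hf (Sum.inl ⟨t, ht⟩)
    have h2 : (f (γ₁ t) : Plane) = N₁ t := congrArg Subtype.val h1
    have h3 : χ (γ₁ t) = 1 := hχK _ (hR _ ⟨Sum.inl ⟨t, ht⟩, rfl⟩)
    simp only [F, h2, h3, one_smul]
  · intro t ht
    refine near _ _ ?_
    have h1 := DFunLike.congr_fun hf (Sum.inr ⟨t, ht⟩)
    have h2 : (f (γ₂ t) : Plane) = N₂ t := congrArg Subtype.val h1
    have h3 : χ (γ₂ t) = 1 := hχK _ (hR _ ⟨Sum.inr ⟨t, ht⟩, rfl⟩)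
    simp only [F, h2, h3, one_smul]

namespace HasBoundedDerivOn

variable {a : ℝ} {x x' y y' : ℝ → ℝ}

theorem continuousOn_speed (hx : HasBoundedDerivOn a x x') (hy : HasBoundedDerivOn a y y') :
    ContinuousOn (fun t => √(x' t ^ 2 + y' t ^ 2)) (Ioo (-a) a) :=
  ((hx.continuousOn_deriv.pow 2).add (hy.continuousOn_deriv.pow 2)).sqrt

theorem exists_speed_le (hx : HasBoundedDerivOn a x x') (hy : HasBoundedDerivOn a y y') :
    ∃ M, ∀ t ∈ Ioo (-a) a, √(x' t ^ 2 + y' t ^ 2) ≤ M := by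
  obtain ⟨M, hM⟩ := hx.bounded_deriv
  obtain ⟨N, hN⟩ := hy.bounded_deriv
  refine ⟨√(M ^ 2 + N ^ 2), fun t ht => Real.sqrt_le_sqrt (add_le_add ?_ ?_)⟩
  · rw [← sq_abs (x' t)]; exact pow_le_pow_left₀ (abs_nonneg _) (hM t ht) 2
  · rw [← sq_abs (y' t)]; exact pow_le_pow_left₀ (abs_nonneg _) (hN t ht) 2

theorem intervalIntegrable_speed (ha : 0 < a) (hx : HasBoundedDerivOn a x x')
    (hy : HasBoundedDerivOn a y y') :
    IntervalIntegrable (fun t => √(x' t ^ 2 + y' t ^ 2)) volume (-a) a := by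
  obtain ⟨M, hM⟩ := hx.exists_speed_le hy
  exact intervalIntegrable_of_continuousOn_Ioo (M := M) (by linarith) (hx.continuousOn_speed hy)
    fun t ht => by rw [abs_of_nonneg (Real.sqrt_nonneg _)]; exact hM t ht

theorem abs_cross_le {T : Plane → Plane} (hT1 : ∀ x, ‖T x‖ ≤ 1) (x x' y y' : ℝ → ℝ) (t : ℝ) :
    |T !₂[x t, y t] 0 * y' t - T !₂[x t, y t] 1 * x' t| ≤ √(x' t ^ 2 + y' t ^ 2) := by
  have h0 := Real.sqrt_nonneg (x' t ^ 2 + y' t ^ 2)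
  rw [abs_le']
  constructor
  · exact (plane_cross_le _ _ _).trans (mul_le_of_le_one_left h0 (hT1 _))
  · have := plane_cross_le (-T !₂[x t, y t]) (x' t) (y' t)
    rw [norm_neg] at this
    simp only [PiLp.neg_apply] at this
    have h2 := mul_le_of_le_one_left h0 (hT1 !₂[x t, y t])
    linarith

theorem intervalIntegrable_cross (ha : 0 < a) (hx : HasBoundedDerivOn a x x')
    (hy : HasBoundedDerivOn a y y') {T : Plane → Plane} (hT : Continuous T)
    (hT1 : ∀ x, ‖T x‖ ≤ 1) :
    IntervalIntegrable (fun t => T !₂[x t, y t] 0 * y' t - T !₂[x t, y t] 1 * x' t)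
      volume (-a) a := by
  obtain ⟨M, hM⟩ := hx.exists_speed_le hy
  have cT : ∀ i, ContinuousOn (fun t => T !₂[x t, y t] i) (Ioo (-a) a) := fun i =>
    ((EuclideanSpace.proj (𝕜 := ℝ) i).continuous.comp hT).comp_continuousOn
      ((hx.continuousOn.plane hy.continuousOn).mono Ioo_subset_Icc_self)
  exact intervalIntegrable_of_continuousOn_Ioo (M := M) (by linarith)
    (((cT 0).mul hy.continuousOn_deriv).sub ((cT 1).mul hx.continuousOn_deriv))
    fun t ht => (abs_cross_le hT1 x x' y y' t).trans (hM t ht)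

theorem abs_flux_le (ha : 0 < a) (hx : HasBoundedDerivOn a x x')
    (hy : HasBoundedDerivOn a y y') {T : Plane → Plane} (hT1 : ∀ x, ‖T x‖ ≤ 1) :
    |flux T a x x' y y'| ≤ arcLength a x' y' := by
  rw [flux, arcLength, ← Real.norm_eq_abs]
  exact intervalIntegral.norm_integral_le_of_norm_le (by linarith)
    (Filter.Eventually.of_forall fun t _ => abs_cross_le hT1 x x' y y' t)
    (hx.intervalIntegrable_speed ha hy)

/-- The field is controlled only away from the end points, where unit tangents need not have limits.
Each end piece of length δ loses at most `2 M δ`; the middle one loses at most `2 δ M` per unit of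
parameter, over a length below `2a`. -/
theorem arcLength_sub_le_flux (ha : 0 < a) (hx : HasBoundedDerivOn a x x')
    (hy : HasBoundedDerivOn a y y') {T : Plane → Plane} (hT : Continuous T)
    (hT1 : ∀ x, ‖T x‖ ≤ 1) {M δ τ : ℝ} (hM : ∀ t ∈ Ioo (-a) a, √(x' t ^ 2 + y' t ^ 2) ≤ M)
    (hδ : 0 < δ) (hδa : δ < a) (hτ : |τ| = 1)
    (hnear : ∀ t ∈ Icc (-a + δ) (a - δ), (1 - 2 * δ) * √(x' t ^ 2 + y' t ^ 2) ≤
      τ * (T !₂[x t, y t] 0 * y' t - T !₂[x t, y t] 1 * x' t)) :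
    arcLength a x' y' - (4 * a + 4) * M * δ ≤ τ * flux T a x x' y y' := by
  have i1 := hx.intervalIntegrable_speed ha hy
  have i2 := (hx.intervalIntegrable_cross ha hy hT hT1).const_mul τ
  have i3 := i1.sub i2
  have hM0 : 0 ≤ M := (Real.sqrt_nonneg _).trans (hM 0 ⟨by linarith, ha⟩)
  rw [flux, ← intervalIntegral.integral_const_mul]
  have hsub := intervalIntegral.integral_sub i1 i2
  set f : ℝ → ℝ := fun t => √(x' t ^ 2 + y' t ^ 2) -
    τ * (T !₂[x t, y t] 0 * y' t - T !₂[x t, y t] 1 * x' t) with hf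
  have hfi : ∀ c d, -a ≤ c → c ≤ d → d ≤ a → IntervalIntegrable f volume c d := by
    intro c d h1 h2 h3
    refine i3.mono_set ?_
    rw [uIcc_of_le h2, uIcc_of_le (by linarith)]
    exact Icc_subset_Icc h1 h3
  have hle : ∀ c d C, -a ≤ c → c ≤ d → d ≤ a → (∀ t ∈ Ioo c d, f t ≤ C) →
      ∫ t in c..d, f t ≤ C * (d - c) := by
    intro c d C h1 h2 h3 h4
    have := intervalIntegral.integral_mono_on_of_le_Ioo h2 (hfi c d h1 h2 h3)
      (intervalIntegrable_const (c := C)) h4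
    rw [intervalIntegral.integral_const, smul_eq_mul] at this
    linarith
  have hbig : ∀ t ∈ Ioo (-a) a, f t ≤ 2 * M := by
    intro t ht
    have h1 := hM t ht
    have h2 := abs_cross_le hT1 x x' y y' t
    have h3 : |τ * (T !₂[x t, y t] 0 * y' t - T !₂[x t, y t] 1 * x' t)| ≤ M := by
      rw [abs_mul, hτ, one_mul]; exact h2.trans h1
    have h4 := neg_abs_le (τ * (T !₂[x t, y t] 0 * y' t - T !₂[x t, y t] 1 * x' t))
    simp only [hf]
    linarith
  have hsmall : ∀ t ∈ Ioo (-a + δ) (a - δ), f t ≤ 2 * δ * M := by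
    intro t ht
    have h1 := hM t ⟨by linarith [ht.1], by linarith [ht.2]⟩
    have h2 := hnear t (Ioo_subset_Icc_self ht)
    have h3 := mul_le_mul_of_nonneg_left h1 (by linarith : (0 : ℝ) ≤ 2 * δ)
    simp only [hf]
    linarith
  have e1 := hle (-a) (-a + δ) (2 * M) le_rfl (by linarith) (by linarith)
    fun t ht => hbig t ⟨ht.1, by linarith [ht.2]⟩
  have e2 := hle (-a + δ) (a - δ) (2 * δ * M) (by linarith) (by linarith) (by linarith) hsmall
  have e3 := hle (a - δ) a (2 * M) (by linarith) (by linarith) le_rfl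
    fun t ht => hbig t ⟨by linarith [ht.1], ht.2⟩
  have s1 := intervalIntegral.integral_add_adjacent_intervals
    (hfi (-a) (-a + δ) le_rfl (by linarith) (by linarith))
    (hfi (-a + δ) (a - δ) (by linarith) (by linarith) (by linarith))
  have s2 := intervalIntegral.integral_add_adjacent_intervals
    (hfi (-a) (a - δ) le_rfl (by linarith) (by linarith))
    (hfi (a - δ) a (by linarith) (by linarith) le_rfl)
  have hp : 0 ≤ δ * M * δ := by positivity
  rw [arcLength]
  nlinarith

end HasBoundedDerivOn

/-- The set function `T ↦ τ₁ F₁(T) + τ₂ F₂(T)`, with `F₁, F₂` the fluxes through two disjoint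
simple arcs, comes as close as desired to the total length. -/
theorem exists_lt_flux_add_flux {a b τ₁ τ₂ : ℝ} {x x' y y' z z' w w' : ℝ → ℝ} (ha : 0 < a)
    (hb : 0 < b) (hτ₁ : |τ₁| = 1) (hτ₂ : |τ₂| = 1)
    (hx : HasBoundedDerivOn a x x') (hy : HasBoundedDerivOn a y y')
    (hz : HasBoundedDerivOn b z z') (hw : HasBoundedDerivOn b w w')
    (hreg₁ : ∀ t ∈ Ioo (-a) a, 0 < x' t ^ 2 + y' t ^ 2)
    (hreg₂ : ∀ t ∈ Ioo (-b) b, 0 < z' t ^ 2 + w' t ^ 2)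
    (hi₁ : InjOn (fun t => (!₂[x t, y t] : Plane)) (Ioo (-a) a))
    (hi₂ : InjOn (fun t => (!₂[z t, w t] : Plane)) (Ioo (-b) b))
    (hdisj : ∀ s ∈ Ioo (-a) a, ∀ t ∈ Ioo (-b) b, (!₂[x s, y s] : Plane) ≠ !₂[z t, w t])
    {c : ℝ} (hc : c < arcLength a x' y' + arcLength b z' w') :
    ∃ T : Plane → Plane, ContDiff ℝ 1 T ∧ HasCompactSupport T ∧ (∀ x, ‖T x‖ ≤ 1) ∧
      c < τ₁ * flux T a x x' y y' + τ₂ * flux T b z z' w w' := by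
  obtain ⟨M, hM⟩ := hx.exists_speed_le hy
  obtain ⟨N, hN⟩ := hz.exists_speed_le hw
  have hM0 : 0 ≤ M := (Real.sqrt_nonneg _).trans (hM 0 ⟨by linarith, ha⟩)
  have hN0 : 0 ≤ N := (Real.sqrt_nonneg _).trans (hN 0 ⟨by linarith, hb⟩)
  set D := (4 * a + 4) * M + (4 * b + 4) * N + 1 with hD
  have hDpos : 0 < D := by positivity
  set S := arcLength a x' y' + arcLength b z' w' - c with hS
  have hSpos : 0 < S := by rw [hS]; linarith
  obtain ⟨δ, hδ0, hδ⟩ := exists_between (lt_min (lt_min ha hb) (div_pos hSpos hDpos))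
  have hδa : δ < a := hδ.trans_le ((min_le_left _ _).trans (min_le_left _ _))
  have hδb : δ < b := hδ.trans_le ((min_le_left _ _).trans (min_le_right _ _))
  have hδD : δ * D < S := (lt_div_iff₀ hDpos).1 (hδ.trans_le (min_le_right _ _))
  have sub : ∀ a : ℝ, Icc (-a + δ) (a - δ) ⊆ Ioo (-a) a := fun a t ht =>
    ⟨by linarith [ht.1], by linarith [ht.2]⟩
  -- The vector is the unit normal of an arc with velocity (p, q), with sign τ, which is the value
  -- prescribed for the test field.
  have unit : ∀ τ p q : ℝ, |τ| = 1 → 0 < p ^ 2 + q ^ 2 →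
      ‖(!₂[τ * q / √(p ^ 2 + q ^ 2), -(τ * p) / √(p ^ 2 + q ^ 2)] : Plane)‖ ≤ 1 := by
    intro τ p q hτ h
    have hτ2 : τ ^ 2 = 1 := by rw [← sq_abs, hτ, one_pow]
    rw [EuclideanSpace.norm_eq, Real.sqrt_le_one, Fin.sum_univ_two]
    simp only [Real.norm_eq_abs, sq_abs]
    simp only [Matrix.cons_val_zero, Matrix.cons_val_one, div_pow, Real.sq_sqrt h.le]
    rw [← add_div, div_le_one h]
    nlinarith
  have cunit : ∀ (a τ : ℝ) (x x' y y' : ℝ → ℝ), HasBoundedDerivOn a x x' →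
      HasBoundedDerivOn a y y' → (∀ t ∈ Ioo (-a) a, 0 < x' t ^ 2 + y' t ^ 2) →
      ContinuousOn (fun t => (!₂[τ * y' t / √(x' t ^ 2 + y' t ^ 2),
        -(τ * x' t) / √(x' t ^ 2 + y' t ^ 2)] : Plane)) (Icc (-a + δ) (a - δ)) := by
    intro a τ x x' y y' hx hy hr
    refine ContinuousOn.mono ?_ (sub a)
    have hs := hx.continuousOn_speed hy
    have hne : ∀ t ∈ Ioo (-a) a, √(x' t ^ 2 + y' t ^ 2) ≠ 0 := fun t ht =>
      (Real.sqrt_pos.2 (hr t ht)).ne'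
    exact ((continuousOn_const.mul hy.continuousOn_deriv).div hs hne).plane
      ((continuousOn_const.mul hx.continuousOn_deriv).neg.div hs hne)
  obtain ⟨T, hT, hTc, hT1, hn₁, hn₂⟩ := exists_contDiff_field_near
    (isCompact_Icc (a := -a + δ) (b := a - δ)) (isCompact_Icc (a := -b + δ) (b := b - δ))
    ((hx.continuousOn.plane hy.continuousOn).mono ((sub a).trans Ioo_subset_Icc_self))
    ((hz.continuousOn.plane hw.continuousOn).mono ((sub b).trans Ioo_subset_Icc_self))
    (cunit a τ₁ x x' y y' hx hy hreg₁) (cunit b τ₂ z z' w w' hz hw hreg₂)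
    (hi₁.mono (sub a)) (hi₂.mono (sub b))
    (fun s hs t ht => hdisj s (sub a hs) t (sub b ht))
    (fun t ht => unit _ _ _ hτ₁ (hreg₁ t (sub a ht)))
    (fun t ht => unit _ _ _ hτ₂ (hreg₂ t (sub b ht))) hδ0
  have near : ∀ τ p q : ℝ, |τ| = 1 → 0 < p ^ 2 + q ^ 2 → ∀ v : Plane,
      ‖v - !₂[τ * q / √(p ^ 2 + q ^ 2), -(τ * p) / √(p ^ 2 + q ^ 2)]‖ ≤ 2 * δ →
      (1 - 2 * δ) * √(p ^ 2 + q ^ 2) ≤ τ * (v 0 * q - v 1 * p) := by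
    intro τ p q hτ h v hv
    have hτ2 : τ ^ 2 = 1 := by rw [← sq_abs, hτ, one_pow]
    have hs := Real.sqrt_pos.2 h
    have hss := Real.sq_sqrt h.le
    set s := √(p ^ 2 + q ^ 2) with hsd
    have h1 := plane_cross_le ((-τ) • (v - !₂[τ * q / s, -(τ * p) / s])) p q
    rw [norm_smul, norm_neg, Real.norm_eq_abs, hτ, one_mul, ← hsd] at h1
    simp only [PiLp.smul_apply, PiLp.sub_apply, smul_eq_mul, Matrix.cons_val_zero,
      Matrix.cons_val_one] at h1
    have h2 := mul_le_mul_of_nonneg_right hv hs.le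
    have h3 : τ * (τ * q / s * q - -(τ * p) / s * p) = s := by
      field_simp
      rw [hss]
      nlinarith
    nlinarith
  have f1 := hx.arcLength_sub_le_flux ha hy hT.continuous hT1 hM hδ0 hδa hτ₁
    fun t ht => near _ _ _ hτ₁ (hreg₁ t (sub a ht)) _ (hn₁ t ht)
  have f2 := hz.arcLength_sub_le_flux hb hw hT.continuous hT1 hN hδ0 hδb hτ₂
    fun t ht => near _ _ _ hτ₂ (hreg₂ t (sub b ht)) _ (hn₂ t ht)
  refine ⟨T, hT, hTc, hT1, ?_⟩
  have : (4 * a + 4) * M * δ + (4 * b + 4) * N * δ ≤ δ * D := by rw [hD]; linarith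
  linarith

/-- Gauss–Green bounds every competitor by the total length, since `|T| ≤ 1`; fields nearly equal to
the signed normals attain it in the limit. It serves the two chambers and the exterior alike, each
being bounded by two arcs. -/
theorem distPerimeter_eq_of_flux {E : Set Plane} {a b τ₁ τ₂ : ℝ} {x x' y y' z z' w w' : ℝ → ℝ}
    (ha : 0 < a) (hb : 0 < b) (hτ₁ : |τ₁| = 1) (hτ₂ : |τ₂| = 1)
    (hx : HasBoundedDerivOn a x x') (hy : HasBoundedDerivOn a y y')
    (hz : HasBoundedDerivOn b z z') (hw : HasBoundedDerivOn b w w')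
    (hreg₁ : ∀ t ∈ Ioo (-a) a, 0 < x' t ^ 2 + y' t ^ 2)
    (hreg₂ : ∀ t ∈ Ioo (-b) b, 0 < z' t ^ 2 + w' t ^ 2)
    (hi₁ : InjOn (fun t => (!₂[x t, y t] : Plane)) (Ioo (-a) a))
    (hi₂ : InjOn (fun t => (!₂[z t, w t] : Plane)) (Ioo (-b) b))
    (hdisj : ∀ s ∈ Ioo (-a) a, ∀ t ∈ Ioo (-b) b, (!₂[x s, y s] : Plane) ≠ !₂[z t, w t])
    (hE : ∀ T : Plane → Plane, ContDiff ℝ 1 T → HasCompactSupport T →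
      ∫ p in E, divergence T p = τ₁ * flux T a x x' y y' + τ₂ * flux T b z z' w w') :
    (distPerimeter E).toReal = arcLength a x' y' + arcLength b z' w' := by
  have hlen : 0 ≤ arcLength a x' y' + arcLength b z' w' :=
    add_nonneg (intervalIntegral.integral_nonneg (by linarith) fun _ _ => Real.sqrt_nonneg _)
      (intervalIntegral.integral_nonneg (by linarith) fun _ _ => Real.sqrt_nonneg _)
  suffices h : distPerimeter E = ENNReal.ofReal (arcLength a x' y' + arcLength b z' w') by
    rw [h, ENNReal.toReal_ofReal hlen]
  apply le_antisymm
  · refine iSup_le fun T => iSup_le fun hT => iSup_le fun hTc => iSup_le fun hT1 => ?_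
    apply ENNReal.ofReal_le_ofReal
    rw [hE T hT hTc]
    have h1 := (le_abs_self _).trans_eq ((abs_mul τ₁ (flux T a x x' y y')).trans
      (by rw [hτ₁, one_mul]))
    have h2 := (le_abs_self _).trans_eq ((abs_mul τ₂ (flux T b z z' w w')).trans
      (by rw [hτ₂, one_mul]))
    have h3 := hx.abs_flux_le ha hy hT1
    have h4 := hz.abs_flux_le hb hw hT1
    linarith
  · refine ENNReal.le_of_forall_pos_le_add fun δ hδ _ => ?_
    obtain ⟨T, hT, hTc, hT1, hlt⟩ := exists_lt_flux_add_flux ha hb hτ₁ hτ₂ hx hy hz hw hreg₁ hreg₂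
      hi₁ hi₂ hdisj (c := arcLength a x' y' + arcLength b z' w' - δ)
      (by have : (0 : ℝ) < δ := hδ
          linarith)
    have h1 : ENNReal.ofReal (∫ p in E, divergence T p) ≤ distPerimeter E :=
      le_iSup_of_le T (le_iSup_of_le hT (le_iSup_of_le hTc (le_iSup_of_le hT1 le_rfl)))
    rw [hE T hT hTc] at h1
    calc ENNReal.ofReal (arcLength a x' y' + arcLength b z' w')
        ≤ ENNReal.ofReal ((τ₁ * flux T a x x' y y' + τ₂ * flux T b z z' w w') + δ) :=
          ENNReal.ofReal_le_ofReal (by linarith)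
      _ ≤ ENNReal.ofReal (τ₁ * flux T a x x' y y' + τ₂ * flux T b z z' w w') +
          ENNReal.ofReal δ := ENNReal.ofReal_add_le
      _ ≤ distPerimeter E + δ := by
          rw [ENNReal.ofReal_coe_nnreal]
          exact add_le_add h1 le_rfl

/-! ### Area and perimeter of a double bubble in terms of its interfaces -/

/-- Admissible interface curves of a double bubble: the polar graphs `R₁, R₂` about the poles
`p₁, p₂` on the horizontal axis, the first one with the polar axis pointing to the left, and a
common interface `(Z, Y)`, with corners at `(0, ±H)`; the common interface is seen
monotonically from both poles. -/
structure IsInterfaceSystem (θ₁ θ₂ b p₁ p₂ ρ₁ ρ₂ H : ℝ) (R₁ R₁' R₂ R₂' Z Z' Y Y' : ℝ → ℝ) :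
    Prop where
  mem₁ : θ₁ ∈ Ioo 0 Real.pi
  mem₂ : θ₂ ∈ Ioo 0 Real.pi
  b_pos : 0 < b
  deriv₁ : HasBoundedDerivOn θ₁ R₁ R₁'
  deriv₂ : HasBoundedDerivOn θ₂ R₂ R₂'
  derivZ : HasBoundedDerivOn b Z Z'
  derivY : HasBoundedDerivOn b Y Y'
  pos₁ : ∀ t ∈ Icc (-θ₁) θ₁, 0 < R₁ t
  pos₂ : ∀ t ∈ Icc (-θ₂) θ₂, 0 < R₂ t
  slit₁ : ∀ t ∈ Icc (-b) b, Y t = 0 → 0 < Z t - p₁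
  slit₂ : ∀ t ∈ Icc (-b) b, Y t = 0 → 0 < p₂ - Z t
  rot₁ : ∀ t ∈ Ioo (-b) b, 0 < (Z t - p₁) * Y' t - Y t * Z' t
  rot₂ : ∀ t ∈ Ioo (-b) b, 0 < (p₂ - Z t) * Y' t + Y t * Z' t
  left₁ : R₁ (-θ₁) = ρ₁
  right₁ : R₁ θ₁ = ρ₁
  left₂ : R₂ (-θ₂) = ρ₂
  right₂ : R₂ θ₂ = ρ₂
  leftZ : Z (-b) = 0
  rightZ : Z b = 0
  leftY : Y (-b) = -H
  rightY : Y b = H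
  sin₁ : ρ₁ * Real.sin θ₁ = H
  sin₂ : ρ₂ * Real.sin θ₂ = H
  cos₁ : p₁ = ρ₁ * Real.cos θ₁
  cos₂ : p₂ = -(ρ₂ * Real.cos θ₂)

/-- This field has unit divergence, so the Gauss–Green formulas applied to it compute areas. It is
not compactly supported, and those formulas do not ask for it. -/
theorem divergence_half_smul (x : Plane) :
    divergence (fun x : Plane => (1 / 2 : ℝ) • x) x = 1 := by
  have h : fderiv ℝ (fun x : Plane => (1 / 2 : ℝ) • x) x =
      (1 / 2 : ℝ) • ContinuousLinearMap.id ℝ Plane :=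
    ((hasFDerivAt_id x).const_smul (1 / 2 : ℝ)).fderiv
  simp only [divergence, h, Fin.sum_univ_two]
  norm_num

theorem contDiff_half_smul : ContDiff ℝ 1 (fun x : Plane => (1 / 2 : ℝ) • x) :=
  contDiff_id.const_smul _

theorem setIntegral_divergence_half_smul (E : Set Plane) :
    ∫ x in E, divergence (fun x : Plane => (1 / 2 : ℝ) • x) x = volume.real E := by
  simp_rw [divergence_half_smul]
  rw [setIntegral_const, smul_eq_mul, mul_one]

namespace HasBoundedDerivOn

variable {θ : ℝ} {R R' : ℝ → ℝ}

theorem polar_x (hR : HasBoundedDerivOn θ R R') (p η : ℝ) :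
    HasBoundedDerivOn θ (fun t => p + η * (R t * Real.cos t))
      (fun t => η * (R' t * Real.cos t + R t * -Real.sin t)) :=
  ((hR.mul (hasBoundedDerivOn_cos θ)).const_mul η).const_add p

theorem polar_y (hR : HasBoundedDerivOn θ R R') :
    HasBoundedDerivOn θ (fun t => R t * Real.sin t)
      (fun t => R' t * Real.sin t + R t * Real.cos t) :=
  hR.mul (hasBoundedDerivOn_sin θ)

theorem integral_deriv_eq_sub {f f' : ℝ → ℝ} (hθ : 0 < θ) (hf : HasBoundedDerivOn θ f f') :
    ∫ t in (-θ)..θ, f' t = f θ - f (-θ) := by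
  obtain ⟨M, hM⟩ := hf.bounded_deriv
  exact intervalIntegral.integral_eq_sub_of_hasDerivAt_of_le (by linarith) hf.continuousOn
    hf.hasDerivAt (intervalIntegrable_of_continuousOn_Ioo (M := M) (by linarith)
      hf.continuousOn_deriv hM)

/-- The area swept from the pole, plus a term for moving the pole to p: the latter is an exact
derivative and depends only on the heights of the end points. -/
theorem flux_polar (hθ : 0 < θ) (hR : HasBoundedDerivOn θ R R') (p η : ℝ) :
    flux (fun x : Plane => (1 / 2 : ℝ) • x) θ (fun t => p + η * (R t * Real.cos t))
      (fun t => η * (R' t * Real.cos t + R t * -Real.sin t)) (fun t => R t * Real.sin t)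
      (fun t => R' t * Real.sin t + R t * Real.cos t) =
      η * ((∫ t in (-θ)..θ, R t ^ 2) / 2) + p * ((R θ + R (-θ)) * Real.sin θ / 2) := by
  have hy := hR.polar_y
  have i1 : IntervalIntegrable (fun t => R t ^ 2) volume (-θ) θ := by
    apply ContinuousOn.intervalIntegrable
    rw [uIcc_of_le (by linarith)]
    exact hR.continuousOn.pow 2
  have i2 : IntervalIntegrable (fun t => R' t * Real.sin t + R t * Real.cos t) volume (-θ) θ := by
    obtain ⟨M, hM⟩ := hy.bounded_deriv
    exact intervalIntegrable_of_continuousOn_Ioo (M := M) (by linarith) hy.continuousOn_deriv hM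
  have e := hy.integral_deriv_eq_sub hθ
  have h : ∀ t, ((1 / 2 : ℝ) • (!₂[p + η * (R t * Real.cos t), R t * Real.sin t] : Plane)) 0 *
      (R' t * Real.sin t + R t * Real.cos t) -
      ((1 / 2 : ℝ) • (!₂[p + η * (R t * Real.cos t), R t * Real.sin t] : Plane)) 1 *
      (η * (R' t * Real.cos t + R t * -Real.sin t)) =
      (η / 2) * R t ^ 2 + (p / 2) * (R' t * Real.sin t + R t * Real.cos t) := by
    intro t
    simp only [PiLp.smul_apply, smul_eq_mul, Matrix.cons_val_zero, Matrix.cons_val_one]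
    linear_combination (η / 2 * R t ^ 2) * Real.sin_sq_add_cos_sq t
  rw [flux]
  simp only [h]
  rw [intervalIntegral.integral_add (i1.const_mul _) (i2.const_mul _),
    intervalIntegral.integral_const_mul, intervalIntegral.integral_const_mul, e, Real.sin_neg]
  ring

theorem arcLength_polar {η : ℝ} (hη : η * η = 1) (R R' : ℝ → ℝ) (θ : ℝ) :
    arcLength θ (fun t => η * (R' t * Real.cos t + R t * -Real.sin t))
      (fun t => R' t * Real.sin t + R t * Real.cos t) =
      ∫ t in (-θ)..θ, √(R t ^ 2 + R' t ^ 2) := by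
  rw [arcLength]
  refine intervalIntegral.integral_congr fun t _ => congrArg Real.sqrt ?_
  linear_combination ((R' t * Real.cos t + R t * -Real.sin t) ^ 2) * hη +
    (R t ^ 2 + R' t ^ 2) * Real.sin_sq_add_cos_sq t

theorem polar_regular {η r r' : ℝ} (hη : η * η = 1) (hr : 0 < r) (t : ℝ) :
    0 < (η * (r' * Real.cos t + r * -Real.sin t)) ^ 2 + (r' * Real.sin t + r * Real.cos t) ^ 2 := by
  have : (η * (r' * Real.cos t + r * -Real.sin t)) ^ 2 + (r' * Real.sin t + r * Real.cos t) ^ 2 =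
      r ^ 2 + r' ^ 2 := by
    linear_combination ((r' * Real.cos t + r * -Real.sin t) ^ 2) * hη +
      (r ^ 2 + r' ^ 2) * Real.sin_sq_add_cos_sq t
  rw [this]
  positivity

theorem polar_injOn {p η : ℝ} (hη : η * η = 1) (hθ : θ ≤ Real.pi)
    (hpos : ∀ t ∈ Icc (-θ) θ, 0 < R t) :
    InjOn (fun t => (!₂[p + η * (R t * Real.cos t), R t * Real.sin t] : Plane)) (Ioo (-θ) θ) := by
  intro s hs t ht h
  have hη0 : η ≠ 0 := by rintro rfl; simp at hη
  have h0 := congrArg (fun v : Plane => v 0) h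
  have h1 := congrArg (fun v : Plane => v 1) h
  simp only [Matrix.cons_val_zero, Matrix.cons_val_one] at h0 h1
  refine (polar_unique (hpos s (Ioo_subset_Icc_self hs)) (hpos t (Ioo_subset_Icc_self ht))
    ⟨by linarith [hs.1], by linarith [hs.2]⟩ ⟨by linarith [ht.1], by linarith [ht.2]⟩ ?_ h1).1
  exact mul_left_cancel₀ hη0 (add_left_cancel h0)

end HasBoundedDerivOn

namespace IsInterfaceSystem

variable {θ₁ θ₂ b p₁ p₂ ρ₁ ρ₂ H : ℝ} {R₁ R₁' R₂ R₂' Z Z' Y Y' : ℝ → ℝ}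

theorem regular (D : IsInterfaceSystem θ₁ θ₂ b p₁ p₂ ρ₁ ρ₂ H R₁ R₁' R₂ R₂' Z Z' Y Y') :
    ∀ t ∈ Ioo (-b) b, 0 < Z' t ^ 2 + Y' t ^ 2 := by
  intro t ht
  have h := D.rot₁ t ht
  by_contra hn
  have h1 : Z' t = 0 := by nlinarith [sq_nonneg (Z' t), sq_nonneg (Y' t)]
  have h2 : Y' t = 0 := by nlinarith [sq_nonneg (Z' t), sq_nonneg (Y' t)]
  rw [h1, h2] at h
  simp at h

/-- The angle of the common interface about the first pole is strictly monotone, so no point is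
visited twice. -/
theorem injOn (D : IsInterfaceSystem θ₁ θ₂ b p₁ p₂ ρ₁ ρ₂ H R₁ R₁' R₂ R₂' Z Z' Y Y') :
    InjOn (fun t => (!₂[Z t, Y t] : Plane)) (Ioo (-b) b) := by
  have hρ : 0 < ρ₁ := D.right₁ ▸ D.pos₁ θ₁ ⟨by linarith [D.mem₁.1], le_rfl⟩
  have hX : HasBoundedDerivOn b (fun t => Z t - p₁) Z' := by
    have := D.derivZ.const_add (-p₁)
    simpa only [neg_add_eq_sub] using this
  obtain ⟨α, hα, hr, hp⟩ := exists_angle (ψ := Real.pi - θ₁) D.b_pos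
    ⟨by linarith [D.mem₁.2], by linarith [D.mem₁.1]⟩ hX D.derivY D.slit₁ D.rot₁ hρ hρ
    (by rw [D.leftZ, D.cos₁, Real.cos_pi_sub]; ring) (by rw [D.leftY, Real.sin_pi_sub, D.sin₁])
    (by rw [D.rightZ, D.cos₁, Real.cos_pi_sub]; ring) (by rw [D.rightY, Real.sin_pi_sub, D.sin₁])
  have hmem : ∀ t ∈ Icc (-b) b, α t ∈ Ioc (-Real.pi) Real.pi := fun t ht => by
    have h : α t ∈ Icc (-(Real.pi - θ₁)) (Real.pi - θ₁) := hr ▸ mem_image_of_mem α ht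
    exact ⟨by linarith [h.1, D.mem₁.1], by linarith [h.2, D.mem₁.1]⟩
  intro s hs t ht h
  have hs' := Ioo_subset_Icc_self hs
  have ht' := Ioo_subset_Icc_self ht
  have h0 : Z s = Z t := by simpa using congrArg (fun v : Plane => v 0) h
  have h1 : Y s = Y t := by simpa using congrArg (fun v : Plane => v 1) h
  obtain ⟨q, hq, e1, e2⟩ := hp s hs'
  obtain ⟨q', hq', e3, e4⟩ := hp t ht'
  exact hα.injOn hs' ht' (polar_unique hq hq' (hmem s hs') (hmem t ht')
    (by rw [← e1, ← e3, h0]) (by rw [← e2, ← e4, h1])).1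

variable {E : DoubleBubble}

/-- Gauss–Green formulas in the two chambers. -/
theorem setIntegral_divergence
    (D : IsInterfaceSystem θ₁ θ₂ b p₁ p₂ ρ₁ ρ₂ H R₁ R₁' R₂ R₂' Z Z' Y Y')
    (hE : E.HasInterfaces
      ((fun t => (!₂[p₁ + -1 * (R₁ t * Real.cos t), R₁ t * Real.sin t] : Plane)) '' Ioo (-θ₁) θ₁)
      ((fun t => (!₂[p₂ + 1 * (R₂ t * Real.cos t), R₂ t * Real.sin t] : Plane)) '' Ioo (-θ₂) θ₂)
      ((fun t => (!₂[Z t, Y t] : Plane)) '' Icc (-b) b))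
    {T : Plane → Plane} (hT : ContDiff ℝ 1 T) :
    ∫ x in E.chamber₁, divergence T x =
      -flux T θ₁ (fun t => p₁ + -1 * (R₁ t * Real.cos t))
          (fun t => -1 * (R₁' t * Real.cos t + R₁ t * -Real.sin t))
          (fun t => R₁ t * Real.sin t) (fun t => R₁' t * Real.sin t + R₁ t * Real.cos t) +
        flux T b Z Z' Y Y' ∧
    ∫ x in E.chamber₂, divergence T x =
      flux T θ₂ (fun t => p₂ + 1 * (R₂ t * Real.cos t))
          (fun t => 1 * (R₂' t * Real.cos t + R₂ t * -Real.sin t))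
          (fun t => R₂ t * Real.sin t) (fun t => R₂' t * Real.sin t + R₂ t * Real.cos t) -
        flux T b Z Z' Y Y' := by
  have hX₁ : HasBoundedDerivOn b (fun t => Z t - p₁) Z' := by
    simpa only [neg_add_eq_sub] using D.derivZ.const_add (-p₁)
  have hX₂ : HasBoundedDerivOn b (fun t => p₂ - Z t) (fun t => -1 * Z' t) := by
    simpa only [neg_one_mul, ← sub_eq_add_neg] using (D.derivZ.const_mul (-1)).const_add p₂
  have z₁ : ∀ t, p₁ + - -1 * (Z t - p₁) = Z t := fun t => by ring
  have z₂ : ∀ t, p₂ + -1 * (p₂ - Z t) = Z t := fun t => by ring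
  have w₁ : ∀ t, - -1 * Z' t = Z' t := fun t => by ring
  have w₂ : ∀ t, -1 * (-1 * Z' t) = Z' t := fun t => by ring
  have f₁ : frontier E.chamber₁ =
      ((fun t => (!₂[p₁ + -1 * (R₁ t * Real.cos t), R₁ t * Real.sin t] : Plane)) '' Ioo (-θ₁) θ₁) ∪
      ((fun t => (!₂[Z t, Y t] : Plane)) '' Icc (-b) b) := by
    rw [← hE.left, ← hE.common, sdiff_union_inter]
  have f₂ : frontier E.chamber₂ =
      ((fun t => (!₂[p₂ + 1 * (R₂ t * Real.cos t), R₂ t * Real.sin t] : Plane)) '' Ioo (-θ₂) θ₂) ∪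
      ((fun t => (!₂[Z t, Y t] : Plane)) '' Icc (-b) b) := by
    rw [← hE.right, ← hE.common, inter_comm, sdiff_union_inter]
  have g₁ := setIntegral_divergence_of_frontier (E := E.chamber₁) (η := -1) (p := p₁) (by norm_num)
    D.mem₁ D.b_pos D.deriv₁ D.pos₁ hX₁ D.derivY D.slit₁ D.rot₁
    (by rw [D.leftZ, D.left₁, D.cos₁]; ring) (by rw [D.leftY, D.left₁, D.sin₁])
    (by rw [D.rightZ, D.right₁, D.cos₁]; ring) (by rw [D.rightY, D.right₁, D.sin₁])
    (by simpa only [z₁] using f₁) E.volume_pos₁ E.volume_lt_top₁ hT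
  have g₂ := setIntegral_divergence_of_frontier (E := E.chamber₂) (η := 1) (p := p₂) (by norm_num)
    D.mem₂ D.b_pos D.deriv₂ D.pos₂ hX₂ D.derivY D.slit₂
    (fun t ht => by have := D.rot₂ t ht; linarith)
    (by rw [D.leftZ, D.left₂, D.cos₂]; ring) (by rw [D.leftY, D.left₂, D.sin₂])
    (by rw [D.rightZ, D.right₂, D.cos₂]; ring) (by rw [D.rightY, D.right₂, D.sin₂])
    (by simpa only [z₂] using f₂) E.volume_pos₂ E.volume_lt_top₂ hT
  simp only [z₁, w₁] at g₁
  simp only [z₂, w₂] at g₂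
  exact ⟨by rw [g₁]; ring, by rw [g₂]; ring⟩

theorem vol_eq
    (D : IsInterfaceSystem θ₁ θ₂ b p₁ p₂ ρ₁ ρ₂ H R₁ R₁' R₂ R₂' Z Z' Y Y')
    (hE : E.HasInterfaces
      ((fun t => (!₂[p₁ + -1 * (R₁ t * Real.cos t), R₁ t * Real.sin t] : Plane)) '' Ioo (-θ₁) θ₁)
      ((fun t => (!₂[p₂ + 1 * (R₂ t * Real.cos t), R₂ t * Real.sin t] : Plane)) '' Ioo (-θ₂) θ₂)
      ((fun t => (!₂[Z t, Y t] : Plane)) '' Icc (-b) b)) :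
    E.vol.1 = (∫ t in (-θ₁)..θ₁, R₁ t ^ 2) / 2 - p₁ * H +
      flux (fun x : Plane => (1 / 2 : ℝ) • x) b Z Z' Y Y' ∧
    E.vol.2 = (∫ t in (-θ₂)..θ₂, R₂ t ^ 2) / 2 + p₂ * H -
      flux (fun x : Plane => (1 / 2 : ℝ) • x) b Z Z' Y Y' := by
  obtain ⟨g₁, g₂⟩ := D.setIntegral_divergence hE contDiff_half_smul
  rw [setIntegral_divergence_half_smul] at g₁ g₂
  rw [D.deriv₁.flux_polar D.mem₁.1, D.left₁, D.right₁] at g₁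
  rw [D.deriv₂.flux_polar D.mem₂.1, D.left₂, D.right₂] at g₂
  constructor
  · change volume.real E.chamber₁ = _
    rw [g₁, ← D.sin₁]; ring
  · change volume.real E.chamber₂ = _
    rw [g₂, ← D.sin₂]; ring

/-- Each interface borders exactly two of the three chambers, so the factor 1/2 in the definition of
the perimeter counts its length once. -/
theorem perimeter_eq
    (D : IsInterfaceSystem θ₁ θ₂ b p₁ p₂ ρ₁ ρ₂ H R₁ R₁' R₂ R₂' Z Z' Y Y')
    (hE : E.HasInterfaces
      ((fun t => (!₂[p₁ + -1 * (R₁ t * Real.cos t), R₁ t * Real.sin t] : Plane)) '' Ioo (-θ₁) θ₁)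
      ((fun t => (!₂[p₂ + 1 * (R₂ t * Real.cos t), R₂ t * Real.sin t] : Plane)) '' Ioo (-θ₂) θ₂)
      ((fun t => (!₂[Z t, Y t] : Plane)) '' Icc (-b) b)) :
    E.perimeter = arcLength b Z' Y' + (∫ t in (-θ₁)..θ₁, √(R₁ t ^ 2 + R₁' t ^ 2)) +
      ∫ t in (-θ₂)..θ₂, √(R₂ t ^ 2 + R₂' t ^ 2) := by
  have n1 : (-1 : ℝ) * -1 = 1 := by norm_num
  have n2 : (1 : ℝ) * 1 = 1 := by norm_num
  have a1 : |(-1 : ℝ)| = 1 := by norm_num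
  have a2 : |(1 : ℝ)| = 1 := by norm_num
  have s : Ioo (-b) b ⊆ Icc (-b) b := Ioo_subset_Icc_self
  have hi₁ := HasBoundedDerivOn.polar_injOn (p := p₁) n1 D.mem₁.2.le D.pos₁
  have hi₂ := HasBoundedDerivOn.polar_injOn (p := p₂) n2 D.mem₂.2.le D.pos₂
  have r₁ := fun t (ht : t ∈ Ioo (-θ₁) θ₁) =>
    HasBoundedDerivOn.polar_regular (r' := R₁' t) n1 (D.pos₁ t (Ioo_subset_Icc_self ht)) t
  have r₂ := fun t (ht : t ∈ Ioo (-θ₂) θ₂) =>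
    HasBoundedDerivOn.polar_regular (r' := R₂' t) n2 (D.pos₂ t (Ioo_subset_Icc_self ht)) t
  have m₁ : ∀ t ∈ Ioo (-θ₁) θ₁,
      (!₂[p₁ + -1 * (R₁ t * Real.cos t), R₁ t * Real.sin t] : Plane) ∈
        frontier E.chamber₁ \ frontier E.chamber₂ := fun t ht => by
    rw [hE.left]; exact mem_image_of_mem _ ht
  have m₂ : ∀ t ∈ Ioo (-θ₂) θ₂,
      (!₂[p₂ + 1 * (R₂ t * Real.cos t), R₂ t * Real.sin t] : Plane) ∈
        frontier E.chamber₂ \ frontier E.chamber₁ := fun t ht => by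
    rw [hE.right]; exact mem_image_of_mem _ ht
  have m₀ : ∀ t ∈ Ioo (-b) b, (!₂[Z t, Y t] : Plane) ∈
      frontier E.chamber₁ ∩ frontier E.chamber₂ := fun t ht => by
    rw [hE.common]; exact mem_image_of_mem _ (s ht)
  have q₁ := distPerimeter_eq_of_flux (E := E.chamber₁) (τ₁ := -1) (τ₂ := 1) D.mem₁.1 D.b_pos a1 a2
    (D.deriv₁.polar_x p₁ (-1)) D.deriv₁.polar_y D.derivZ D.derivY r₁ D.regular hi₁ D.injOn
    (fun i hi j hj e => (m₁ i hi).2 (e ▸ (m₀ j hj).2))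
    (fun T hT _ => by rw [(D.setIntegral_divergence hE hT).1]; ring)
  have q₂ := distPerimeter_eq_of_flux (E := E.chamber₂) (τ₁ := 1) (τ₂ := -1) D.mem₂.1 D.b_pos a2 a1
    (D.deriv₂.polar_x p₂ 1) D.deriv₂.polar_y D.derivZ D.derivY r₂ D.regular hi₂ D.injOn
    (fun i hi j hj e => (m₂ i hi).2 (e ▸ (m₀ j hj).1))
    (fun T hT _ => by rw [(D.setIntegral_divergence hE hT).2]; ring)
  -- The divergence of a compactly supported field has zero integral over the plane. The exterior
  -- integral is therefore minus the sum over the chambers, in which the flux through the common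
  -- interface cancels.
  have q₀ := distPerimeter_eq_of_flux (E := E.exterior) (τ₁ := 1) (τ₂ := -1) D.mem₁.1 D.mem₂.1 a2 a1
    (D.deriv₁.polar_x p₁ (-1)) D.deriv₁.polar_y (D.deriv₂.polar_x p₂ 1) D.deriv₂.polar_y r₁ r₂
    hi₁ hi₂ (fun i hi j hj e => (m₁ i hi).2 (e ▸ (m₂ j hj).1))
    (fun T hT hTc => by
      have hint := integrable_divergence hT hTc
      obtain ⟨g₁, g₂⟩ := D.setIntegral_divergence hE hT
      rw [DoubleBubble.exterior, setIntegral_compl₀ (E.measurable₁.union E.measurable₂) hint,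
        setIntegral_union₀ E.disjoint E.measurable₂ hint.integrableOn hint.integrableOn,
        integral_divergence_eq_zero hT hTc, g₁, g₂]
      ring)
  rw [HasBoundedDerivOn.arcLength_polar n1] at q₁ q₀
  rw [HasBoundedDerivOn.arcLength_polar n2] at q₂ q₀
  rw [DoubleBubble.perimeter, q₁, q₂, q₀]
  ring

end IsInterfaceSystem

/-! ### Perturbed double bubbles -/

theorem IsC1ZeroLe.hasBoundedDerivOn {a ε : ℝ} {u : ℝ → ℝ} (hu : IsC1ZeroLe a ε u) :
    HasBoundedDerivOn a u (deriv u) :=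
  ⟨hu.continuousOn, fun _ ht => hu.hasDerivAt ht, hu.continuousOn_deriv, ε, hu.abs_deriv_le⟩

theorem IsC1ZeroLe.zero (a : ℝ) : IsC1ZeroLe a 0 (fun _ => 0) :=
  ⟨continuousOn_const, contDiffOn_const, rfl, rfl, fun _ _ => by simp, fun _ _ => by simp⟩

theorem IsC1ZeroLe.hasBoundedDerivOn_radius {a ε : ℝ} {u : ℝ → ℝ} (hu : IsC1ZeroLe a ε u) (ρ : ℝ) :
    HasBoundedDerivOn a (fun t => ρ * (1 + u t)) (fun t => ρ * deriv u t) :=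
  (hu.hasBoundedDerivOn.const_add 1).const_mul ρ

theorem leftArc_eq (σ r θ : ℝ) (s : Set ℝ) (u : ℝ → ℝ) :
    leftArc σ r θ s u =
      (fun t => (!₂[(1 + σ) * r * Real.cos θ + -1 * ((1 + σ) * r * (1 + u t) * Real.cos t),
        (1 + σ) * r * (1 + u t) * Real.sin t] : Plane)) '' s := by
  rw [leftArc, perturbedArc, image_image]
  refine image_congr fun t _ => ?_
  ext i
  fin_cases i <;> simp [leftIsometry] <;> ring

theorem rightArc_eq (σ r θ : ℝ) (s : Set ℝ) (u : ℝ → ℝ) :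
    rightArc σ r θ s u =
      (fun t => (!₂[-((1 + σ) * r * Real.cos θ) + 1 * ((1 + σ) * r * (1 + u t) * Real.cos t),
        (1 + σ) * r * (1 + u t) * Real.sin t] : Plane)) '' s := by
  rw [rightArc, perturbedArc, image_image]
  refine image_congr fun t _ => ?_
  ext i
  fin_cases i <;> simp [rightIsometry] <;> ring

theorem midSegment_eq (σ r : ℝ) (s : Set ℝ) (v : ℝ → ℝ) :
    midSegment σ r s v =
      (fun t => (!₂[(1 + σ) * r * v t, (1 + σ) * r * t] : Plane)) '' s := by
  rw [midSegment, perturbedSegment, image_image]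
  refine image_congr fun t _ => ?_
  ext i
  fin_cases i <;> simp <;> ring

/-- With `f = 1 + u`, `w = u'` and S, C the sine and cosine of the parameter, this is the rotation
of the perturbed common arc about a pole at distance l from its centre, for unit radius. The
unperturbed value `1 - l C` is positive because the pole is inside the circle. -/
theorem rotation_pos_of_lt_one {l ε f w S C : ℝ} (hl : 0 < l) (hl1 : l < 1) (hε : 0 ≤ ε)
    (hεl : ε ≤ (1 - l) / 4) (hf : 1 - ε ≤ f) (hw : |w| ≤ ε) (hSC : S ^ 2 + C ^ 2 = 1) :
    0 < f ^ 2 - l * (f * C + w * S) := by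
  have hf0 : 0 < f := by linarith
  have hC : C ≤ 1 := by nlinarith
  have hS : |S| ≤ 1 := abs_le_one_iff_mul_self_le_one.2 (by nlinarith)
  have h1 : f * C ≤ f := by nlinarith
  have h2 : w * S ≤ ε := (le_abs_self _).trans (by
    rw [abs_mul]
    exact (mul_le_mul hw hS (abs_nonneg _) hε).trans_eq (mul_one _))
  have h3 : l * (f * C + w * S) ≤ l * (f + ε) := mul_le_mul_of_nonneg_left (by linarith) hl.le
  have h4 : 3 / 4 * (1 - l) ≤ f - l := by linarith
  have h5 : 3 / 4 ≤ f := by linarith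
  have h6 : 3 / 4 * (3 / 4 * (1 - l)) ≤ f * (f - l) :=
    mul_le_mul h5 h4 (by linarith) hf0.le
  have h7 : l * ε ≤ ε := by nlinarith
  nlinarith

/-- The same rotation about a pole on the other side, at distance μ outside the circle. The
unperturbed value `μ C - 1` is positive when the arc lies within the part visible from the pole; C₀
is the least cosine along the arc and ν the margin there. -/
theorem rotation_pos_of_one_lt {μ ν ε f w S C C₀ : ℝ} (hμ : 0 < μ) (hν : 0 < ν)
    (hC₀ : μ * C₀ = 1 + ν) (hC : C₀ ≤ C) (hε : 0 ≤ ε) (hε1 : ε ≤ 1 / 2)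
    (hεν : ε * (4 * (1 + μ)) ≤ ν) (hf : 1 - ε ≤ f) (hf' : f ≤ 1 + ε) (hw : |w| ≤ ε)
    (hSC : S ^ 2 + C ^ 2 = 1) :
    0 < μ * (f * C + w * S) - f ^ 2 := by
  have hf0 : 1 / 2 ≤ f := by linarith
  have hS : |S| ≤ 1 := abs_le_one_iff_mul_self_le_one.2 (by nlinarith)
  have h2 : -ε ≤ w * S := by
    have : |w * S| ≤ ε := by
      rw [abs_mul]
      exact (mul_le_mul hw hS (abs_nonneg _) hε).trans_eq (mul_one _)
    exact (abs_le.1 this).1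
  have h3 : 1 + ν ≤ μ * C := hC₀ ▸ mul_le_mul_of_nonneg_left hC hμ.le
  have h4 : f * (1 + ν) ≤ f * (μ * C) := mul_le_mul_of_nonneg_left h3 (by linarith)
  have h5 : μ * -ε ≤ μ * (w * S) := mul_le_mul_of_nonneg_left h2 hμ.le
  have h7 : ε * μ ≤ ν / 4 := by nlinarith
  have h8 : ε ≤ ν / 4 := by nlinarith
  have h6 : 1 / 2 * (3 / 4 * ν) ≤ f * (1 + ν - f) :=
    mul_le_mul hf0 (by linarith) (by linarith) (by linarith)
  nlinarith

/-- Radii and half-apertures of three circular arcs meeting at 120 degrees. -/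
structure IsBubbleTriple (φ ρ₀ ρ₁ ρ₂ : ℝ) : Prop where
  pos₀ : 0 < ρ₀
  pos₁ : 0 < ρ₁
  pos₂ : 0 < ρ₂
  sin₁ : ρ₁ * Real.sin (2 * Real.pi / 3 - φ) = ρ₀ * Real.sin φ
  sin₂ : ρ₂ * Real.sin (2 * Real.pi / 3 + φ) = ρ₀ * Real.sin φ

namespace IsBubbleTriple

variable {φ ρ₀ ρ₁ ρ₂ : ℝ}

/-- The left side is the distance between the centres of the common arc and of the smaller chamber's
exterior arc; the sine rule evaluates it, since the two apertures add up to `2π/3`. -/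
theorem add_cos (h : IsBubbleTriple φ ρ₀ ρ₁ ρ₂) (hs : 0 < Real.sin (2 * Real.pi / 3 - φ)) :
    ρ₀ * Real.cos φ + ρ₁ * Real.cos (2 * Real.pi / 3 - φ) =
      ρ₀ * (√3 / 2 / Real.sin (2 * Real.pi / 3 - φ)) := by
  have e := Real.sin_add (2 * Real.pi / 3 - φ) φ
  rw [sub_add_cancel, Real.sin_two_pi_div_three] at e
  rw [e, mul_div_assoc', eq_div_iff hs.ne']
  linear_combination Real.cos (2 * Real.pi / 3 - φ) * h.sin₁

theorem sub_cos (h : IsBubbleTriple φ ρ₀ ρ₁ ρ₂) (hs : 0 < Real.sin (2 * Real.pi / 3 + φ)) :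
    ρ₀ * Real.cos φ - ρ₂ * Real.cos (2 * Real.pi / 3 + φ) =
      ρ₀ * (√3 / 2 / Real.sin (2 * Real.pi / 3 + φ)) := by
  have e := Real.sin_sub (2 * Real.pi / 3 + φ) φ
  rw [add_sub_cancel_right, Real.sin_two_pi_div_three] at e
  rw [e, mul_div_assoc', eq_div_iff hs.ne']
  linear_combination -Real.cos (2 * Real.pi / 3 + φ) * h.sin₂

end IsBubbleTriple

/-- Small perturbations of the arcs of a standard double bubble are admissible interfaces. -/
theorem exists_isInterfaceSystem_arc {φ : ℝ} (hφ : φ ∈ Ioo 0 (Real.pi / 3)) :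
    ∃ ε₁ > (0 : ℝ), ∀ (ε ρ₀ ρ₁ ρ₂ : ℝ) (u₀ u₁ u₂ : ℝ → ℝ), IsBubbleTriple φ ρ₀ ρ₁ ρ₂ → ε ≤ ε₁ →
      IsC1ZeroLe φ ε u₀ → IsC1ZeroLe (2 * Real.pi / 3 - φ) ε u₁ →
      IsC1ZeroLe (2 * Real.pi / 3 + φ) ε u₂ →
      IsInterfaceSystem (2 * Real.pi / 3 - φ) (2 * Real.pi / 3 + φ) φ
        (ρ₁ * Real.cos (2 * Real.pi / 3 - φ)) (-(ρ₂ * Real.cos (2 * Real.pi / 3 + φ))) ρ₁ ρ₂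
        (ρ₀ * Real.sin φ) (fun t => ρ₁ * (1 + u₁ t)) (fun t => ρ₁ * deriv u₁ t)
        (fun t => ρ₂ * (1 + u₂ t)) (fun t => ρ₂ * deriv u₂ t)
        (fun t => -(ρ₀ * Real.cos φ) + 1 * (ρ₀ * (1 + u₀ t) * Real.cos t))
        (fun t => 1 * (ρ₀ * deriv u₀ t * Real.cos t + ρ₀ * (1 + u₀ t) * -Real.sin t))
        (fun t => ρ₀ * (1 + u₀ t) * Real.sin t)
        (fun t => ρ₀ * deriv u₀ t * Real.sin t + ρ₀ * (1 + u₀ t) * Real.cos t) := by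
  obtain ⟨hφ0, hφ1⟩ := hφ
  have hπ := Real.pi_pos
  have h3 : (0 : ℝ) < √3 := by positivity
  have m₁ : 2 * Real.pi / 3 - φ ∈ Ioo 0 Real.pi := ⟨by linarith, by linarith⟩
  have m₂ : 2 * Real.pi / 3 + φ ∈ Ioo 0 Real.pi := ⟨by linarith, by linarith⟩
  have hs₁ := Real.sin_pos_of_pos_of_lt_pi m₁.1 m₁.2
  have hs₂ := Real.sin_pos_of_pos_of_lt_pi m₂.1 m₂.2
  have hs₀ := Real.sin_pos_of_pos_of_lt_pi hφ0 (by linarith)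
  have hc₀ : 1 / 2 < Real.cos φ := by
    rw [← Real.cos_pi_div_three]
    exact Real.cos_lt_cos_of_nonneg_of_le_pi hφ0.le (by linarith) hφ1
  have hsq3 : √3 ^ 2 = 3 := Real.sq_sqrt (by norm_num)
  have hsc := Real.sin_sq_add_cos_sq φ
  -- Distances of the two poles from the centre of the common arc, in units of its radius. `l < 1`
  -- since `sin (2π/3 - φ)` exceeds `√3/2` on this range, and `μ cos φ > 1` since `sin (2π/3 + φ) <
  -- (√3/2) cos φ`.
  set l := √3 / 2 / Real.sin (2 * Real.pi / 3 - φ) with hl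
  set μ := √3 / 2 / Real.sin (2 * Real.pi / 3 + φ) with hμ
  set ν := μ * Real.cos φ - 1 with hν
  have hl0 : 0 < l := by positivity
  have hμ0 : 0 < μ := by positivity
  have hl1 : l < 1 := by
    rw [hl, div_lt_one hs₁, ← Real.sin_two_pi_div_three, Real.sin_sub, Real.sin_two_pi_div_three,
      Real.cos_two_pi_div_three]
    have hsu : Real.sin φ < √3 / 2 := by
      rw [← Real.sin_pi_div_three]
      exact Real.sin_lt_sin_of_lt_of_le_pi_div_two (by linarith) (by linarith) hφ1
    have h5 : 0 < Real.sin φ * (1 + Real.cos φ - √3 * Real.sin φ) := mul_pos hs₀ (by nlinarith)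
    have h6 : (1 + Real.cos φ) *
        (√3 / 2 * Real.cos φ - -(1 / 2) * Real.sin φ - √3 / 2) =
        Real.sin φ * (1 + Real.cos φ - √3 * Real.sin φ) / 2 := by
      linear_combination (√3 / 2) * hsc
    have h7 := pos_of_mul_pos_right (h6 ▸ half_pos h5) (by linarith)
    linarith
  have hν0 : 0 < ν := by
    rw [hν, hμ, sub_pos, div_mul_eq_mul_div, one_lt_div hs₂, Real.sin_add,
      Real.sin_two_pi_div_three, Real.cos_two_pi_div_three]
    linarith
  refine ⟨min (1 / 2) (min ((1 - l) / 4) (ν / (4 * (1 + μ)))), by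
    have : 0 < (1 - l) / 4 := by linarith
    positivity, ?_⟩
  intro ε ρ₀ ρ₁ ρ₂ u₀ u₁ u₂ hρ hε hu₀ hu₁ hu₂
  have e1 : ε ≤ 1 / 2 := hε.trans (min_le_left _ _)
  have e2 : ε ≤ (1 - l) / 4 := hε.trans ((min_le_right _ _).trans (min_le_left _ _))
  have e3 : ε * (4 * (1 + μ)) ≤ ν :=
    (le_div_iff₀ (by positivity)).1 (hε.trans ((min_le_right _ _).trans (min_le_right _ _)))
  have hε0 : 0 ≤ ε := hu₀.nonneg hφ0
  have low : ∀ {a : ℝ} {u : ℝ → ℝ}, 0 < a → IsC1ZeroLe a ε u → ∀ t ∈ Icc (-a) a,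
      1 - ε ≤ 1 + u t := fun ha hu t ht => by
    have := (abs_le.1 (hu.abs_le_Icc ha ht)).1; linarith
  have up : ∀ {a : ℝ} {u : ℝ → ℝ}, 0 < a → IsC1ZeroLe a ε u → ∀ t ∈ Icc (-a) a,
      1 + u t ≤ 1 + ε := fun ha hu t ht => by
    have := (abs_le.1 (hu.abs_le_Icc ha ht)).2; linarith
  have k1 := hρ.add_cos hs₁
  have k2 := hρ.sub_cos hs₂
  rw [← hl] at k1
  rw [← hμ] at k2
  have hp₀ := hρ.pos₀
  have slit : ∀ t ∈ Icc (-φ) φ, ρ₀ * (1 + u₀ t) * Real.sin t = 0 → t = 0 := by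
    intro t ht h
    have hf := low hφ0 hu₀ t ht
    have h1 : Real.sin t = 0 := by
      rcases mul_eq_zero.1 h with h | h
      · rcases mul_eq_zero.1 h with h | h <;> linarith
      · exact h
    exact (Real.sin_eq_zero_iff_of_lt_of_lt (by linarith [ht.1]) (by linarith [ht.2])).1 h1
  have hcosge : ∀ t ∈ Ioo (-φ) φ, Real.cos φ ≤ Real.cos t := by
    intro t ht
    rw [← Real.cos_abs t]
    exact Real.cos_le_cos_of_nonneg_of_le_pi (abs_nonneg _) (by linarith)
      (abs_le.2 ⟨ht.1.le, ht.2.le⟩)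
  refine
    { mem₁ := m₁, mem₂ := m₂, b_pos := hφ0
      deriv₁ := hu₁.hasBoundedDerivOn_radius ρ₁
      deriv₂ := hu₂.hasBoundedDerivOn_radius ρ₂
      derivZ := (hu₀.hasBoundedDerivOn_radius ρ₀).polar_x _ _
      derivY := (hu₀.hasBoundedDerivOn_radius ρ₀).polar_y
      pos₁ := fun t ht => mul_pos hρ.pos₁ (by linarith [low m₁.1 hu₁ t ht])
      pos₂ := fun t ht => mul_pos hρ.pos₂ (by linarith [low m₂.1 hu₂ t ht])
      slit₁ := ?_, slit₂ := ?_, rot₁ := ?_, rot₂ := ?_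
      left₁ := by simp only [hu₁.left_zero]; ring
      right₁ := by simp only [hu₁.right_zero]; ring
      left₂ := by simp only [hu₂.left_zero]; ring
      right₂ := by simp only [hu₂.right_zero]; ring
      leftZ := by simp only [hu₀.left_zero, Real.cos_neg]; ring
      rightZ := by simp only [hu₀.right_zero]; ring
      leftY := by simp only [hu₀.left_zero, Real.sin_neg]; ring
      rightY := by simp only [hu₀.right_zero]; ring
      sin₁ := hρ.sin₁, sin₂ := hρ.sin₂, cos₁ := rfl, cos₂ := rfl }
  · intro t ht h
    obtain rfl := slit t ht h
    have hf := low hφ0 hu₀ 0 ht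
    have : 0 < ρ₀ * (1 + u₀ 0 - l) := mul_pos hp₀ (by linarith)
    rw [Real.cos_zero]
    linarith
  · intro t ht h
    obtain rfl := slit t ht h
    have hf := up hφ0 hu₀ 0 ht
    have hμν : 1 + ν ≤ μ := by
      have : μ * Real.cos φ ≤ μ := mul_le_of_le_one_right hμ0.le (Real.cos_le_one φ)
      linarith
    have : 0 < ρ₀ * (μ - (1 + u₀ 0)) := mul_pos hp₀ (by nlinarith)
    rw [Real.cos_zero]
    linarith
  · intro t ht
    have := rotation_pos_of_lt_one hl0 hl1 hε0 e2 (low hφ0 hu₀ t (Ioo_subset_Icc_self ht))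
      (hu₀.abs_deriv_le t ht) (Real.sin_sq_add_cos_sq t)
    have h2 := mul_pos (pow_pos hp₀ 2) this
    refine h2.trans_eq ?_
    linear_combination -(ρ₀ ^ 2 * (1 + u₀ t) ^ 2) * Real.sin_sq_add_cos_sq t +
      ρ₀ * (deriv u₀ t * Real.sin t + (1 + u₀ t) * Real.cos t) * k1
  · intro t ht
    have := rotation_pos_of_one_lt hμ0 hν0 (by rw [hν]; ring) (hcosge t ht) hε0 e1 e3
      (low hφ0 hu₀ t (Ioo_subset_Icc_self ht)) (up hφ0 hu₀ t (Ioo_subset_Icc_self ht))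
      (hu₀.abs_deriv_le t ht) (Real.sin_sq_add_cos_sq t)
    have h2 := mul_pos (pow_pos hp₀ 2) this
    refine h2.trans_eq ?_
    linear_combination (ρ₀ ^ 2 * (1 + u₀ t) ^ 2) * Real.sin_sq_add_cos_sq t -
      ρ₀ * (deriv u₀ t * Real.sin t + (1 + u₀ t) * Real.cos t) * k2

/-- Small perturbations of the interfaces of a symmetric standard double bubble are admissible
interfaces. -/
theorem isInterfaceSystem_sym {ε ρ : ℝ} {v₀ u₁ u₂ : ℝ → ℝ} (hρ : 0 < ρ) (hε : ε ≤ 1 / 8)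
    (hv₀ : IsC1ZeroLe (√3 / 2) ε v₀) (hu₁ : IsC1ZeroLe (2 * Real.pi / 3) ε u₁)
    (hu₂ : IsC1ZeroLe (2 * Real.pi / 3) ε u₂) :
    IsInterfaceSystem (2 * Real.pi / 3) (2 * Real.pi / 3) (√3 / 2)
      (ρ * Real.cos (2 * Real.pi / 3)) (-(ρ * Real.cos (2 * Real.pi / 3))) ρ ρ
      (ρ * (√3 / 2)) (fun t => ρ * (1 + u₁ t)) (fun t => ρ * deriv u₁ t)
      (fun t => ρ * (1 + u₂ t)) (fun t => ρ * deriv u₂ t)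
      (fun t => ρ * v₀ t) (fun t => ρ * deriv v₀ t) (fun t => ρ * t) (fun _ => ρ * 1) := by
  have hπ := Real.pi_pos
  have h3 : (0 : ℝ) < √3 / 2 := by positivity
  have h3u : √3 / 2 < 1 := by
    have : √3 < 2 := by rw [Real.sqrt_lt' (by norm_num)]; norm_num
    linarith
  have m : 2 * Real.pi / 3 ∈ Ioo 0 Real.pi := ⟨by linarith, by linarith⟩
  have hε0 : 0 ≤ ε := hv₀.nonneg h3
  have pos : ∀ {u : ℝ → ℝ}, IsC1ZeroLe (2 * Real.pi / 3) ε u →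
      ∀ t ∈ Icc (-(2 * Real.pi / 3)) (2 * Real.pi / 3), 0 < ρ * (1 + u t) := fun hu t ht => by
    have := (abs_le.1 (hu.abs_le_Icc m.1 ht)).1
    exact mul_pos hρ (by linarith)
  have cross : ∀ t ∈ Ioo (-(√3 / 2)) (√3 / 2), |t * deriv v₀ t| ≤ 1 / 8 := by
    intro t ht
    rw [abs_mul]
    have h1 : |t| ≤ 1 := abs_le.2 ⟨by linarith [ht.1], by linarith [ht.2]⟩
    have h2 := (hv₀.abs_deriv_le t ht).trans hε
    nlinarith [abs_nonneg t, abs_nonneg (deriv v₀ t)]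
  refine
    { mem₁ := m, mem₂ := m, b_pos := h3
      deriv₁ := hu₁.hasBoundedDerivOn_radius ρ
      deriv₂ := hu₂.hasBoundedDerivOn_radius ρ
      derivZ := hv₀.hasBoundedDerivOn.const_mul ρ
      derivY := (hasBoundedDerivOn_id _).const_mul ρ
      pos₁ := pos hu₁
      pos₂ := pos hu₂
      slit₁ := ?_, slit₂ := ?_, rot₁ := ?_, rot₂ := ?_
      left₁ := by simp only [hu₁.left_zero]; ring
      right₁ := by simp only [hu₁.right_zero]; ring
      left₂ := by simp only [hu₂.left_zero]; ring
      right₂ := by simp only [hu₂.right_zero]; ring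
      leftZ := by simp only [hv₀.left_zero]; ring
      rightZ := by simp only [hv₀.right_zero]; ring
      leftY := by ring
      rightY := by ring
      sin₁ := by rw [Real.sin_two_pi_div_three]
      sin₂ := by rw [Real.sin_two_pi_div_three]
      cos₁ := rfl, cos₂ := rfl }
  · intro t ht _
    have := (abs_le.1 (hv₀.abs_le_Icc h3 ht)).1
    rw [Real.cos_two_pi_div_three]
    nlinarith
  · intro t ht _
    have := (abs_le.1 (hv₀.abs_le_Icc h3 ht)).2
    rw [Real.cos_two_pi_div_three]
    nlinarith
  · intro t ht
    have h1 := (abs_le.1 (hv₀.abs_le t ht)).1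
    have h2 := (abs_le.1 (cross t ht)).2
    rw [Real.cos_two_pi_div_three]
    have : 0 < ρ ^ 2 * (v₀ t + 1 / 2 - t * deriv v₀ t) := mul_pos (pow_pos hρ 2) (by linarith)
    refine this.trans_eq (by ring)
  · intro t ht
    have h1 := (abs_le.1 (hv₀.abs_le t ht)).2
    have h2 := (abs_le.1 (cross t ht)).1
    rw [Real.cos_two_pi_div_three]
    have : 0 < ρ ^ 2 * (1 / 2 - v₀ t + t * deriv v₀ t) := mul_pos (pow_pos hρ 2) (by linarith)
    refine this.trans_eq (by ring)

theorem IsC1ZeroLe.integral_radius_sq {a ε : ℝ} {u : ℝ → ℝ} (ha : 0 < a) (hu : IsC1ZeroLe a ε u)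
    (ρ : ℝ) : (∫ t in (-a)..a, (ρ * (1 + u t)) ^ 2) / 2 =
      ρ ^ 2 * (a + ∫ t in (-a)..a, (u t + u t ^ 2 / 2)) := by
  have h : ∀ t, (ρ * (1 + u t)) ^ 2 = ρ ^ 2 * (1 + 2 * (u t + u t ^ 2 / 2)) := fun t => by ring
  simp only [h]
  rw [intervalIntegral.integral_const_mul, intervalIntegral.integral_add
    intervalIntegrable_const ((hu.intervalIntegrable_area ha).const_mul 2),
    intervalIntegral.integral_const_mul, intervalIntegral.integral_const]
  simp only [smul_eq_mul]
  ring

theorem integral_sqrt_radius {ρ : ℝ} (hρ : 0 < ρ) (a : ℝ) (f f' : ℝ → ℝ) :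
    ∫ t in (-a)..a, √((ρ * f t) ^ 2 + (ρ * f' t) ^ 2) =
      ρ * ∫ t in (-a)..a, √(f t ^ 2 + f' t ^ 2) := by
  rw [← intervalIntegral.integral_const_mul]
  refine intervalIntegral.integral_congr fun t _ => ?_
  rw [mul_pow, mul_pow, ← mul_add, Real.sqrt_mul (by positivity), Real.sqrt_sq hρ.le]

/-- Perimeter and areas of a small perturbation of a standard double bubble. -/
theorem exists_perimeter_vol_arc {φ : ℝ} (hφ : φ ∈ Ioo 0 (Real.pi / 3)) :
    ∃ ε₁ > (0 : ℝ), ∀ (g : BubbleGeometry) (ε σ : ℝ) (u : Fin 3 → ℝ → ℝ) (E : DoubleBubble),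
      g.θ 0 = φ → ε ≤ ε₁ → -1 < σ → (∀ k, IsC1ZeroLe (g.θ k) ε (u k)) →
      HasArcInterfaces g σ u E →
      E.perimeter = (1 + σ) * ∑ k, g.r k *
        ∫ t in (-g.θ k)..(g.θ k), √((1 + u k t) ^ 2 + deriv (u k) t ^ 2) ∧
      E.vol.1 = (1 + σ) ^ 2 * ((g.r 0 * Real.sin (g.θ 0)) ^ 2 * smallArea φ +
        g.r 1 ^ 2 * (∫ t in (-g.θ 1)..(g.θ 1), (u 1 t + u 1 t ^ 2 / 2)) +
        g.r 0 ^ 2 * ∫ t in (-g.θ 0)..(g.θ 0), (u 0 t + u 0 t ^ 2 / 2)) ∧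
      E.vol.2 = (1 + σ) ^ 2 * ((g.r 0 * Real.sin (g.θ 0)) ^ 2 * largeArea φ +
        g.r 2 ^ 2 * (∫ t in (-g.θ 2)..(g.θ 2), (u 2 t + u 2 t ^ 2 / 2)) -
        g.r 0 ^ 2 * ∫ t in (-g.θ 0)..(g.θ 0), (u 0 t + u 0 t ^ 2 / 2)) := by
  obtain ⟨ε₁, hε₁, H⟩ := exists_isInterfaceSystem_arc hφ
  refine ⟨ε₁, hε₁, fun g ε σ u E h0 hε hσ hu hE => ?_⟩
  have hσ' : 0 < 1 + σ := by linarith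
  have h1 : g.θ 1 = 2 * Real.pi / 3 - φ := by have := g.angle₁; linarith
  have h2 : g.θ 2 = 2 * Real.pi / 3 + φ := by have := g.angle₂; linarith
  have u0 := hu 0
  have u1 := hu 1
  have u2 := hu 2
  have s1 := g.sin_eq₁
  have s2 := g.sin_eq₂
  have p0 := Real.sin_pos_of_pos_of_lt_pi (g.θ_pos 0) (g.θ_lt_pi 0)
  have p1 := Real.sin_pos_of_pos_of_lt_pi (g.θ_pos 1) (g.θ_lt_pi 1)
  have p2 := Real.sin_pos_of_pos_of_lt_pi (g.θ_pos 2) (g.θ_lt_pi 2)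
  have q0 := g.θ_pos 0
  have q1 := g.θ_pos 1
  have q2 := g.θ_pos 2
  rw [HasArcInterfaces, leftArc_eq, rightArc_eq, rightArc_eq] at hE
  rw [Fin.sum_univ_three]
  rw [h0] at u0 s1 s2 hE p0 q0 ⊢
  rw [h1] at u1 s1 hE p1 q1 ⊢
  rw [h2] at u2 s2 hE p2 q2 ⊢
  have triple : IsBubbleTriple φ ((1 + σ) * g.r 0) ((1 + σ) * g.r 1) ((1 + σ) * g.r 2) :=
    ⟨mul_pos hσ' (g.r_pos 0), mul_pos hσ' (g.r_pos 1), mul_pos hσ' (g.r_pos 2),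
      by rw [mul_assoc, ← s1, mul_assoc], by rw [mul_assoc, ← s2, mul_assoc]⟩
  have D := H ε _ _ _ _ _ _ triple hε u0 u1 u2
  have A0 : segmentArea φ * Real.sin φ ^ 2 = φ - Real.sin φ * Real.cos φ :=
    div_mul_cancel₀ _ (pow_pos p0 2).ne'
  have A1 : segmentArea (2 * Real.pi / 3 - φ) * Real.sin (2 * Real.pi / 3 - φ) ^ 2 =
      (2 * Real.pi / 3 - φ) - Real.sin (2 * Real.pi / 3 - φ) * Real.cos (2 * Real.pi / 3 - φ) :=
    div_mul_cancel₀ _ (pow_pos p1 2).ne'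
  have A2 : segmentArea (2 * Real.pi / 3 + φ) * Real.sin (2 * Real.pi / 3 + φ) ^ 2 =
      (2 * Real.pi / 3 + φ) - Real.sin (2 * Real.pi / 3 + φ) * Real.cos (2 * Real.pi / 3 + φ) :=
    div_mul_cancel₀ _ (pow_pos p2 2).ne'
  have hvol := D.vol_eq hE
  rw [(u0.hasBoundedDerivOn_radius _).flux_polar q0, u0.integral_radius_sq q0,
    u1.integral_radius_sq q1, u2.integral_radius_sq q2] at hvol
  have hper := D.perimeter_eq hE
  rw [HasBoundedDerivOn.arcLength_polar (by norm_num : (1 : ℝ) * 1 = 1)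
      (fun t => (1 + σ) * g.r 0 * (1 + u 0 t)) (fun t => (1 + σ) * g.r 0 * deriv (u 0) t),
    integral_sqrt_radius triple.pos₀, integral_sqrt_radius triple.pos₁,
    integral_sqrt_radius triple.pos₂] at hper
  simp only [u0.left_zero, u0.right_zero] at hvol
  refine ⟨by rw [hper]; ring, ?_, ?_⟩
  · rw [hvol.1, smallArea]
    generalize (∫ t in (-φ)..φ, (u 0 t + u 0 t ^ 2 / 2)) = B0
    generalize (∫ t in (-(2 * Real.pi / 3 - φ))..(2 * Real.pi / 3 - φ), (u 1 t + u 1 t ^ 2 / 2)) = B1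
    set a1 := segmentArea (2 * Real.pi / 3 - φ)
    -- The three arcs share one chord, so the area of the exterior segment may be written with
    -- either radius.
    have hsq : (g.r 0 * Real.sin φ) ^ 2 * a1 =
        (g.r 1 * Real.sin (2 * Real.pi / 3 - φ)) ^ 2 * a1 := by rw [s1]
    linear_combination -(1 + σ) ^ 2 * hsq - (1 + σ) ^ 2 * g.r 0 ^ 2 * A0
      - (1 + σ) ^ 2 * g.r 1 ^ 2 * A1
      - (1 + σ) ^ 2 * g.r 1 * Real.cos (2 * Real.pi / 3 - φ) * s1
  · rw [hvol.2, largeArea]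
    generalize (∫ t in (-φ)..φ, (u 0 t + u 0 t ^ 2 / 2)) = B0
    generalize (∫ t in (-(2 * Real.pi / 3 + φ))..(2 * Real.pi / 3 + φ), (u 2 t + u 2 t ^ 2 / 2)) = B2
    set a2 := segmentArea (2 * Real.pi / 3 + φ)
    have hsq : (g.r 0 * Real.sin φ) ^ 2 * a2 =
        (g.r 2 * Real.sin (2 * Real.pi / 3 + φ)) ^ 2 * a2 := by rw [s2]
    linear_combination -(1 + σ) ^ 2 * hsq + (1 + σ) ^ 2 * g.r 0 ^ 2 * A0
      - (1 + σ) ^ 2 * g.r 2 ^ 2 * A2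
      - (1 + σ) ^ 2 * g.r 2 * Real.cos (2 * Real.pi / 3 + φ) * s2

/-- Perimeter and areas of a small perturbation of a symmetric standard double bubble. -/
theorem perimeter_vol_sym {r ε σ : ℝ} {v₀ u₁ u₂ : ℝ → ℝ} {E : DoubleBubble} (hr : 0 < r)
    (hε : ε ≤ 1 / 8) (hσ : -1 < σ) (hv₀ : IsC1ZeroLe (√3 / 2) ε v₀)
    (hu₁ : IsC1ZeroLe (2 * Real.pi / 3) ε u₁) (hu₂ : IsC1ZeroLe (2 * Real.pi / 3) ε u₂)
    (hE : HasSymInterfaces r σ v₀ u₁ u₂ E) :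
    E.perimeter = (1 + σ) * (r * (∫ t in (-(√3 / 2))..(√3 / 2), √(1 + deriv v₀ t ^ 2)) +
        r * (∫ t in (-(2 * Real.pi / 3))..(2 * Real.pi / 3),
          √((1 + u₁ t) ^ 2 + deriv u₁ t ^ 2)) +
        r * (∫ t in (-(2 * Real.pi / 3))..(2 * Real.pi / 3),
          √((1 + u₂ t) ^ 2 + deriv u₂ t ^ 2))) ∧
      E.vol.1 = (1 + σ) ^ 2 * ((r * (√3 / 2)) ^ 2 * segmentArea (2 * Real.pi / 3) +
        r ^ 2 * (∫ t in (-(2 * Real.pi / 3))..(2 * Real.pi / 3), (u₁ t + u₁ t ^ 2 / 2)) +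
        r ^ 2 * ∫ t in (-(√3 / 2))..(√3 / 2), v₀ t) ∧
      E.vol.2 = (1 + σ) ^ 2 * ((r * (√3 / 2)) ^ 2 * segmentArea (2 * Real.pi / 3) +
        r ^ 2 * (∫ t in (-(2 * Real.pi / 3))..(2 * Real.pi / 3), (u₂ t + u₂ t ^ 2 / 2)) -
        r ^ 2 * ∫ t in (-(√3 / 2))..(√3 / 2), v₀ t) := by
  have hσ' : 0 < 1 + σ := by linarith
  have hπ := Real.pi_pos
  have hρ : 0 < (1 + σ) * r := mul_pos hσ' hr
  have h3 : (0 : ℝ) < √3 / 2 := by positivity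
  have m : 0 < 2 * Real.pi / 3 := by linarith
  rw [HasSymInterfaces, leftArc_eq, rightArc_eq, midSegment_eq] at hE
  have D := isInterfaceSystem_sym hρ hε hv₀ hu₁ hu₂
  have hsq3 : √3 ^ 2 = 3 := Real.sq_sqrt (by norm_num)
  have A : segmentArea (2 * Real.pi / 3) * (√3 / 2) ^ 2 = 2 * Real.pi / 3 + √3 / 2 * (1 / 2) := by
    rw [segmentArea, Real.sin_two_pi_div_three, Real.cos_two_pi_div_three,
      div_mul_cancel₀ _ (pow_pos h3 2).ne']
    ring
  have hvol := D.vol_eq hE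
  have hper := D.perimeter_eq hE
  -- `v₀ + t v₀'` is the derivative of `t v₀`, which vanishes at both ends, so only the integral of
  -- `v₀` remains.
  have hflux : flux (fun x : Plane => (1 / 2 : ℝ) • x) (√3 / 2) (fun t => (1 + σ) * r * v₀ t)
      (fun t => (1 + σ) * r * deriv v₀ t) (fun t => (1 + σ) * r * t) (fun _ => (1 + σ) * r * 1) =
      ((1 + σ) * r) ^ 2 * ∫ t in (-(√3 / 2))..(√3 / 2), v₀ t := by
    have hi := hv₀.intervalIntegrable h3
    have hP := ((hasBoundedDerivOn_id (√3 / 2)).mul hv₀.hasBoundedDerivOn)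
    have hP' := hP.integral_deriv_eq_sub h3
    have hi' : IntervalIntegrable (fun t => 1 * v₀ t + t * deriv v₀ t) volume
        (-(√3 / 2)) (√3 / 2) := by
      obtain ⟨M, hM⟩ := hP.bounded_deriv
      exact intervalIntegrable_of_continuousOn_Ioo (M := M) (by linarith) hP.continuousOn_deriv hM
    have h : ∀ t, ((1 / 2 : ℝ) • (!₂[(1 + σ) * r * v₀ t, (1 + σ) * r * t] : Plane)) 0 *
        ((1 + σ) * r * 1) -
        ((1 / 2 : ℝ) • (!₂[(1 + σ) * r * v₀ t, (1 + σ) * r * t] : Plane)) 1 *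
        ((1 + σ) * r * deriv v₀ t) =
        ((1 + σ) * r) ^ 2 * v₀ t - ((1 + σ) * r) ^ 2 / 2 * (1 * v₀ t + t * deriv v₀ t) := by
      intro t
      simp only [PiLp.smul_apply, smul_eq_mul, Matrix.cons_val_zero, Matrix.cons_val_one]
      ring
    rw [flux]
    simp only [h]
    rw [intervalIntegral.integral_sub (hi.const_mul _) (hi'.const_mul _),
      intervalIntegral.integral_const_mul, intervalIntegral.integral_const_mul, hP',
      hv₀.left_zero, hv₀.right_zero]
    ring
  rw [hflux, hu₁.integral_radius_sq m, hu₂.integral_radius_sq m, Real.cos_two_pi_div_three] at hvol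
  rw [arcLength, integral_sqrt_radius hρ, integral_sqrt_radius hρ, integral_sqrt_radius hρ] at hper
  have hcomm : ∀ t, √(deriv v₀ t ^ 2 + 1 ^ 2) = √(1 + deriv v₀ t ^ 2) := fun t => by
    rw [one_pow, add_comm]
  simp only [hcomm] at hper
  refine ⟨by rw [hper]; ring, ?_, ?_⟩
  · rw [hvol.1]
    linear_combination -(1 + σ) ^ 2 * r ^ 2 * A
  · rw [hvol.2]
    linear_combination -(1 + σ) ^ 2 * r ^ 2 * A

/-! ### Stability -/

/-- `exists_arc_excess_ge` for the arc whose chord has half-length one, in terms of the normalised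
change of area. -/
theorem exists_normalized_arc_excess_ge {θ η : ℝ} (hθ : 0 < θ) (hπ : θ < Real.pi) (hη : 0 < η) :
    ∃ ε₁ > (0 : ℝ), ∃ c > (0 : ℝ), ∀ (ε : ℝ) (u : ℝ → ℝ), IsC1ZeroLe θ ε u → ε ≤ ε₁ →
      (segmentStiffness θ - η) / 2 *
          ((∫ t in (-θ)..θ, (u t + u t ^ 2 / 2)) / Real.sin θ ^ 2) ^ 2 +
          c / Real.sin θ * (∫ t in (-θ)..θ, u t ^ 2) ≤
        ((∫ t in (-θ)..θ, √((1 + u t) ^ 2 + deriv u t ^ 2)) - 2 * θ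
          - ∫ t in (-θ)..θ, (u t + u t ^ 2 / 2)) / Real.sin θ := by
  have hs := Real.sin_pos_of_pos_of_lt_pi hθ hπ
  -- The factor `sin³ θ` is what the normalisation of area by `sin² θ` and of length by `sin θ` puts
  -- in front of the coefficient of the squared area.
  obtain ⟨ε₁, hε₁, c, hc, H⟩ := exists_arc_excess_ge hθ hπ (η := η / Real.sin θ ^ 3) (by positivity)
  refine ⟨ε₁, hε₁, c, hc, fun ε u hu hε => ?_⟩
  rw [le_div_iff₀ hs]
  refine le_trans (le_of_eq ?_) (H ε u hu hε)
  rw [segmentStiffness]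
  generalize Real.cos θ / (2 * (Real.sin θ - θ * Real.cos θ)) = q
  generalize (∫ t in (-θ)..θ, (u t + u t ^ 2 / 2)) = B
  field_simp

/-- First order balance of length against area. -/
theorem perimeter_balance {σ P m₁ m₂ s₁ s₂ : ℝ} {A : Fin 3 → ℝ} (hσ : 0 < 1 + σ)
    (h₁ : (1 + σ) ^ 2 * (m₁ + A 1 + A 0) = m₁) (h₂ : (1 + σ) ^ 2 * (m₂ + A 2 - A 0) = m₂)
    (hP : P = 2 * (s₁ * m₁ + s₂ * m₂)) :
    σ * P + (1 + σ) * ((s₁ - s₂) * A 0 + s₁ * A 1 + s₂ * A 2) = σ ^ 2 * P / (2 * (1 + σ)) := by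
  rw [eq_div_iff (by positivity), hP]
  linear_combination 2 * s₁ * h₁ + 2 * s₂ * h₂

theorem segmentArea_mul_sin {θ : ℝ} (hs : 0 < Real.sin θ) :
    Real.sin θ * segmentArea θ = θ / Real.sin θ - Real.cos θ := by
  rw [segmentArea]
  field_simp

/-- Half the perimeter equals the sum of pressure times area, as dilation invariance of the
equilibrium predicts. The 120 degree condition enters through `sin θ₁ - sin θ₂ = sin φ` and `cos θ₁
+ cos θ₂ = -cos φ`, where θ₁, θ₂ are the exterior half-apertures. -/
theorem standard_perimeter_eq {φ : ℝ} (h₀ : 0 < Real.sin φ)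
    (h₁ : 0 < Real.sin (2 * Real.pi / 3 - φ)) (h₂ : 0 < Real.sin (2 * Real.pi / 3 + φ)) :
    Real.sin (2 * Real.pi / 3 - φ) * smallArea φ + Real.sin (2 * Real.pi / 3 + φ) * largeArea φ =
      φ / Real.sin φ + (2 * Real.pi / 3 - φ) / Real.sin (2 * Real.pi / 3 - φ) +
        (2 * Real.pi / 3 + φ) / Real.sin (2 * Real.pi / 3 + φ) := by
  have e₀ := segmentArea_mul_sin h₀
  have e₁ := segmentArea_mul_sin h₁
  have e₂ := segmentArea_mul_sin h₂
  have hs : Real.sin (2 * Real.pi / 3 - φ) - Real.sin (2 * Real.pi / 3 + φ) = Real.sin φ := by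
    rw [Real.sin_sub, Real.sin_add, Real.cos_two_pi_div_three]; ring
  have hc : Real.cos (2 * Real.pi / 3 - φ) + Real.cos (2 * Real.pi / 3 + φ) = -Real.cos φ := by
    rw [Real.cos_sub, Real.cos_add, Real.cos_two_pi_div_three]; ring
  rw [smallArea, largeArea]
  linear_combination e₀ + e₁ + e₂ + segmentArea φ * hs - hc

theorem integral_sqrt_zero (a : ℝ) :
    ∫ t in (-a)..a, √((1 : ℝ) ^ 2 + deriv (fun _ : ℝ => (0 : ℝ)) t ^ 2) =
      2 * a := by
  simp
  ring

theorem integral_area_zero (a : ℝ) :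
    ∫ t in (-a)..a, ((fun _ : ℝ => (0 : ℝ)) t + (fun _ : ℝ => (0 : ℝ)) t ^ 2 / 2) = 0 := by
  simp

/-- Stability of a standard double bubble of given shape. -/
theorem exists_stability_arc {φ : ℝ} (hφ : φ ∈ Ioo 0 (Real.pi / 3)) :
    ∃ ε₁ > (0 : ℝ), ∃ σ₁ > (0 : ℝ), ∃ κ > (0 : ℝ), ∃ K > (0 : ℝ),
      ∀ (g : BubbleGeometry) (E₀ : DoubleBubble), g.θ 0 = φ → IsReferenceBubble g E₀ →
        E₀.vol.2 = K * g.r 2 ^ 2 ∧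
        ∀ (ε σ : ℝ) (u : Fin 3 → ℝ → ℝ) (E : DoubleBubble), ε < ε₁ → |σ| < σ₁ →
          IsPerturbation g E₀ ε σ u E →
            κ * (g.r 2 * σ ^ 2 + ∑ k, g.r k * ∫ t in (-g.θ k)..(g.θ k), u k t ^ 2)
              ≤ E.perimeter - E₀.perimeter := by
  have hπ := Real.pi_pos
  obtain ⟨hφ0, hφ1⟩ := hφ
  have m₁ : 2 * Real.pi / 3 - φ ∈ Ioo 0 Real.pi := ⟨by linarith, by linarith⟩
  have m₂ : 2 * Real.pi / 3 + φ ∈ Ioo 0 Real.pi := ⟨by linarith, by linarith⟩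
  have hs₀ := Real.sin_pos_of_pos_of_lt_pi hφ0 (by linarith)
  have hs₁ := Real.sin_pos_of_pos_of_lt_pi m₁.1 m₁.2
  have hs₂ := Real.sin_pos_of_pos_of_lt_pi m₂.1 m₂.2
  have hsmall := smallArea_pos ⟨hφ0, hφ1⟩
  have hlarge := largeArea_pos ⟨hφ0, hφ1⟩
  have hsum : Real.sin φ = Real.sin (2 * Real.pi / 3 - φ) - Real.sin (2 * Real.pi / 3 + φ) := by
    rw [Real.sin_sub, Real.sin_add, Real.cos_two_pi_div_three]; ring
  have hper₀ := standard_perimeter_eq hs₀ hs₁ hs₂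
  obtain ⟨c₀, hc₀, hform⟩ := exists_form_ge ⟨hφ0, hφ1⟩
  obtain ⟨ε₀, hε₀, Hper⟩ := exists_perimeter_vol_arc ⟨hφ0, hφ1⟩
  set P := 2 * (Real.sin (2 * Real.pi / 3 - φ) * smallArea φ +
    Real.sin (2 * Real.pi / 3 + φ) * largeArea φ) with hP
  obtain ⟨η, hη, σ₁, hσ₁, hσ₁2, c, hc, Hstab⟩ := exists_stability_of_form_ge (P := P)
    (m₁ := smallArea φ) (m₂ := largeArea φ) (c₀ := c₀)
    (κ := ![segmentStiffness φ, segmentStiffness (2 * Real.pi / 3 - φ),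
      segmentStiffness (2 * Real.pi / 3 + φ)]) (by positivity) hc₀
    (fun x y => (hform x y).trans_eq (by
      simp only [Matrix.cons_val_zero, Matrix.cons_val_one, Matrix.cons_val_two, Matrix.head_cons,
        Matrix.tail_cons, hP]
      ring))
  obtain ⟨δ₀, hδ₀, a₀, ha₀, X₀⟩ := exists_normalized_arc_excess_ge hφ0 (by linarith) hη
  obtain ⟨δ₁, hδ₁, a₁, ha₁, X₁⟩ := exists_normalized_arc_excess_ge m₁.1 m₁.2 hη
  obtain ⟨δ₂, hδ₂, a₂, ha₂, X₂⟩ := exists_normalized_arc_excess_ge m₂.1 m₂.2 hη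
  refine ⟨min ε₀ (min δ₀ (min δ₁ δ₂)), by positivity, σ₁, hσ₁,
    min (Real.sin (2 * Real.pi / 3 + φ) * c) (min (a₀ / 2) (min (a₁ / 2) (a₂ / 2))),
    by positivity, Real.sin (2 * Real.pi / 3 + φ) ^ 2 * largeArea φ, by positivity, ?_⟩
  intro g E₀ h0 href
  have h1 : g.θ 1 = 2 * Real.pi / 3 - φ := by have := g.angle₁; linarith
  have h2 : g.θ 2 = 2 * Real.pi / 3 + φ := by have := g.angle₂; linarith
  have s1 := g.sin_eq₁
  have s2 := g.sin_eq₂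
  rw [h0, h1] at s1
  rw [h0, h2] at s2
  have hr₀ := g.r_pos 0
  have hr₁ := g.r_pos 1
  have hr₂ := g.r_pos 2
  -- Half the distance between the singular points: the only length scale. Every radius is h divided
  -- by the sine of its aperture, so h factors out of the whole estimate.
  set h := g.r 0 * Real.sin φ with hh
  have hpos : 0 < h := by positivity
  have q₀ : g.r 0 = h / Real.sin φ := by rw [hh]; field_simp
  have q₁ : g.r 1 = h / Real.sin (2 * Real.pi / 3 - φ) := eq_div_of_mul_eq hs₁.ne' s1.symm
  have q₂ : g.r 2 = h / Real.sin (2 * Real.pi / 3 + φ) := eq_div_of_mul_eq hs₂.ne' s2.symm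
  obtain ⟨P₀, V₁, V₂⟩ := Hper g 0 0 (fun _ _ => 0) E₀ h0 hε₀.le (by norm_num)
    (fun k => IsC1ZeroLe.zero _) href
  rw [h0, ← hh] at V₁ V₂
  simp only [integral_area_zero, mul_zero, add_zero, sub_zero, one_pow, one_mul] at V₁ V₂
  simp only [integral_sqrt_zero, add_zero, one_mul, Fin.sum_univ_three, h0, h1, h2] at P₀
  refine ⟨by rw [V₂, s2]; ring, ?_⟩
  intro ε σ u E hε hσ hE
  have u0 := hE.small 0
  have u1 := hE.small 1
  have u2 := hE.small 2
  have hε0 : ε ≤ ε₀ := hε.le.trans (min_le_left _ _)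
  have hε1 : ε ≤ δ₀ := hε.le.trans ((min_le_right _ _).trans (min_le_left _ _))
  have hε2 : ε ≤ δ₁ :=
    hε.le.trans ((min_le_right _ _).trans ((min_le_right _ _).trans (min_le_left _ _)))
  have hε3 : ε ≤ δ₂ :=
    hε.le.trans ((min_le_right _ _).trans ((min_le_right _ _).trans (min_le_right _ _)))
  have hσp : 0 < 1 + σ := by linarith [(abs_lt.1 hσ).1]
  obtain ⟨PE, W₁, W₂⟩ := Hper g ε σ u E h0 hε0 (by linarith) hE.small hE.interfaces
  rw [hE.vol_eq, h0, ← hh] at W₁ W₂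
  rw [V₁, h1] at W₁
  rw [V₂, h2] at W₂
  rw [Fin.sum_univ_three] at PE ⊢
  rw [h0] at u0
  rw [h1] at u1
  rw [h2] at u2
  rw [h0, h1, h2] at PE ⊢
  have x₀ := X₀ ε (u 0) u0 hε1
  have x₁ := X₁ ε (u 1) u1 hε2
  have x₂ := X₂ ε (u 2) u2 hε3
  have n₀ := IsC1ZeroLe.integral_sq_nonneg hφ0 (u 0)
  have n₁ := IsC1ZeroLe.integral_sq_nonneg m₁.1 (u 1)
  have n₂ := IsC1ZeroLe.integral_sq_nonneg m₂.1 (u 2)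
  rw [P₀, PE]
  clear X₀ X₁ X₂ P₀ PE Hper hform V₁ V₂
  generalize (∫ t in (-φ)..φ, (u 0 t + u 0 t ^ 2 / 2)) = B₀ at *
  generalize (∫ t in (-(2 * Real.pi / 3 - φ))..(2 * Real.pi / 3 - φ),
    (u 1 t + u 1 t ^ 2 / 2)) = B₁ at *
  generalize (∫ t in (-(2 * Real.pi / 3 + φ))..(2 * Real.pi / 3 + φ),
    (u 2 t + u 2 t ^ 2 / 2)) = B₂ at *
  generalize (∫ t in (-φ)..φ, u 0 t ^ 2) = I₀ at *
  generalize (∫ t in (-(2 * Real.pi / 3 - φ))..(2 * Real.pi / 3 - φ), u 1 t ^ 2) = I₁ at *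
  generalize (∫ t in (-(2 * Real.pi / 3 + φ))..(2 * Real.pi / 3 + φ), u 2 t ^ 2) = I₂ at *
  generalize (∫ t in (-φ)..φ, √((1 + u 0 t) ^ 2 + deriv (u 0) t ^ 2)) = L₀ at *
  generalize (∫ t in (-(2 * Real.pi / 3 - φ))..(2 * Real.pi / 3 - φ),
    √((1 + u 1 t) ^ 2 + deriv (u 1) t ^ 2)) = L₁ at *
  generalize (∫ t in (-(2 * Real.pi / 3 + φ))..(2 * Real.pi / 3 + φ),
    √((1 + u 2 t) ^ 2 + deriv (u 2) t ^ 2)) = L₂ at *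
  generalize hθ₁ : 2 * Real.pi / 3 - φ = θ₁ at *
  generalize hθ₂ : 2 * Real.pi / 3 + φ = θ₂ at *
  rw [q₀, q₁] at W₁
  rw [q₀, q₂] at W₂
  rw [q₀, q₁, q₂]
  generalize Real.sin φ = s₀ at *
  generalize Real.sin θ₁ = s₁ at *
  generalize Real.sin θ₂ = s₂ at *
  have hh2 : 0 < h ^ 2 := pow_pos hpos 2
  have W₁' : (1 + σ) ^ 2 * (smallArea φ + B₁ / s₁ ^ 2 + B₀ / s₀ ^ 2) = smallArea φ := by
    apply mul_left_cancel₀ hh2.ne'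
    rw [W₁]
    ring
  have W₂' : (1 + σ) ^ 2 * (largeArea φ + B₂ / s₂ ^ 2 - B₀ / s₀ ^ 2) = largeArea φ := by
    apply mul_left_cancel₀ hh2.ne'
    rw [W₂]
    ring
  set A : Fin 3 → ℝ := ![B₀ / s₀ ^ 2, B₁ / s₁ ^ 2, B₂ / s₂ ^ 2] with hA
  have stab := Hstab σ A ![(L₀ - 2 * φ - B₀) / s₀, (L₁ - 2 * θ₁ - B₁) / s₁, (L₂ - 2 * θ₂ - B₂) / s₂]
    ![a₀ / s₀ * I₀, a₁ / s₁ * I₁, a₂ / s₂ * I₂] hσ W₁' W₂'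
    (fun k => by fin_cases k <;> simp <;> positivity)
    (fun k => by
      fin_cases k
      · exact x₀
      · exact x₁
      · exact x₂)
  -- This exchanges the quadratic dilation term for the first order terms that were subtracted from
  -- the lengths, which turns the stability bound into one for the actual perimeter gap divided by
  -- h.
  have bal := perimeter_balance (A := A) (s₁ := s₁) (s₂ := s₂) hσp W₁' W₂' hP
  rw [← bal] at stab
  simp only [Fin.sum_univ_three, hA, Matrix.cons_val_zero, Matrix.cons_val_one, Matrix.cons_val_two,
    Matrix.head_cons, Matrix.tail_cons, ← hsum] at stab
  rw [hper₀] at hP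
  set κ := min (s₂ * c) (min (a₀ / 2) (min (a₁ / 2) (a₂ / 2))) with hκ
  have k1 : κ ≤ s₂ * c := min_le_left _ _
  have k2 : κ ≤ a₀ / 2 := (min_le_right _ _).trans (min_le_left _ _)
  have k3 : κ ≤ a₁ / 2 := (min_le_right _ _).trans ((min_le_right _ _).trans (min_le_left _ _))
  have k4 : κ ≤ a₂ / 2 := (min_le_right _ _).trans ((min_le_right _ _).trans (min_le_right _ _))
  have j1 : κ * (h / s₂ * σ ^ 2) ≤ s₂ * c * (h / s₂ * σ ^ 2) :=
    mul_le_mul_of_nonneg_right k1 (by positivity)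
  have j2 : κ * (h / s₀ * I₀) ≤ a₀ / 2 * (h / s₀ * I₀) :=
    mul_le_mul_of_nonneg_right k2 (by positivity)
  have j3 : κ * (h / s₁ * I₁) ≤ a₁ / 2 * (h / s₁ * I₁) :=
    mul_le_mul_of_nonneg_right k3 (by positivity)
  have j4 : κ * (h / s₂ * I₂) ≤ a₂ / 2 * (h / s₂ * I₂) :=
    mul_le_mul_of_nonneg_right k4 (by positivity)
  have fin := mul_le_mul_of_nonneg_left stab hpos.le
  have e1 : s₂ * c * (h / s₂ * σ ^ 2) = h * (c * σ ^ 2) := by field_simp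
  calc κ * (h / s₂ * σ ^ 2 + (h / s₀ * I₀ + h / s₁ * I₁ + h / s₂ * I₂))
      ≤ h * (c * σ ^ 2 + (a₀ / s₀ * I₀ + a₁ / s₁ * I₁ + a₂ / s₂ * I₂) / 2) := by
        rw [mul_add, mul_add h, ← e1]
        have e2 : h * ((a₀ / s₀ * I₀ + a₁ / s₁ * I₁ + a₂ / s₂ * I₂) / 2) =
            a₀ / 2 * (h / s₀ * I₀) + a₁ / 2 * (h / s₁ * I₁) + a₂ / 2 * (h / s₂ * I₂) := by ring
        linarith
    _ ≤ _ := fin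
    _ = _ := by
        rw [hP]
        field_simp
        ring

/-- Stability of the symmetric standard double bubble. -/
theorem exists_stability_sym :
    ∃ ε₁ > (0 : ℝ), ∃ σ₁ > (0 : ℝ), ∃ κ > (0 : ℝ), ∃ K > (0 : ℝ),
      ∀ (r : ℝ) (E₀ : DoubleBubble), IsSymReferenceBubble r E₀ →
        E₀.vol.2 = K * r ^ 2 ∧
        ∀ (ε σ : ℝ) (v₀ u₁ u₂ : ℝ → ℝ) (E : DoubleBubble), ε < ε₁ → |σ| < σ₁ →
          IsSymPerturbation r E₀ ε σ v₀ u₁ u₂ E →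
            κ * (r * σ ^ 2 + r * (∫ t in (-(√3 / 2))..(√3 / 2), v₀ t ^ 2)
              + r * (∫ t in (-(2 * Real.pi / 3))..(2 * Real.pi / 3), u₁ t ^ 2)
              + r * (∫ t in (-(2 * Real.pi / 3))..(2 * Real.pi / 3), u₂ t ^ 2))
              ≤ E.perimeter - E₀.perimeter := by
  have hπ := Real.pi_pos
  have ha : (0 : ℝ) < √3 / 2 := by positivity
  have m : 2 * Real.pi / 3 ∈ Ioo 0 Real.pi := ⟨by linarith, by linarith⟩
  have hs : Real.sin (2 * Real.pi / 3) = √3 / 2 := Real.sin_two_pi_div_three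
  have hG := segmentArea_pos m.1 m.2
  have hGs := segmentArea_mul_sin (θ := 2 * Real.pi / 3) (hs ▸ ha)
  rw [hs, Real.cos_two_pi_div_three] at hGs
  obtain ⟨c₀, hc₀, hform⟩ := exists_form_ge_sym
  set P := 2 * (√3 / 2 * segmentArea (2 * Real.pi / 3) +
    √3 / 2 * segmentArea (2 * Real.pi / 3)) with hP
  obtain ⟨η, hη, σ₁, hσ₁, hσ₁2, c, hc, Hstab⟩ := exists_stability_of_form_ge (P := P)
    (m₁ := segmentArea (2 * Real.pi / 3)) (m₂ := segmentArea (2 * Real.pi / 3)) (c₀ := c₀)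
    (κ := ![1, segmentStiffness (2 * Real.pi / 3), segmentStiffness (2 * Real.pi / 3)])
    (by positivity) hc₀
    (fun x y => (hform x y).trans_eq (by
      simp only [Matrix.cons_val_zero, Matrix.cons_val_one, Matrix.cons_val_two, Matrix.head_cons,
        Matrix.tail_cons, hP]
      ring))
  obtain ⟨δ₀, hδ₀, a₀, ha₀, X₀⟩ := exists_segment_excess_ge ha
  obtain ⟨δ₁, hδ₁, a₁, ha₁, X₁⟩ := exists_normalized_arc_excess_ge m.1 m.2 hη
  refine ⟨min (1 / 8) (min δ₀ δ₁), by positivity, σ₁, hσ₁,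
    min (√3 / 2 * c) (min (a₀ / 2) (a₁ / 2)), by positivity,
    (√3 / 2) ^ 2 * segmentArea (2 * Real.pi / 3), by positivity, ?_⟩
  rintro r E₀ ⟨hr, href⟩
  obtain ⟨P₀, V₁, V₂⟩ := perimeter_vol_sym hr (by norm_num) (by norm_num) (IsC1ZeroLe.zero _)
    (IsC1ZeroLe.zero _) (IsC1ZeroLe.zero _) href
  simp only [integral_area_zero, intervalIntegral.integral_zero, mul_zero, add_zero, sub_zero,
    one_pow, one_mul] at V₁ V₂
  have hseg : ∫ t in (-(√3 / 2))..(√3 / 2), √(1 + deriv (fun _ : ℝ => (0 : ℝ)) t ^ 2) =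
      2 * (√3 / 2) := by
    simp
    ring
  simp only [integral_sqrt_zero, add_zero, one_mul, hseg] at P₀
  refine ⟨by rw [V₂]; ring, ?_⟩
  intro ε σ v₀ u₁ u₂ E hε hσ hE
  have v0 := hE.small₀
  have u1 := hE.small₁
  have u2 := hE.small₂
  have hε0 : ε ≤ 1 / 8 := hε.le.trans (min_le_left _ _)
  have hε1 : ε ≤ δ₀ := hε.le.trans ((min_le_right _ _).trans (min_le_left _ _))
  have hε2 : ε ≤ δ₁ := hε.le.trans ((min_le_right _ _).trans (min_le_right _ _))
  have hσp : 0 < 1 + σ := by linarith [(abs_lt.1 hσ).1]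
  obtain ⟨PE, W₁, W₂⟩ := perimeter_vol_sym hr hε0 (by linarith) v0 u1 u2 hE.interfaces
  rw [hE.vol_eq, V₁] at W₁
  rw [hE.vol_eq, V₂] at W₂
  have x₀ := X₀ ε v₀ v0 hε1
  have x₁ := X₁ ε u₁ u1 hε2
  have x₂ := X₁ ε u₂ u2 hε2
  have n₀ := IsC1ZeroLe.integral_sq_nonneg ha v₀
  have n₁ := IsC1ZeroLe.integral_sq_nonneg m.1 u₁
  have n₂ := IsC1ZeroLe.integral_sq_nonneg m.1 u₂
  rw [P₀, PE]
  rw [hs] at x₁ x₂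
  clear X₀ X₁ P₀ PE hform V₁ V₂
  generalize (∫ t in (-(√3 / 2))..(√3 / 2), v₀ t) = B₀ at *
  generalize (∫ t in (-(2 * Real.pi / 3))..(2 * Real.pi / 3), (u₁ t + u₁ t ^ 2 / 2)) = B₁ at *
  generalize (∫ t in (-(2 * Real.pi / 3))..(2 * Real.pi / 3), (u₂ t + u₂ t ^ 2 / 2)) = B₂ at *
  generalize (∫ t in (-(√3 / 2))..(√3 / 2), v₀ t ^ 2) = I₀ at *
  generalize (∫ t in (-(2 * Real.pi / 3))..(2 * Real.pi / 3), u₁ t ^ 2) = I₁ at *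
  generalize (∫ t in (-(2 * Real.pi / 3))..(2 * Real.pi / 3), u₂ t ^ 2) = I₂ at *
  generalize (∫ t in (-(√3 / 2))..(√3 / 2), √(1 + deriv v₀ t ^ 2)) = L₀ at *
  generalize (∫ t in (-(2 * Real.pi / 3))..(2 * Real.pi / 3),
    √((1 + u₁ t) ^ 2 + deriv u₁ t ^ 2)) = L₁ at *
  generalize (∫ t in (-(2 * Real.pi / 3))..(2 * Real.pi / 3),
    √((1 + u₂ t) ^ 2 + deriv u₂ t ^ 2)) = L₂ at *
  generalize 2 * Real.pi / 3 = θ at *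
  generalize √3 / 2 = a at *
  have hh2 : 0 < (r * a) ^ 2 := by positivity
  have W₁' : (1 + σ) ^ 2 * (segmentArea θ + B₁ / a ^ 2 + B₀ / a ^ 2) = segmentArea θ := by
    apply mul_left_cancel₀ hh2.ne'
    rw [W₁]
    field_simp
  have W₂' : (1 + σ) ^ 2 * (segmentArea θ + B₂ / a ^ 2 - B₀ / a ^ 2) = segmentArea θ := by
    apply mul_left_cancel₀ hh2.ne'
    rw [W₂]
    field_simp
  -- The segment estimate holds without the loss η; it is weakened only to match the form required
  -- for all three interfaces. A segment has zero curvature, so no area is subtracted from its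
  -- length.
  have x₀' : (1 - η) / 2 * (B₀ / a ^ 2) ^ 2 + a₀ / a * I₀ ≤ (L₀ - 2 * a) / a := by
    rw [le_div_iff₀ ha]
    refine le_trans ?_ x₀
    have e : ((1 - η) / 2 * (B₀ / a ^ 2) ^ 2 + a₀ / a * I₀) * a =
        1 / a ^ 3 / 2 * B₀ ^ 2 + a₀ * I₀ - η / 2 * (1 / a ^ 3 * B₀ ^ 2) := by
      field_simp
      ring
    have : 0 ≤ η / 2 * (1 / a ^ 3 * B₀ ^ 2) := by positivity
    linarith
  set A : Fin 3 → ℝ := ![B₀ / a ^ 2, B₁ / a ^ 2, B₂ / a ^ 2] with hA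
  have stab := Hstab σ A ![(L₀ - 2 * a) / a, (L₁ - 2 * θ - B₁) / a, (L₂ - 2 * θ - B₂) / a]
    ![a₀ / a * I₀, a₁ / a * I₁, a₁ / a * I₂] hσ W₁' W₂'
    (fun k => by fin_cases k <;> simp <;> positivity)
    (fun k => by
      fin_cases k
      · exact x₀'
      · exact x₁
      · exact x₂)
  have bal := perimeter_balance (A := A) (s₁ := a) (s₂ := a) hσp W₁' W₂' hP
  rw [← bal] at stab
  simp only [Fin.sum_univ_three, hA, Matrix.cons_val_zero, Matrix.cons_val_one, Matrix.cons_val_two,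
    Matrix.head_cons, Matrix.tail_cons] at stab
  rw [hGs] at hP
  set κ := min (a * c) (min (a₀ / 2) (a₁ / 2)) with hκ
  have k1 : κ ≤ a * c := min_le_left _ _
  have k2 : κ ≤ a₀ / 2 := (min_le_right _ _).trans (min_le_left _ _)
  have k3 : κ ≤ a₁ / 2 := (min_le_right _ _).trans (min_le_right _ _)
  have j1 : κ * (r * σ ^ 2) ≤ a * c * (r * σ ^ 2) :=
    mul_le_mul_of_nonneg_right k1 (by positivity)
  have j2 : κ * (r * I₀) ≤ a₀ / 2 * (r * I₀) := mul_le_mul_of_nonneg_right k2 (by positivity)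
  have j3 : κ * (r * I₁) ≤ a₁ / 2 * (r * I₁) := mul_le_mul_of_nonneg_right k3 (by positivity)
  have j4 : κ * (r * I₂) ≤ a₁ / 2 * (r * I₂) := mul_le_mul_of_nonneg_right k3 (by positivity)
  have fin := mul_le_mul_of_nonneg_left stab (mul_pos hr ha).le
  calc κ * (r * σ ^ 2 + r * I₀ + r * I₁ + r * I₂)
      ≤ a * c * (r * σ ^ 2) + a₀ / 2 * (r * I₀) + a₁ / 2 * (r * I₁) + a₁ / 2 * (r * I₂) := by
        linarith
    _ = r * a * (c * σ ^ 2 + (a₀ / a * I₀ + a₁ / a * I₁ + a₁ / a * I₂) / 2) := by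
        field_simp
        ring
    _ ≤ _ := fin
    _ = _ := by
        rw [hP]
        field_simp
        ring

/-- Stability of all standard double bubbles with chambers in a given ratio. -/
theorem exists_stability_of_ratio (ρ : ℝ) :
    ∃ ε₁ > (0 : ℝ), ∃ σ₁ > (0 : ℝ), ∃ κ > (0 : ℝ), ∃ K > (0 : ℝ),
      ∀ (g : BubbleGeometry) (E₀ : DoubleBubble), IsReferenceBubble g E₀ →
        E₀.vol.1 / E₀.vol.2 = ρ →
        E₀.vol.2 = K * g.r 2 ^ 2 ∧
        ∀ (ε σ : ℝ) (u : Fin 3 → ℝ → ℝ) (E : DoubleBubble), ε < ε₁ → |σ| < σ₁ →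
          IsPerturbation g E₀ ε σ u E →
            κ * (g.r 2 * σ ^ 2 + ∑ k, g.r k * ∫ t in (-g.θ k)..(g.θ k), u k t ^ 2)
              ≤ E.perimeter - E₀.perimeter := by
  have key : ∀ (g : BubbleGeometry) (E₀ : DoubleBubble), IsReferenceBubble g E₀ →
      g.θ 0 ∈ Ioo 0 (Real.pi / 3) ∧
        E₀.vol.1 / E₀.vol.2 = smallArea (g.θ 0) / largeArea (g.θ 0) := by
    intro g E₀ href
    have hmem : g.θ 0 ∈ Ioo 0 (Real.pi / 3) :=
      ⟨g.θ_pos 0, by linarith [g.angle₂, g.θ_lt_pi 2]⟩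
    refine ⟨hmem, ?_⟩
    obtain ⟨ε₀, hε₀, Hper⟩ := exists_perimeter_vol_arc hmem
    obtain ⟨-, V₁, V₂⟩ := Hper g 0 0 (fun _ _ => 0) E₀ rfl hε₀.le (by norm_num)
      (fun k => IsC1ZeroLe.zero _) href
    simp only [integral_area_zero, mul_zero, add_zero, sub_zero, one_pow, one_mul] at V₁ V₂
    have hs := Real.sin_pos_of_pos_of_lt_pi (g.θ_pos 0) (g.θ_lt_pi 0)
    rw [V₁, V₂, mul_div_mul_left _ _ (pow_pos (mul_pos (g.r_pos 0) hs) 2).ne']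
  -- The constants are chosen from ρ before any bubble is given. If no shape realises the ratio
  -- there is no reference bubble to consider, and any constants do.
  by_cases hex : ∃ φ ∈ Ioo 0 (Real.pi / 3), smallArea φ / largeArea φ = ρ
  · obtain ⟨φ, hφ, hρ⟩ := hex
    obtain ⟨ε₁, hε₁, σ₁, hσ₁, κ, hκ, K, hK, H⟩ := exists_stability_arc hφ
    refine ⟨ε₁, hε₁, σ₁, hσ₁, κ, hκ, K, hK, fun g E₀ href hr => ?_⟩
    obtain ⟨hmem, hratio⟩ := key g E₀ href
    exact H g E₀ (eq_of_area_ratio_eq hmem hφ (by rw [← hratio, hr, hρ])) href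
  · refine ⟨1, one_pos, 1, one_pos, 1, one_pos, 1, one_pos, fun g E₀ href hr => ?_⟩
    obtain ⟨hmem, hratio⟩ := key g E₀ href
    exact absurd ⟨_, hmem, by rw [← hratio, hr]⟩ hex

/-- The scale invariant estimate carries `r σ²`, the other one `σ²`. Since the area m determines r,
the factor `min 1 r` can be written in terms of m alone, and so fixed before the bubble is. -/
theorem min_mul_le_of_sq_le {κ m K r σ S D : ℝ} (hκ : 0 < κ) (hK : 0 < K) (hr : 0 < r)
    (hm : m = K * r ^ 2) (hS : 0 ≤ S) (h : κ * (r * σ ^ 2 + S) ≤ D) :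
    κ * min 1 √(m / K) * (σ ^ 2 + S) ≤ D := by
  have e : √(m / K) = r := by
    rw [hm, mul_div_cancel_left₀ _ hK.ne', Real.sqrt_sq hr.le]
  rw [e, mul_assoc]
  refine le_trans (mul_le_mul_of_nonneg_left ?_ hκ.le) h
  rw [mul_add]
  exact add_le_add (mul_le_mul_of_nonneg_right (min_le_right _ _) (sq_nonneg σ))
    (mul_le_of_le_one_left hS (min_le_left _ _))

end

theorem theorem3p3 (ρ : ℝ) (hρ0 : 0 < ρ) (hρ1 : ρ ≤ 1) :
    ∃ ε₁ > (0 : ℝ), ∃ σ₁ > (0 : ℝ), ∃ κ > (0 : ℝ),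
      ∀ m₁ m₂ : ℝ, 0 < m₁ → m₁ ≤ m₂ → m₁ / m₂ = ρ →
        ∃ κ₁ > (0 : ℝ),
          (m₁ < m₂ →
            ∀ (g : BubbleGeometry) (E₀ : DoubleBubble),
              IsReferenceBubble g E₀ → E₀.vol = (m₁, m₂) →
              ∀ (ε σ : ℝ) (u : Fin 3 → ℝ → ℝ) (E : DoubleBubble),
                0 < ε → ε < ε₁ → |σ| < σ₁ → IsPerturbation g E₀ ε σ u E →
                  κ₁ * (σ ^ 2 + ∑ k, g.r k * ∫ t in (-g.θ k)..(g.θ k), u k t ^ 2)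
                      ≤ E.perimeter - E₀.perimeter ∧
                  κ * (g.r 2 * σ ^ 2 + ∑ k, g.r k * ∫ t in (-g.θ k)..(g.θ k), u k t ^ 2)
                      ≤ E.perimeter - E₀.perimeter) ∧
          (m₁ = m₂ →
            ∀ (r : ℝ) (E₀ : DoubleBubble),
              IsSymReferenceBubble r E₀ → E₀.vol = (m₁, m₂) →
              ∀ (ε σ : ℝ) (v₀ u₁ u₂ : ℝ → ℝ) (E : DoubleBubble),
                0 < ε → ε < ε₁ → |σ| < σ₁ → IsSymPerturbation r E₀ ε σ v₀ u₁ u₂ E →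
                  κ₁ * (σ ^ 2 + r * (∫ t in (-(√3 / 2))..(√3 / 2), v₀ t ^ 2)
                        + r * (∫ t in (-(2 * Real.pi / 3))..(2 * Real.pi / 3), u₁ t ^ 2)
                        + r * (∫ t in (-(2 * Real.pi / 3))..(2 * Real.pi / 3), u₂ t ^ 2))
                      ≤ E.perimeter - E₀.perimeter ∧
                  κ * (r * σ ^ 2 + r * (∫ t in (-(√3 / 2))..(√3 / 2), v₀ t ^ 2)
                        + r * (∫ t in (-(2 * Real.pi / 3))..(2 * Real.pi / 3), u₁ t ^ 2)
                        + r * (∫ t in (-(2 * Real.pi / 3))..(2 * Real.pi / 3), u₂ t ^ 2))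
                      ≤ E.perimeter - E₀.perimeter) := by
  obtain ⟨ε₁, hε₁, σ₁, hσ₁, κ, hκ, K, hK, H⟩ := exists_stability_of_ratio ρ
  obtain ⟨ε₂, hε₂, σ₂, hσ₂, κ', hκ', K', hK', H'⟩ := exists_stability_sym
  refine ⟨min ε₁ ε₂, lt_min hε₁ hε₂, min σ₁ σ₂, lt_min hσ₁ hσ₂, min κ κ', lt_min hκ hκ', ?_⟩
  intro m₁ m₂ hm₁ hle hratio
  have hm₂ : 0 < m₂ := hm₁.trans_le hle
  have hκm : 0 < min κ κ' := lt_min hκ hκ'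
  have hd : 0 < min 1 √(m₂ / K) := lt_min one_pos (Real.sqrt_pos.2 (div_pos hm₂ hK))
  have hd' : 0 < min 1 √(m₂ / K') := lt_min one_pos (Real.sqrt_pos.2 (div_pos hm₂ hK'))
  have mono : ∀ {c d X D : ℝ}, 0 ≤ X → c ≤ d → d * X ≤ D → c * X ≤ D := fun hX hcd h =>
    (mul_le_mul_of_nonneg_right hcd hX).trans h
  -- Both cases must share one κ₁, so it is the minimum of the constants obtained from the two area
  -- laws `m₂ = K r₂²` and `m₂ = K' r²`.
  refine ⟨min (min κ κ' * min 1 √(m₂ / K)) (min κ κ' * min 1 √(m₂ / K')),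
    lt_min (mul_pos hκm hd) (mul_pos hκm hd'), fun _ => ?_, fun _ => ?_⟩
  · intro g E₀ href hvol ε σ u E _ hε hσ hE
    obtain ⟨hV, hstab⟩ := H g E₀ href (by rw [hvol, hratio])
    have h := hstab ε σ u E (hε.trans_le (min_le_left _ _)) (hσ.trans_le (min_le_left _ _)) hE
    rw [hvol] at hV
    have hS : 0 ≤ ∑ k, g.r k * ∫ t in (-g.θ k)..(g.θ k), u k t ^ 2 :=
      Finset.sum_nonneg fun k _ => mul_nonneg (g.r_pos k).le
        (IsC1ZeroLe.integral_sq_nonneg (g.θ_pos k) (u k))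
    have hr := g.r_pos 2
    have h' := mono (by positivity) (min_le_left κ κ') h
    exact ⟨mono (by positivity) (min_le_left _ _) (min_mul_le_of_sq_le hκm hK hr hV hS h'), h'⟩
  · intro r E₀ href hvol ε σ v₀ u₁ u₂ E _ hε hσ hE
    obtain ⟨hV, hstab⟩ := H' r E₀ href
    have h := hstab ε σ v₀ u₁ u₂ E (hε.trans_le (min_le_right _ _)) (hσ.trans_le (min_le_right _ _))
      hE
    rw [hvol] at hV
    have hr := href.1
    have n₀ := mul_nonneg hr.le (IsC1ZeroLe.integral_sq_nonneg (θ := √3 / 2) (by positivity) v₀)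
    have hθ : 0 < 2 * Real.pi / 3 := by have := Real.pi_pos; positivity
    have n₁ := mul_nonneg hr.le (IsC1ZeroLe.integral_sq_nonneg hθ u₁)
    have n₂ := mul_nonneg hr.le (IsC1ZeroLe.integral_sq_nonneg hθ u₂)
    have hX : 0 ≤ r * σ ^ 2 := by positivity
    have h' := mono (by linarith) (min_le_right κ κ') h
    refine ⟨?_, h'⟩
    rw [add_assoc, add_assoc] at h' ⊢
    exact mono (add_nonneg (sq_nonneg σ) (by linarith)) (min_le_right _ _)
      (min_mul_le_of_sq_le hκm hK' hr hV (by linarith) h')
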